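/- **Setting.** An instance of multi-robot motion planning with given paths (MRMP-GP) consists of a finite undirected graph $W$ and $n$ robots; robot $r$ has a source $s(r)$, a target $t(r)$ and a path $\pi(r)$ in $W$ from $s(r)$ to $t(r)$ that visits no vertex twice. Initially every robot is at its source. A legal move advances a single robot to the next vertex of its path, provided that no other robot is located there; backward moves are not allowed. A *solution* is a finite sequence of legal moves after which every robot is at its target, with no collision at any time (in particular, an instance in which two robots share a source has no solution). The instance has *non-blocking targets* if no $t(r')$ lies on $\pi(r)$ for $r\neq r'$. Its *vertex multiplicity* is $\max_v |\{r : v\in\pi(r)\}|$. MRMP-GP-NBT(2,0) is the problem restricted to instances in which $W$ is a 2D (rectangular) grid graph, each path is contained in a single row or a single column of $W$, targets are non-blocking, and the vertex multiplicity is at most $2$. The input is given compactly: the number $n$ of robots, the dimensions of the grid, and the coordinates of the source and the target of every robot. A solution may be output compactly as a list of pairs $(r,v)$, meaning that robot $r$ advances along its path, move by move, until it is at vertex $v$. The running time is measured on a random access machine with integer registers, (two-dimensional) integer arrays and an output tape, at unit cost per step, whose arithmetic is restricted to copying and comparing integers and adding fixed constants. **Theorem.** There is an algorithm that, for every instance of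 MRMP-GP-NBT(2,0) with $n$ robots, halts after $O(n^2)$ steps and outputs a solution if one exists, and otherwise reports that no solution exists. The constant in the bound is absolute; in particular the bound does not depend on the size of the grid or on the lengths of the paths. -/

import Mathlib

namespace MRMP

/-! ## Multi-robot motion planning with given paths -/

/-- An instance with `n` robots on the workspace `W`: every robot has a source, a target, and a
path of `W` (no repeated vertices) from its source to its target. -/
structure MRMPGP {V : Type*} (W : SimpleGraph V) (n : ℕ) where
  src : Fin n → V
  trg : Fin n → V
  path : ∀ r : Fin n, W.Walk (src r) (trg r)
  isPath : ∀ r : Fin n, (path r).IsPath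

/-- A configuration tells how many edges of its path each robot has traversed so far. -/
abbrev Config (n : ℕ) : Type := Fin n → ℕ

namespace MRMPGP

variable {V : Type*} {W : SimpleGraph V} {n : ℕ}

/-- The vertex at which robot `r` is located in configuration `c`. -/
def loc (M : MRMPGP W n) (c : Config n) (r : Fin n) : V := (M.path r).getVert (c r)

/-- All robots at their sources. -/
def start : Config n := fun _ => 0

/-- All robots at their targets. -/
def goal (M : MRMPGP W n) : Config n := fun r => (M.path r).length

/-- Robot `r` advances by one edge of its path. -/
def advance (c : Config n) (r : Fin n) : Config n := Function.update c r (c r + 1)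

/-- In configuration `c` robot `r` may move to the next vertex on its path: it is not yet at its
target, and no other robot is located at the next vertex. -/
def Legal (M : MRMPGP W n) (c : Config n) (r : Fin n) : Prop :=
  c r < (M.path r).length ∧ ∀ r' : Fin n, r' ≠ r → M.loc c r' ≠ (M.path r).getVert (c r + 1)

/-- The sequence of moves `plan` (the list of the robots that move, in order) consists of legal
moves and leads from the first configuration to the second. -/
def Leads (M : MRMPGP W n) : Config n → List (Fin n) → Config n → Prop
  | c, [], d => c = d
  | c, r :: plan, d => M.Legal c r ∧ M.Leads (advance c r) plan d

/-- `plan` is a solution (motion plan): there is no collision at the beginning, and `plan` is a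
sequence of legal moves that brings every robot from its source to its target. -/
def IsSolution (M : MRMPGP W n) (plan : List (Fin n)) : Prop :=
  Function.Injective M.src ∧ M.Leads start plan M.goal

/-- Non-blocking targets: no target lies on the path of another robot. -/
def NonBlockingTargets (M : MRMPGP W n) : Prop :=
  ∀ r r' : Fin n, r ≠ r' → M.trg r' ∉ (M.path r).support

/-- `N(v)`, the number of paths on which the vertex `v` appears. -/
noncomputable def multiplicity (M : MRMPGP W n) (v : V) : ℕ :=
  {r : Fin n | v ∈ (M.path r).support}.ncard

/-- The vertex multiplicity of the instance, the maximum of `N(v)` over all vertices. -/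
noncomputable def vertexMultiplicity [Fintype V] (M : MRMPGP W n) : ℕ :=
  Finset.univ.sup M.multiplicity

/-- A compact plan is a list of pairs `(r, v)`, read as "robot `r` advances along its path until
it is at `v`". `M.Expands c ms plan` says that `plan` is the sequence of single moves that the
compact plan `ms` describes, when it is started in the configuration `c`. -/
inductive Expands (M : MRMPGP W n) : Config n → List (Fin n × V) → List (Fin n) → Prop
  | nil (c : Config n) : Expands M c [] []
  | cons (c : Config n) (r : Fin n) (v : V) (k : ℕ) (ms : List (Fin n × V)) (plan : List (Fin n)) :
      (M.path r).getVert (c r + k) = v →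
      Expands M (Function.update c r (c r + k)) ms plan →
      Expands M c ((r, v) :: ms) (List.replicate k r ++ plan)

end MRMPGP

/-! ## Straight paths on a 2D grid -/

/-- The 2D grid with `a` rows and `b` columns. The vertex `(i, j)` lies in row `i`, column `j`. -/
def gridGraph (a b : ℕ) : SimpleGraph (Fin a × Fin b) :=
  (SimpleGraph.pathGraph a).boxProd (SimpleGraph.pathGraph b)

/-- Turn number zero: each path is contained in a single row or in a single column. -/
def MRMPGP.Straight {a b n : ℕ} (M : MRMPGP (gridGraph a b) n) : Prop :=
  ∀ r : Fin n, (∃ i : Fin a, ∀ v ∈ (M.path r).support, v.1 = i) ∨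
    (∃ j : Fin b, ∀ v ∈ (M.path r).support, v.2 = j)

/-! ## The machine model

A random access machine with integer registers, two-dimensional integer arrays and an output tape.
It can copy and compare integers and add constants of the program to them. As it cannot add or
multiply two registers, a run of `T` steps changes the magnitude of numbers by `O(T)` only, so that
unit cost per step is realistic. Every executed assignment, output command and test is one step; the
size of the expressions in them is bounded by the (fixed) program. -/

/-- Memory: integer registers, arrays with two integer indices, and what has been output. -/
structure State where
  reg : ℕ → ℤ
  arr : ℕ → ℤ → ℤ → ℤ
  out : List ℤ

/-- Integer expressions. `read A i j` is the entry of the array number `A` at index `(i, j)`. -/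
inductive Expr where
  | const (z : ℤ) : Expr
  | reg (x : ℕ) : Expr
  | read (A : ℕ) (i j : Expr) : Expr
  | addConst (e : Expr) (z : ℤ) : Expr

def Expr.eval (s : State) : Expr → ℤ
  | .const z => z
  | .reg x => s.reg x
  | .read A i j => s.arr A (i.eval s) (j.eval s)
  | .addConst e z => e.eval s + z

/-- Tests. -/
inductive Test where
  | le (e f : Expr) : Test
  | eq (e f : Expr) : Test
  | not (t : Test) : Test
  | and (t u : Test) : Test
  | or (t u : Test) : Test

def Test.holds (s : State) : Test → Prop
  | .le e f => e.eval s ≤ f.eval s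
  | .eq e f => e.eval s = f.eval s
  | .not t => ¬ t.holds s
  | .and t u => t.holds s ∧ u.holds s
  | .or t u => t.holds s ∨ u.holds s

/-- Programs. -/
inductive Program where
  | skip : Program
  | assign (x : ℕ) (e : Expr) : Program
  | write (A : ℕ) (i j e : Expr) : Program
  | emit (e : Expr) : Program
  | seq (p q : Program) : Program
  | ite (t : Test) (p q : Program) : Program
  | while (t : Test) (p : Program) : Program

def State.setReg (s : State) (x : ℕ) (z : ℤ) : State :=
  { s with reg := Function.update s.reg x z }

def State.setArr (s : State) (A : ℕ) (i j z : ℤ) : State :=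
  { s with arr := fun A' i' j' => if A' = A ∧ i' = i ∧ j' = j then z else s.arr A' i' j' }

def State.emit (s : State) (z : ℤ) : State :=
  { s with out := s.out ++ [z] }

/-- `Run p s s' T`: started in the state `s`, the program `p` halts in the state `s'` after exactly
`T` steps. -/
inductive Run : Program → State → State → ℕ → Prop
  | skip (s : State) : Run .skip s s 1
  | assign (s : State) (x : ℕ) (e : Expr) : Run (.assign x e) s (s.setReg x (e.eval s)) 1
  | write (s : State) (A : ℕ) (i j e : Expr) :
      Run (.write A i j e) s (s.setArr A (i.eval s) (j.eval s) (e.eval s)) 1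
  | emit (s : State) (e : Expr) : Run (.emit e) s (s.emit (e.eval s)) 1
  | seq {p q : Program} {s s' s'' : State} {T T' : ℕ} :
      Run p s s' T → Run q s' s'' T' → Run (.seq p q) s s'' (T + T')
  | ite_true {t : Test} {p q : Program} {s s' : State} {T : ℕ} :
      t.holds s → Run p s s' T → Run (.ite t p q) s s' (T + 1)
  | ite_false {t : Test} {p q : Program} {s s' : State} {T : ℕ} :
      ¬ t.holds s → Run q s s' T → Run (.ite t p q) s s' (T + 1)
  | while_true {t : Test} {p : Program} {s s' s'' : State} {T T' : ℕ} :
      t.holds s → Run p s s' T → Run (.while t p) s' s'' T' →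
      Run (.while t p) s s'' (T + T' + 1)
  | while_false {t : Test} {p : Program} {s : State} :
      ¬ t.holds s → Run (.while t p) s s 1

/-! ## Input and output -/

/-- The input array: row `r` holds the row and the column of the source and then the row and the
column of the target of robot `r`; all other entries are `0`. -/
def inputArray {a b n : ℕ} (M : MRMPGP (gridGraph a b) n) (r k : ℤ) : ℤ :=
  if h : r.toNat < n ∧ 0 ≤ r then
    if k = 0 then ((M.src ⟨r.toNat, h.1⟩).1 : ℕ)
    else if k = 1 then ((M.src ⟨r.toNat, h.1⟩).2 : ℕ)
    else if k = 2 then ((M.trg ⟨r.toNat, h.1⟩).1 : ℕ)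
    else if k = 3 then ((M.trg ⟨r.toNat, h.1⟩).2 : ℕ)
    else 0
  else 0

/-- The initial state: registers `0`, `1`, `2` hold the number of robots and the numbers of rows and
columns of the grid, array `0` holds the endpoints of the paths, everything else is zero. -/
def inputState {a b n : ℕ} (M : MRMPGP (gridGraph a b) n) : State where
  reg := fun x => if x = 0 then (n : ℤ) else if x = 1 then (a : ℤ) else if x = 2 then (b : ℤ) else 0
  arr := fun A r k => if A = 0 then inputArray M r k else 0
  out := []

/-- The output that reports that no solution exists. -/
def noSolutionOutput : List ℤ := [0]

/-- The output that announces a compact plan: `1`, and then for each `(r, (i, j))` of the plan the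
three numbers `r`, `i`, `j`. -/
def planOutput {a b n : ℕ} (ms : List (Fin n × (Fin a × Fin b))) : List ℤ :=
  1 :: ms.flatMap fun m => [((m.1 : ℕ) : ℤ), ((m.2.1 : ℕ) : ℤ), ((m.2.2 : ℕ) : ℤ)]

end MRMP

/-!
If two paths in the same row (or column) share a vertex, there is no solution: their robots cannot
overtake each other, and then one of the two targets would block the other robot
(`Straight.no_solution_of_collinear`). Otherwise any two paths share at most one vertex, every
vertex is on at most two paths, and sources may be assumed to be distinct. The rest of the argument
is about paths in a graph with these properties (`Crossing`).

Call the vertices of a path before the first one that is on no other path its *run*. Distinct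
vertices of a run are shared with distinct robots, so a run has at most `n` vertices, and all of
them together can be tabulated in `O(n ^ 2)` steps, although the paths may be long. The algorithm
moves robots along their runs only, and keeps the configuration *clean*: a robot that has left its
source stands where no other robot still has to pass. As soon as every source that is on the path of
another robot has been left, all robots can go straight to their targets, one after another
(`creach_targets`).

To make a robot leave its source, scan its run for the first vertex at which it may stay. In a clean
configuration only a robot that is still at its source can be in the way. That robot is served
first, which leads to a stack of robots, each blocked by the next one. It remains to treat a cycle
of robots each of which is blocked by the next one (`Cycle`). Traverse the cycle along the paths,
from each source to the next one, and match the two visits of a vertex like parentheses, with a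
stack of visits.
* As long as a vertex that is visited for the second time is on top of the stack, the visits are
  nested, and by induction, in every plan, the robot of a stack entry has to wait for the robot of
  the next entry, and that of the top entry for the current robot (`Traversal`, `Traversal.pop`).
  If the stack becomes empty, the first robot could not even be at its source before another robot
  has passed there, so there is no solution (`Traversal.no_solution`). This happens at the end of
  the traversal at the latest.
* If the vertex is not on top of the stack, then the top is a vertex that has been visited once only
  between the two visits (`Traversal.chord`). The robot `b` that visits it moves there, out of the
  way, and then the other robots of the cycle can rotate. All of them stop at the source of the next
  robot, except for the second robot at the vertex that is visited twice, which stops there.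
  Robot `b` moves on when its turn comes, and the result is a clean configuration (`Cycle.first`,
  `Cycle.step`, `Cycle.last`).

A cycle of `m` robots costs `O(m n)` steps, and its robots have left their sources afterwards. More
precisely, let `w` be the number of robots at their sources and `d` the height of the robot stack.
Serving the top robot decreases `2 w - d`, and `80 (n + 2)` steps for each unit of the decrease
suffice (`Served`), which makes `O(n ^ 2)` steps in total.

The program is verified with total correctness assertions `Tot p s Q`, whose postconditions also
bound the running time; the invariants of loops carry a potential that pays for the steps
(`Tot.while`).
-/

namespace MRMP

set_option linter.unusedSimpArgs false

namespace MRMPGP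

variable {V : Type*} {W : SimpleGraph V} {n : ℕ}

/-! ### Positions on paths -/

/-- The `k`-th vertex of the path of `r`. -/
abbrev vert (M : MRMPGP W n) (r : Fin n) (k : ℕ) : V := (M.path r).getVert k

/-- The number of edges of the path of `r`. -/
abbrev len (M : MRMPGP W n) (r : Fin n) : ℕ := (M.path r).length

/-- The vertex `v` lies on the path of `r`. -/
def On (M : MRMPGP W n) (r : Fin n) (v : V) : Prop := v ∈ (M.path r).support

theorem on_vert (M : MRMPGP W n) (r : Fin n) (k : ℕ) : M.On r (M.vert r k) :=
  (M.path r).getVert_mem_support k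

theorem on_src (M : MRMPGP W n) (r : Fin n) : M.On r (M.src r) :=
  (M.path r).start_mem_support

theorem on_iff (M : MRMPGP W n) (r : Fin n) (v : V) :
    M.On r v ↔ ∃ k, M.vert r k = v ∧ k ≤ M.len r :=
  SimpleGraph.Walk.mem_support_iff_exists_getVert

theorem vert_zero (M : MRMPGP W n) (r : Fin n) : M.vert r 0 = M.src r :=
  (M.path r).getVert_zero

theorem vert_inj (M : MRMPGP W n) {r : Fin n} {k l : ℕ} (hk : k ≤ M.len r) (hl : l ≤ M.len r)
    (h : M.vert r k = M.vert r l) : k = l :=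
  (M.isPath r).getVert_injOn hk hl h

theorem loc_eq (M : MRMPGP W n) (c : Config n) (r : Fin n) : M.loc c r = M.vert r (c r) := rfl

/-! ### Compact plans -/

/-- `M.CReach c ms d`: executing the compact plan `ms` legally leads from `c` to `d`. -/
inductive CReach (M : MRMPGP W n) (c : Config n) : List (Fin n × V) → Config n → Prop
  | nil : CReach M c [] c
  | snoc {ms : List (Fin n × V)} {d : Config n} (r : Fin n) (e : ℕ) :
      CReach M c ms d → d r ≤ e → e ≤ M.len r →
      (∀ k, d r < k → k ≤ e → ∀ r', r' ≠ r → M.loc d r' ≠ M.vert r k) →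
      CReach M c (ms ++ [(r, M.vert r e)]) (Function.update d r e)

theorem Leads.append {M : MRMPGP W n} {p q : List (Fin n)} {c d e : Config n}
    (h : M.Leads c p d) (h' : M.Leads d q e) : M.Leads c (p ++ q) e := by
  induction p generalizing c with
  | nil => obtain rfl : c = d := h; exact h'
  | cons r p ih => exact ⟨h.1, ih h.2⟩

theorem leads_replicate {M : MRMPGP W n} {r : Fin n} (k : ℕ) {c : Config n}
    (hk : c r + k ≤ M.len r)
    (hfree : ∀ l, c r < l → l ≤ c r + k → ∀ r', r' ≠ r → M.loc c r' ≠ M.vert r l) :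
    M.Leads c (List.replicate k r) (Function.update c r (c r + k)) := by
  induction k generalizing c with
  | zero => exact (Function.update_eq_self r c).symm
  | succ k ih =>
    refine ⟨⟨by change c r < M.len r; omega,
      fun r' hr' => hfree _ (by omega) (by omega) r' hr'⟩, ?_⟩
    have hloc : ∀ r', r' ≠ r → M.loc (advance c r) r' = M.loc c r' := fun r' hr' => by
      simp [loc, advance, hr']
    have := @ih (advance c r) (by simp [advance]; omega)
      (fun l h1 h2 r' hr' => by
        rw [hloc r' hr']
        simp only [advance, Function.update_self] at h1 h2
        exact hfree l (by omega) (by omega) r' hr')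
    have h3 : Function.update (advance c r) r (advance c r r + k)
        = Function.update c r (c r + (k + 1)) := by
      simp [advance]; congr 1; omega
    rw [h3] at this
    exact this

theorem Leads.of_replicate_append {M : MRMPGP W n} {r : Fin n} (k : ℕ) {c d : Config n}
    {p : List (Fin n)} (h : M.Leads c (List.replicate k r ++ p) d) :
    M.Leads (Function.update c r (c r + k)) p d := by
  induction k generalizing c with
  | zero => simpa using h
  | succ k ih =>
    have := ih h.2
    have h3 : Function.update (advance c r) r (advance c r r + k)
        = Function.update c r (c r + (k + 1)) := by
      simp [advance]; congr 1; omega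
    rwa [h3] at this

theorem Expands.append {M : MRMPGP W n} {ms ms' : List (Fin n × V)} {p q : List (Fin n)}
    {c d : Config n} (h : M.Expands c ms p) (hd : M.Leads c p d) (h' : M.Expands d ms' q) :
    M.Expands c (ms ++ ms') (p ++ q) := by
  induction h with
  | nil c => obtain rfl : c = d := hd; exact h'
  | cons c r v k ms plan hv _ ih =>
    rw [List.append_assoc]
    exact .cons c r v k _ _ hv (ih hd.of_replicate_append)

theorem CReach.exists_plan {M : MRMPGP W n} {c d : Config n} {ms : List (Fin n × V)}
    (h : M.CReach c ms d) : ∃ plan, M.Expands c ms plan ∧ M.Leads c plan d := by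
  induction h with
  | nil => exact ⟨[], .nil c, rfl⟩
  | @snoc ms d r e _ hle hlen hfree ih =>
    obtain ⟨plan, h1, h2⟩ := ih
    obtain ⟨k, rfl⟩ := Nat.exists_eq_add_of_le hle
    have h3 := leads_replicate k hlen hfree
    refine ⟨plan ++ List.replicate k r, h1.append h2 ?_, h2.append h3⟩
    have := Expands.cons (M := M) d r (M.vert r (d r + k)) k [] [] rfl (.nil _)
    simpa using this

/-! ### Time in a plan -/

/-- The configuration after the first `i` moves of a plan that begins at the sources. -/
def cfg (plan : List (Fin n)) (i : ℕ) : Config n := fun r => (plan.take i).count r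

theorem cfg_zero (plan : List (Fin n)) : cfg plan 0 = start := by
  funext r; simp [cfg, start]

theorem cfg_succ (plan : List (Fin n)) (i : ℕ) (hi : i < plan.length) :
    cfg plan (i + 1) = advance (cfg plan i) plan[i] := by
  have ht : plan.take (i + 1) = plan.take i ++ [plan[i]] := by
    rw [List.take_add_one, List.getElem?_eq_getElem hi]; rfl
  funext r
  by_cases h : r = plan[i]
  · rw [h, advance, Function.update_self, cfg, ht, List.count_append]
    simp [cfg]
  · have : ¬ plan[i] = r := fun h' => h h'.symm
    rw [advance, Function.update_of_ne h, cfg, ht, List.count_append]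
    simp [cfg, this]

theorem cfg_of_length_le (plan : List (Fin n)) (i : ℕ) (hi : plan.length ≤ i) :
    cfg plan (i + 1) = cfg plan i := by
  funext r; simp [cfg, List.take_of_length_le hi, List.take_of_length_le (Nat.le_succ_of_le hi)]

theorem cfg_mono (plan : List (Fin n)) (r : Fin n) : Monotone fun i => cfg plan i r :=
  monotone_nat_of_le_succ fun i => by
    rcases lt_or_ge i plan.length with hi | hi
    · rw [cfg_succ plan i hi, advance]
      by_cases h : r = plan[i]
      · subst h; simp
      · simp [h]
    · rw [cfg_of_length_le plan i hi]

theorem cfg_succ_le (plan : List (Fin n)) (r : Fin n) (i : ℕ) :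
    cfg plan (i + 1) r ≤ cfg plan i r + 1 := by
  rcases lt_or_ge i plan.length with hi | hi
  · rw [cfg_succ plan i hi, advance]
    by_cases h : r = plan[i]
    · subst h; simp
    · simp [h]
  · rw [cfg_of_length_le plan i hi]; omega

/-- In a plan from `c` to `d`, every move is legal at its time, and `d` is determined by how often
each robot moves. -/
theorem Leads.legal_cfg {M : MRMPGP W n} {plan : List (Fin n)} {c d : Config n}
    (h : M.Leads c plan d) :
    (∀ i (hi : i < plan.length), M.Legal (fun r => c r + cfg plan i r) plan[i]) ∧
      d = fun r => c r + cfg plan plan.length r := by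
  induction plan generalizing c with
  | nil => obtain rfl : c = d := h; simp [cfg]
  | cons r p ih =>
    have hc : ∀ i, (fun r' => c r' + cfg (r :: p) (i + 1) r')
        = fun r' => advance c r r' + cfg p i r' := by
      intro i; funext r'
      by_cases hr : r' = r
      · subst hr; simp [cfg, advance]; omega
      · have : ¬ r = r' := fun h' => hr h'.symm
        simp [cfg, advance, hr, this]
    obtain ⟨h1, h2⟩ := ih h.2
    refine ⟨fun i hi => ?_, ?_⟩
    · cases i with
      | zero => simpa [cfg] using h.1
      | succ i =>
        rw [hc]
        exact h1 i (by simpa using hi)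
    · rw [h2, List.length_cons, hc]

variable {M : MRMPGP W n} {plan : List (Fin n)}

theorem IsSolution.legal (h : M.IsSolution plan) (i : ℕ) (hi : i < plan.length) :
    M.Legal (cfg plan i) plan[i] := by
  have := h.2.legal_cfg.1 i hi
  simpa [start] using this

theorem IsSolution.cfg_length (h : M.IsSolution plan) : cfg plan plan.length = M.goal := by
  have := h.2.legal_cfg.2
  rw [this]; simp [start]

/-- There is no collision at any time. -/
theorem IsSolution.loc_ne (h : M.IsSolution plan) (i : ℕ) {r r' : Fin n} (hr : r ≠ r') :
    M.loc (cfg plan i) r ≠ M.loc (cfg plan i) r' := by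
  induction i generalizing r r' with
  | zero => simpa [cfg_zero, loc, start] using h.1.ne hr
  | succ i ih =>
    rcases lt_or_ge i plan.length with hi | hi
    · have hl := (h.legal i hi).2
      rw [cfg_succ plan i hi]
      have key : ∀ r' : Fin n, r' ≠ plan[i] →
          M.loc (advance (cfg plan i) plan[i]) r' ≠
            M.loc (advance (cfg plan i) plan[i]) plan[i] := by
        intro r' hr'
        have := hl r' hr'
        simpa [loc, advance, hr'] using this
      by_cases h1 : r = plan[i]
      · subst h1; exact (key r' hr.symm).symm
      · by_cases h2 : r' = plan[i]
        · subst h2; exact key r hr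
        · simpa [loc, advance, h1, h2] using ih hr
    · rw [cfg_of_length_le plan i hi]; exact ih hr

/-- In the plan, the robot `r` cannot have reached its `d`-th vertex unless `r'` has reached its
`d'`-th vertex. -/
def Imp (plan : List (Fin n)) (r : Fin n) (d : ℕ) (r' : Fin n) (d' : ℕ) : Prop :=
  ∀ i, d ≤ cfg plan i r → d' ≤ cfg plan i r'

theorem Imp.trans {r r' r'' : Fin n} {d d' d'' : ℕ} (h : Imp plan r d r' d')
    (h' : Imp plan r' d' r'' d'') : Imp plan r d r'' d'' :=
  fun i hi => h' i (h i hi)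

theorem not_imp_zero_succ (plan : List (Fin n)) (r r' : Fin n) (d : ℕ) :
    ¬ Imp plan r 0 r' (d + 1) := fun h => by
  have := h 0 (Nat.zero_le _)
  simp [cfg_zero, start] at this

/-- The first time at which `r` has reached its `d`-th vertex. -/
theorem IsSolution.exists_first (h : M.IsSolution plan) {r : Fin n} {d : ℕ} (hd : d ≤ M.len r) :
    ∃ i, cfg plan i r = d ∧ ∀ j, d ≤ cfg plan j r ↔ i ≤ j := by
  classical
  have hex : ∃ i, d ≤ cfg plan i r := ⟨plan.length, by rw [h.cfg_length]; exact hd⟩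
  refine ⟨Nat.find hex, le_antisymm ?_ (Nat.find_spec hex), fun j =>
    ⟨fun hj => Nat.find_min' hex hj, fun hj => (Nat.find_spec hex).trans (cfg_mono plan r hj)⟩⟩
  rcases hi : Nat.find hex with _ | i
  · simp [cfg_zero, start]
  · have : ¬ d ≤ cfg plan i r := Nat.find_min hex (by omega)
    have := cfg_succ_le plan r i
    omega

/-- Of two robots that both visit a vertex, one leaves it before the other one enters it. -/
theorem IsSolution.exclusive (h : M.IsSolution plan) {r r' : Fin n} {d d' : ℕ} (hr : r ≠ r')
    (hd : d ≤ M.len r) (hd' : d' ≤ M.len r') (hv : M.vert r d = M.vert r' d') :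
    Imp plan r d r' (d' + 1) ∨ Imp plan r' d' r (d + 1) := by
  obtain ⟨i, hi, hi'⟩ := h.exists_first hd
  obtain ⟨j, hj, hj'⟩ := h.exists_first hd'
  rcases le_total i j with hij | hij
  · right
    intro l hl
    have h1 := (hj' l).1 hl
    have h2 : d ≤ cfg plan j r := (hi' j).2 hij
    have h3 : cfg plan j r ≠ d := fun h3 => h.loc_ne j hr (by simp only [loc, h3, hj]; exact hv)
    have := cfg_mono plan r h1
    simp only at this
    omega
  · left
    intro l hl
    have h1 := (hi' l).1 hl
    have h2 : d' ≤ cfg plan i r' := (hj' i).2 hij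
    have h3 : cfg plan i r' ≠ d' := fun h3 => h.loc_ne i hr (by simp only [loc, h3, hi]; exact hv)
    have := cfg_mono plan r' h1
    simp only at this
    omega

/-- Two robots cannot wait for each other: one moves at a time. -/
theorem IsSolution.not_simultaneous (h : M.IsSolution plan) {r r' : Fin n} {d d' : ℕ}
    (hr : r ≠ r') (hd0 : 0 < d) (hd : d ≤ M.len r) (h1 : Imp plan r d r' d')
    (h2 : Imp plan r' d' r d) : False := by
  obtain ⟨i, hi, hi'⟩ := h.exists_first hd
  rcases i with _ | i
  · rw [cfg_zero] at hi; simp [start] at hi; omega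
  · have h3 : ¬ d ≤ cfg plan i r := fun h3 => by have := (hi' i).1 h3; omega
    have h4 := h1 _ hi.ge
    rcases lt_or_ge i plan.length with hlt | hge
    · rw [cfg_succ plan i hlt] at hi h4
      by_cases hp : r = plan[i]
      · have : r' ≠ plan[i] := fun h5 => hr (hp.trans h5.symm)
        simp only [advance, Function.update_of_ne this] at h4
        exact h3 (h2 i h4)
      · simp only [advance, Function.update_of_ne hp] at hi
        omega
    · rw [cfg_of_length_le plan i hge] at hi
      omega

/-- If `r'` enters a vertex before `r` leaves it, then `r'` leaves it before `r` enters it. -/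
theorem IsSolution.imp_of_imp (h : M.IsSolution plan) {r r' : Fin n} {d d' : ℕ} (hr : r ≠ r')
    (hd : d ≤ M.len r) (hd' : d' ≤ M.len r') (hv : M.vert r d = M.vert r' d') (h0 : 0 < d')
    (h1 : Imp plan r (d + 1) r' d') : Imp plan r d r' (d' + 1) :=
  (h.exclusive hr hd hd' hv).resolve_right fun h2 =>
    h.not_simultaneous hr.symm h0 hd' h2 h1

end MRMPGP

namespace MRMPGP

variable {V : Type*} {W : SimpleGraph V} {n : ℕ}

/-! ### Instances in which two paths meet at most once -/

/-- Non-blocking targets, vertex multiplicity at most two, distinct sources, and no two paths share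
more than one vertex. -/
structure Crossing (M : MRMPGP W n) : Prop where
  two : ∀ {v : V} {r s t : Fin n}, M.On r v → M.On s v → M.On t v → r ≠ s → r = t ∨ s = t
  one : ∀ {v w : V} {r s : Fin n}, r ≠ s → M.On r v → M.On s v → M.On r w → M.On s w → v = w
  nbt : M.NonBlockingTargets
  inj : Function.Injective M.src

/-- The `k`-th vertex on the path of `r` lies on no other path. -/
def Clear (M : MRMPGP W n) (r : Fin n) (k : ℕ) : Prop :=
  ∀ o, o ≠ r → ¬ M.On o (M.vert r k)

/-- The number of vertices on the path of `r` before the first one that lies on no other path. -/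
noncomputable def run (M : MRMPGP W n) (r : Fin n) : ℕ := sInf {k | M.Clear r k}

/-- Robots that have left their source stand where no other robot still has to pass. -/
def Clean (M : MRMPGP W n) (c : Config n) : Prop :=
  ∀ r, 0 < c r → ∀ o, o ≠ r → ∀ k, c o ≤ k → k ≤ M.len o → M.vert o k ≠ M.vert r (c r)

/-- The robot `r'`, which is still at its source, is the first robot on the way of `r`; it is `k`
edges away from the source of `r`, and all vertices before it lie on other paths, too. -/
structure Link (M : MRMPGP W n) (c : Config n) (r r' : Fin n) (k : ℕ) : Prop where
  pos : 0 < k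
  lt_run : k < M.run r
  eq : M.vert r k = M.src r'
  ne : r' ≠ r
  free : ∀ l, 0 < l → l < k → ∀ w, c w = 0 → M.src w ≠ M.vert r l

variable {M : MRMPGP W n}

theorem Link.mono {c c' : Config n} {r r' : Fin n} {k : ℕ} (h : M.Link c r r' k)
    (hc : ∀ w, c' w = 0 → c w = 0) : M.Link c' r r' k :=
  ⟨h.pos, h.lt_run, h.eq, h.ne, fun l h0 hl w hw => h.free l h0 hl w (hc w hw)⟩

namespace Crossing

theorem clear_len (h : M.Crossing) (r : Fin n) : M.Clear r (M.len r) := fun o ho => by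
  have := h.nbt o r ho
  simpa [vert, len, On] using this

theorem clear_run (h : M.Crossing) (r : Fin n) : M.Clear r (M.run r) :=
  Nat.sInf_mem (s := {k | M.Clear r k}) ⟨_, h.clear_len r⟩

theorem run_le_len (h : M.Crossing) (r : Fin n) : M.run r ≤ M.len r :=
  Nat.sInf_le (h.clear_len r)

end Crossing

theorem exists_other {r : Fin n} {k : ℕ} (hk : k < M.run r) :
    ∃ o, o ≠ r ∧ M.On o (M.vert r k) := by
  have := Nat.notMem_of_lt_sInf hk
  simpa [Clear] using this

namespace Crossing

/-- The robot met at a vertex of the run determines the vertex. -/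
theorem eq_of_on (h : M.Crossing) {r o : Fin n} {k l : ℕ} (ho : o ≠ r) (hk : k ≤ M.len r)
    (hl : l ≤ M.len r) (h1 : M.On o (M.vert r k)) (h2 : M.On o (M.vert r l)) : k = l :=
  M.vert_inj hk hl (h.one ho h1 (M.on_vert r k) h2 (M.on_vert r l))

theorem run_le (h : M.Crossing) (r : Fin n) : M.run r ≤ n := by
  choose f hf using fun k : Fin (M.run r) => exists_other (M := M) k.2
  have hlen := h.run_le_len r
  have : Function.Injective f := fun k l hkl => by
    have h2 := (hf l).2
    rw [← hkl] at h2
    exact Fin.ext (h.eq_of_on (hf k).1 (k.2.le.trans hlen) (l.2.le.trans hlen) (hf k).2 h2)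
  simpa using Fintype.card_le_of_injective f this

end Crossing

/-- A robot at its source moves to a vertex where nobody else has to pass, past unoccupied
vertices. -/
theorem CReach.advance_clean {s c : Config n} {ms : List (Fin n × V)}
    (hr : M.CReach s ms c) (hc : M.Clean c) {r : Fin n} {k : ℕ} (hk : k ≤ M.len r)
    (h0 : c r ≤ k)
    (hfree : ∀ l, c r < l → l < k → ∀ w, w ≠ r → M.loc c w ≠ M.vert r l)
    (hb : ∀ w, c w ≤ M.len w)
    (hend : ∀ w, w ≠ r → ∀ l, c w ≤ l → l ≤ M.len w → M.vert w l ≠ M.vert r k) :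
    M.CReach s (ms ++ [(r, M.vert r k)]) (Function.update c r k) ∧
      M.Clean (Function.update c r k) := by
  refine ⟨.snoc r k hr h0 hk fun l h1 h2 w hw => ?_, fun w hw o how l hl hll => ?_⟩
  · rcases h2.lt_or_eq with h2 | rfl
    · exact hfree l h1 h2 w hw
    · exact hend w hw _ le_rfl (hb w)
  · by_cases hwr : w = r
    · subst hwr
      rw [Function.update_self]
      rw [Function.update_of_ne how] at hl
      exact hend o how l hl hll
    · rw [Function.update_of_ne hwr] at hw ⊢
      refine hc w hw o how l ?_ hll
      by_cases hor : o = r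
      · subst hor; rw [Function.update_self] at hl; omega
      · rwa [Function.update_of_ne hor] at hl

/-! ### Resolving a cycle of blocked robots -/

/-- The robots `ρ base, …, ρ top` are at their sources, each of them is blocked by the next one,
and the last one by the first. -/
structure Cycle (M : MRMPGP W n) (c : Config n) (ρ : ℕ → Fin n) (seg : Fin n → ℕ)
    (base top : ℕ) : Prop where
  le : base ≤ top
  wrap : ρ (top + 1) = ρ base
  inj : ∀ i j, base ≤ i → i ≤ top → base ≤ j → j ≤ top → ρ i = ρ j → i = j
  zero : ∀ j, base ≤ j → j ≤ top → c (ρ j) = 0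
  link : ∀ j, base ≤ j → j ≤ top → M.Link c (ρ j) (ρ (j + 1)) (seg (ρ j))

/-- Along the cycle, the vertex `q` is visited by robot `a` after `ka` edges and by robot `z` after
`kz` edges, and in between there is a vertex that is visited once only, by robot `b` after `kb`
edges. -/
structure Chord (M : MRMPGP W n) (ρ : ℕ → Fin n) (seg : Fin n → ℕ)
    (base top a ka b kb z kz : ℕ) : Prop where
  base_le : base ≤ a
  a_lt : a < z
  z_le : z ≤ top
  a_le_b : a ≤ b
  b_le_z : b ≤ z
  ka_lt : ka < seg (ρ a)
  kz_pos : 0 < kz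
  kz_le : kz ≤ seg (ρ z)
  meet : M.vert (ρ a) ka = M.vert (ρ z) kz
  kb_pos : 0 < kb
  kb_lt : kb < seg (ρ b)
  ka_lt_kb : a = b → ka < kb
  kb_lt_kz : b = z → kb < kz
  once : ∀ j, a ≤ j → j ≤ z → j ≠ b → ∀ l, 0 < l → l ≤ seg (ρ j) → (j = z → l ≤ kz) →
    M.vert (ρ j) l ≠ M.vert (ρ b) kb

/-- The destination of each robot of the cycle: the source of the next robot, but the meeting vertex
for robot `z`. -/
def dest (ρ : ℕ → Fin n) (seg : Fin n → ℕ) (z kz : ℕ) : Fin n → ℕ :=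
  Function.update seg (ρ z) kz

/-- An intermediate configuration: the robots with index in `S` are at their destinations, robot
`b` waits after `kb` edges unless it is in `S`, and no other robot of the cycle has moved. -/
structure Mid (c e : Config n) (ρ : ℕ → Fin n) (dst : Fin n → ℕ) (base top b kb : ℕ)
    (S : ℕ → Prop) : Prop where
  out : ∀ r, (∀ j, base ≤ j → j ≤ top → ρ j ≠ r) → e r = c r
  mem : ∀ j, base ≤ j → j ≤ top → S j → e (ρ j) = dst (ρ j)
  wait : base ≤ b → b ≤ top → ¬ S b → e (ρ b) = kb
  rest : ∀ j, base ≤ j → j ≤ top → ¬ S j → j ≠ b → e (ρ j) = 0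

/-- Conditions under which robot `j` may move to its destination when the robots with index in `S`
have done so: its successor has left its source, robot `a` has passed the meeting vertex before
robot `z` goes there, and the vertex at which robot `b` waits is not in the way. -/
structure StepOK (base top a b z : ℕ) (S : ℕ → Prop) (j : ℕ) : Prop where
  base_le : base ≤ j
  le_top : j ≤ top
  not_mem : ¬ S j
  next : j ≠ z → j < top → S (j + 1) ∨ j + 1 = b
  last : j ≠ z → j = top → S base ∨ base = b
  closing : j = z → S a ∨ a = b
  wait : j ≠ b → ¬ S b → a ≤ j ∧ j ≤ z
  order : S z → S a ∨ a = b

section Rotation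

variable {c e : Config n} {ρ : ℕ → Fin n} {seg : Fin n → ℕ} {base top a ka b kb z kz : ℕ}
  {S : ℕ → Prop}

theorem dest_z : dest ρ seg z kz (ρ z) = kz := by simp [dest]

theorem Cycle.dest_of_ne (C : M.Cycle c ρ seg base top)
    (H : M.Chord ρ seg base top a ka b kb z kz) {j : ℕ} (h1 : base ≤ j) (h2 : j ≤ top)
    (hj : j ≠ z) : dest ρ seg z kz (ρ j) = seg (ρ j) := by
  have := H.base_le; have := H.a_lt
  rw [dest, Function.update_of_ne fun h => hj (C.inj j z h1 h2 (by omega) H.z_le h)]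

theorem Cycle.dest_le (C : M.Cycle c ρ seg base top)
    (H : M.Chord ρ seg base top a ka b kb z kz) {j : ℕ} (h1 : base ≤ j) (h2 : j ≤ top) :
    dest ρ seg z kz (ρ j) ≤ seg (ρ j) := by
  by_cases hj : j = z
  · subst hj; rw [dest_z]; exact H.kz_le
  · rw [C.dest_of_ne H h1 h2 hj]

theorem Cycle.dest_pos (C : M.Cycle c ρ seg base top)
    (H : M.Chord ρ seg base top a ka b kb z kz) {j : ℕ} (h1 : base ≤ j) (h2 : j ≤ top) :
    0 < dest ρ seg z kz (ρ j) := by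
  by_cases hj : j = z
  · subst hj; rw [dest_z]; exact H.kz_pos
  · rw [C.dest_of_ne H h1 h2 hj]; exact (C.link j h1 h2).pos

theorem Cycle.kb_lt_dest (C : M.Cycle c ρ seg base top)
    (H : M.Chord ρ seg base top a ka b kb z kz) : kb < dest ρ seg z kz (ρ b) := by
  have := H.base_le; have := H.a_le_b; have := H.b_le_z; have := H.z_le
  by_cases hj : b = z
  · have := H.kb_lt_kz hj
    subst hj; rwa [dest_z]
  · rw [C.dest_of_ne H (by omega) (by omega) hj]; exact H.kb_lt

theorem Cycle.seg_le_len (X : M.Crossing) (C : M.Cycle c ρ seg base top) {j : ℕ} (h1 : base ≤ j)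
    (h2 : j ≤ top) : seg (ρ j) ≤ M.len (ρ j) :=
  (C.link j h1 h2).lt_run.le.trans (X.run_le_len _)

/-- The next index along the cycle. -/
theorem Cycle.exists_next (C : M.Cycle c ρ seg base top) {j : ℕ} (h1 : base ≤ j)
    (h2 : j ≤ top) : ∃ i, base ≤ i ∧ i ≤ top ∧ ρ i = ρ (j + 1) ∧
      (i = j + 1 ∧ j < top ∨ i = base ∧ j = top) := by
  rcases h2.lt_or_eq with h | rfl
  · exact ⟨j + 1, by omega, by omega, rfl, .inl ⟨rfl, h⟩⟩
  · exact ⟨base, le_rfl, C.le, C.wrap.symm, .inr ⟨rfl, rfl⟩⟩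

/-- A single move in the rotation of the cycle is legal. -/
theorem Cycle.step (X : M.Crossing) (hc : M.Clean c) (C : M.Cycle c ρ seg base top)
    (H : M.Chord ρ seg base top a ka b kb z kz)
    (E : Mid c e ρ (dest ρ seg z kz) base top b kb S) {s : Config n} {ms : List (Fin n × V)}
    (hr : M.CReach s ms e) {j : ℕ} (J : StepOK base top a b z S j) :
    M.CReach s (ms ++ [(ρ j, M.vert (ρ j) (dest ρ seg z kz (ρ j)))])
        (Function.update e (ρ j) (dest ρ seg z kz (ρ j))) ∧
      Mid c (Function.update e (ρ j) (dest ρ seg z kz (ρ j))) ρ (dest ρ seg z kz) base top b kb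
        (fun i => S i ∨ i = j) := by
  have hb1 := H.base_le
  have hb2 := H.a_lt
  have hb3 := H.z_le
  have hb4 := H.a_le_b
  have hb5 := H.b_le_z
  have hj1 := J.base_le
  have hj2 := J.le_top
  have hdl := C.dest_le H hj1 hj2
  have hsl := C.seg_le_len X hj1 hj2
  have hupd : ∀ i, base ≤ i → i ≤ top → i ≠ j → ρ i ≠ ρ j := fun i h1 h2 h3 h4 =>
    h3 (C.inj i j h1 h2 hj1 hj2 h4)
  -- the robot `a` has passed the meeting vertex whenever this matters
  have hpast : S a ∨ a = b → ka < e (ρ a) := by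
    intro hS
    by_cases hSa : S a
    · rw [E.mem a (by omega) (by omega) hSa, C.dest_of_ne H (by omega) (by omega) (by omega)]
      exact H.ka_lt
    · have hab := hS.resolve_left hSa
      have := E.wait (by omega) (by omega) (hab ▸ hSa)
      have h3 := H.ka_lt_kb hab
      rw [hab, this]
      exact h3
  have hnext : ∀ i, base ≤ i → i ≤ top → (S i ∨ i = b) → e (ρ i) ≠ 0 := by
    intro i h1 h2 h3
    by_cases hSi : S i
    · rw [E.mem i h1 h2 hSi]; exact (C.dest_pos H h1 h2).ne'
    · have := h3.resolve_left hSi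
      subst this
      rw [E.wait h1 h2 hSi]; exact H.kb_pos.ne'
  refine ⟨.snoc (ρ j) _ hr ?_ (hdl.trans hsl) ?_, ?_⟩
  · by_cases hjb : j = b
    · subst hjb
      rw [E.wait hj1 hj2 J.not_mem]
      exact (C.kb_lt_dest H).le
    · rw [E.rest j hj1 hj2 J.not_mem hjb]; exact Nat.zero_le _
  · intro k hk1 hk2 w hw heq
    have hk3 : k ≤ seg (ρ j) := hk2.trans hdl
    -- no robot that is still at its source is in the way
    have hsrc : ∀ w, w ≠ ρ j → c w = 0 → e w = 0 → M.src w ≠ M.vert (ρ j) k := by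
      intro w hw hcw hew heq
      rcases hk3.lt_or_eq with hlt | rfl
      · exact (C.link j hj1 hj2).free k (by omega) hlt w hcw heq
      · have h1 := (C.link j hj1 hj2).eq
        rw [← heq] at h1
        have h2 := X.inj h1
        by_cases hjz : j = z
        · subst hjz
          rw [dest_z] at hk2
          have hk4 : kz = seg (ρ j) := le_antisymm H.kz_le hk2
          have hon : M.On w (M.vert (ρ j) (seg (ρ j))) := heq ▸ M.on_src w
          have hon2 : M.On (ρ a) (M.vert (ρ j) (seg (ρ j))) := by
            rw [← hk4, ← H.meet]; exact M.on_vert _ _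
          rcases X.two (M.on_vert (ρ j) (seg (ρ j))) hon hon2 hw.symm with h3 | h3
          · have := C.inj j a hj1 hj2 (by omega) (by omega) h3
            omega
          · have := hpast (J.closing rfl)
            rw [← h3, hew] at this
            omega
        · obtain ⟨i, hi1, hi2, hi3, hi4⟩ := C.exists_next hj1 hj2
          rw [h2, ← hi3] at hew
          refine hnext i hi1 hi2 ?_ hew
          rcases hi4 with ⟨rfl, h4⟩ | ⟨rfl, h4⟩
          · exact J.next hjz h4
          · exact J.last hjz h4
    by_cases hcyc : ∀ i, base ≤ i → i ≤ top → ρ i ≠ w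
    · have hew := E.out w hcyc
      rcases Nat.eq_zero_or_pos (c w) with h0 | h0
      · rw [loc_eq, hew, h0] at heq
        exact hsrc w hw h0 (hew.trans h0) ((M.vert_zero w).symm.trans heq)
      · rw [loc_eq, hew] at heq
        exact hc w h0 (ρ j) hw.symm k (by rw [C.zero j hj1 hj2]; omega) (hk3.trans hsl) heq.symm
    · push Not at hcyc
      obtain ⟨i, hi1, hi2, rfl⟩ := hcyc
      have hij : i ≠ j := fun h => hw (h ▸ rfl)
      by_cases hSi : S i
      -- a robot that has moved stands at the source of its successor or, if it is `z`, at the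
      -- meeting vertex; the only other path through this vertex is that of the successor or of `a`
      · rw [loc_eq, E.mem i hi1 hi2 hSi] at heq
        by_cases hiz : i = z
        · subst hiz
          rw [dest_z] at heq
          have hon : M.On (ρ a) (M.vert (ρ j) k) := by
            have h3 := M.on_vert (ρ a) ka
            rw [H.meet, heq] at h3; exact h3
          have hon2 : M.On (ρ i) (M.vert (ρ j) k) := by
            rw [← heq]; exact M.on_vert (ρ i) kz
          rcases X.two hon2 (M.on_vert (ρ j) k) hon hw with h3 | h3
          · have := C.inj i a hi1 hi2 (by omega) (by omega) h3
            omega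
          · have hja := C.inj j a hj1 hj2 (by omega) (by omega) h3
            have h5 := H.meet
            rw [← hja] at h5
            have hkk : ka = k := M.vert_inj
              ((hja ▸ H.ka_lt.le).trans hsl) (hk3.trans hsl) (h5.trans heq)
            have := hpast (J.order hSi)
            rw [← hja] at this
            omega
        · rw [C.dest_of_ne H hi1 hi2 hiz] at heq
          have h1 := (C.link i hi1 hi2).eq
          obtain ⟨i', hi1', hi2', hi3, hi4⟩ := C.exists_next hi1 hi2
          have hon : M.On (ρ i') (M.vert (ρ j) k) := by
            have h3 := M.on_src (ρ i')
            rw [hi3, ← h1, heq, ← hi3] at h3; exact h3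
          have hon2 : M.On (ρ i) (M.vert (ρ j) k) := by
            rw [← heq]; exact M.on_vert _ _
          rcases X.two hon2 (M.on_vert (ρ j) k) hon hw with h3 | h3
          · exact (C.link i hi1 hi2).ne (h3.trans hi3).symm
          · have h5 : M.vert (ρ j) 0 = M.vert (ρ j) k := by
              rw [M.vert_zero, ← heq]; rw [h3, hi3]; exact h1.symm
            have := M.vert_inj (Nat.zero_le _) (hk3.trans hsl) h5
            omega
      · by_cases hib : i = b
        · subst hib
          rw [loc_eq, E.wait hi1 hi2 hSi] at heq
          obtain ⟨h5, h6⟩ := J.wait hij.symm hSi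
          refine H.once j h5 h6 hij.symm k (by omega) hk3 ?_ heq.symm
          rintro rfl
          rwa [dest_z] at hk2
        · have h0 := E.rest i hi1 hi2 hSi hib
          rw [loc_eq, h0] at heq
          exact hsrc _ hw (C.zero i hi1 hi2) h0 ((M.vert_zero _).symm.trans heq)
  · constructor
    · intro r hr
      rw [Function.update_of_ne (hr j hj1 hj2).symm]
      exact E.out r hr
    · intro i h1 h2 hS
      by_cases hij : i = j
      · subst hij; simp
      · rw [Function.update_of_ne (hupd i h1 h2 hij)]
        exact E.mem i h1 h2 (hS.resolve_right hij)
    · intro h1 h2 hS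
      push Not at hS
      rw [Function.update_of_ne (hupd b h1 h2 hS.2)]
      exact E.wait h1 h2 hS.1
    · intro i h1 h2 hS hib
      push Not at hS
      rw [Function.update_of_ne (hupd i h1 h2 hS.2)]
      exact E.rest i h1 h2 hS.1 hib

/-- The first move of a rotation: robot `b` goes to the vertex that is visited once only. -/
theorem Cycle.first (X : M.Crossing) (hc : M.Clean c) (C : M.Cycle c ρ seg base top)
    (H : M.Chord ρ seg base top a ka b kb z kz) {s : Config n} {ms : List (Fin n × V)}
    (hr : M.CReach s ms c) :
    M.CReach s (ms ++ [(ρ b, M.vert (ρ b) kb)]) (Function.update c (ρ b) kb) ∧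
      Mid c (Function.update c (ρ b) kb) ρ (dest ρ seg z kz) base top b kb (fun _ => False) := by
  have hb1 := H.base_le
  have hb3 := H.z_le
  have hb4 := H.a_le_b
  have hb5 := H.b_le_z
  have h1 : base ≤ b := by omega
  have h2 : b ≤ top := by omega
  have hlen := C.seg_le_len X h1 h2
  have hkb := H.kb_lt
  have hz := C.zero b h1 h2
  refine ⟨.snoc _ _ hr (by omega) (by omega) fun k hk1 hk2 w hw heq => ?_, ?_, ?_, ?_, ?_⟩
  · rcases Nat.eq_zero_or_pos (c w) with h0 | h0
    · rw [loc_eq, h0] at heq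
      exact (C.link b h1 h2).free k (by omega) (by omega) w h0 ((M.vert_zero w).symm.trans heq)
    · exact hc w h0 (ρ b) hw.symm k (by omega) (by omega) heq.symm
  · intro r hr
    rw [Function.update_of_ne (hr b h1 h2).symm]
  · intro _ _ _ h; exact h.elim
  · intro _ _ _; simp
  · intro j hj1 hj2 _ hjb
    rw [Function.update_of_ne fun h => hjb (C.inj j b hj1 hj2 h1 h2 h)]
    exact C.zero j hj1 hj2

/-- The result of a rotation is clean: the robots stand at vertices that their second visitors have
left behind. -/
theorem Cycle.last (X : M.Crossing) (hc : M.Clean c) (C : M.Cycle c ρ seg base top)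
    (H : M.Chord ρ seg base top a ka b kb z kz)
    (E : Mid c e ρ (dest ρ seg z kz) base top b kb S) (hS : ∀ j, base ≤ j → j ≤ top → S j) :
    M.Clean e := by
  have hb1 := H.base_le
  have hb2 := H.a_lt
  have hb3 := H.z_le
  have hle : ∀ o, c o ≤ e o := by
    intro o
    by_cases hcyc : ∀ i, base ≤ i → i ≤ top → ρ i ≠ o
    · exact (E.out o hcyc).ge
    · push Not at hcyc
      obtain ⟨i, hi1, hi2, rfl⟩ := hcyc
      rw [C.zero i hi1 hi2]; exact Nat.zero_le _
  intro r hr o ho k hk hkl heq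
  by_cases hcyc : ∀ i, base ≤ i → i ≤ top → ρ i ≠ r
  · rw [E.out r hcyc] at hr heq
    exact hc r hr o ho k ((hle o).trans hk) hkl heq
  · push Not at hcyc
    obtain ⟨i, hi1, hi2, rfl⟩ := hcyc
    rw [E.mem i hi1 hi2 (hS i hi1 hi2)] at heq
    have hon : M.On o (M.vert (ρ i) (dest ρ seg z kz (ρ i))) := heq ▸ M.on_vert o k
    by_cases hiz : i = z
    · subst hiz
      rw [dest_z] at heq hon
      have hon2 : M.On (ρ a) (M.vert (ρ i) kz) := H.meet ▸ M.on_vert (ρ a) ka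
      rcases X.two (M.on_vert (ρ i) kz) hon hon2 ho.symm with h3 | h3
      · have := C.inj i a hi1 hi2 (by omega) (by omega) h3
        omega
      · subst h3
        rw [E.mem a (by omega) (by omega) (hS a (by omega) (by omega)),
          C.dest_of_ne H (by omega) (by omega) (by omega)] at hk
        have h4 := H.ka_lt
        have h5 := C.seg_le_len X (j := a) (by omega) (by omega)
        have := M.vert_inj hkl (by omega) (heq.trans H.meet.symm)
        omega
    · rw [C.dest_of_ne H hi1 hi2 hiz] at heq hon
      have hl := C.link i hi1 hi2
      obtain ⟨i', hi1', hi2', hi3, _⟩ := C.exists_next hi1 hi2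
      rcases X.two (M.on_vert (ρ i) (seg (ρ i))) hon (hl.eq ▸ M.on_src _) ho.symm with h3 | h3
      · exact hl.ne h3.symm
      · rw [← hi3] at h3
        subst h3
        rw [E.mem i' hi1' hi2' (hS i' hi1' hi2')] at hk
        have h5 := C.dest_pos H hi1' hi2'
        have h6 : M.vert (ρ i') k = M.vert (ρ i') 0 := by
          rw [heq, hl.eq, M.vert_zero, hi3]
        have := M.vert_inj hkl (Nat.zero_le _) h6
        omega

end Rotation

end MRMPGP

namespace MRMPGP

variable {V : Type*} {W : SimpleGraph V} {n : ℕ} {M : MRMPGP W n}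

/-! ### Traversing a cycle -/

/-- `(j, k)` is a visit of the traversal of the cycle: the robot with index `j` after `k` edges.
The source of the first robot is visited at the beginning and at the end of the traversal, the
other sources are left out. -/
def Occ (ρ : ℕ → Fin n) (seg : Fin n → ℕ) (base top j k : ℕ) : Prop :=
  base ≤ j ∧ j ≤ top ∧ k ≤ seg (ρ j) ∧ (k = seg (ρ j) → j = top) ∧ (k = 0 → j = base)

/-- The visit `(j, k)` precedes the visit `(j', k')`. -/
def Bef (j k j' k' : ℕ) : Prop := j < j' ∨ j = j' ∧ k < k'

/-- The invariant of the traversal of a cycle, as far as the visit `(j, k)`. The stack with the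
entries `(Hj x, Hk x)` for `x = 1, …, h` holds the visits of vertices that were visited once. By
`imp`, in every plan, the robot of an entry cannot proceed from there before the next entry, or
the current visit, has taken place. -/
structure Traversal (M : MRMPGP W n) (ρ : ℕ → Fin n) (seg : Fin n → ℕ) (base top h : ℕ)
    (Hj Hk : ℕ → ℕ) (j k : ℕ) : Prop where
  base_le : base ≤ j
  le_top : j ≤ top
  le_seg : k ≤ seg (ρ j)
  zero : k = 0 → j = base
  occ : ∀ x, 1 ≤ x → x ≤ h → Occ ρ seg base top (Hj x) (Hk x) ∧ Bef (Hj x) (Hk x) j k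
  sorted : ∀ x y, 1 ≤ x → x < y → y ≤ h → Bef (Hj x) (Hk x) (Hj y) (Hk y)
  fresh : ∀ x, 1 ≤ x → x ≤ h → ∀ i l, Occ ρ seg base top i l → Bef i l j k →
    (i = Hj x → l ≠ Hk x) → M.vert (ρ i) l ≠ M.vert (ρ (Hj x)) (Hk x)
  paired : ∀ i l, Occ ρ seg base top i l → Bef i l j k →
    (∃ x, 1 ≤ x ∧ x ≤ h ∧ Hj x = i ∧ Hk x = l) ∨
      ∃ i' l', Occ ρ seg base top i' l' ∧ Bef i' l' j k ∧ (i' = i → l' ≠ l) ∧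
        M.vert (ρ i') l' = M.vert (ρ i) l
  bottom : 1 ≤ h → Hj 1 = base ∧ Hk 1 = 0
  empty : h = 0 → j = base ∧ k = 0
  imp : ∀ plan, M.IsSolution plan →
    (∀ x, 1 ≤ x → x < h → Imp plan (ρ (Hj x)) (Hk x + 1) (ρ (Hj (x + 1))) (Hk (x + 1))) ∧
      (1 ≤ h → Imp plan (ρ (Hj h)) (Hk h + 1) (ρ j) k)

variable {c : Config n} {ρ : ℕ → Fin n} {seg : Fin n → ℕ} {base top h j k : ℕ} {Hj Hk : ℕ → ℕ}

theorem Cycle.occ_ne (X : M.Crossing) (C : M.Cycle c ρ seg base top) {i l j k : ℕ}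
    (h1 : Occ ρ seg base top i l) (h2 : Occ ρ seg base top j k) (hne : i = j → l ≠ k)
    (hv : M.vert (ρ i) l = M.vert (ρ j) k) : ρ i ≠ ρ j := by
  intro h
  have hij := C.inj i j h1.1 h1.2.1 h2.1 h2.2.1 h
  subst hij
  have := C.seg_le_len X h1.1 h1.2.1
  exact hne rfl (M.vert_inj (h1.2.2.1.trans this) (h2.2.2.1.trans this) hv)

/-- A vertex is visited at most twice. -/
theorem Cycle.occ_two (X : M.Crossing) (C : M.Cycle c ρ seg base top) {i l j k i' l' : ℕ}
    (h1 : Occ ρ seg base top i l) (h2 : Occ ρ seg base top j k) (h3 : Occ ρ seg base top i' l')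
    (h12 : i = j → l ≠ k) (h13 : i' = i → l' ≠ l) (h23 : i' = j → l' ≠ k)
    (hv : M.vert (ρ i) l = M.vert (ρ j) k) (hv' : M.vert (ρ i') l' = M.vert (ρ j) k) : False := by
  have o1 : M.On (ρ i) (M.vert (ρ j) k) := hv ▸ M.on_vert (ρ i) l
  have o3 : M.On (ρ i') (M.vert (ρ j) k) := hv' ▸ M.on_vert (ρ i') l'
  rcases X.two o1 (M.on_vert (ρ j) k) o3 (C.occ_ne X h1 h2 h12 hv) with h | h
  · exact C.occ_ne X h3 h1 h13 (hv'.trans hv.symm) h.symm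
  · exact C.occ_ne X h3 h2 h23 hv' h.symm

theorem Cycle.vert_seg_top (C : M.Cycle c ρ seg base top) :
    M.vert (ρ top) (seg (ρ top)) = M.vert (ρ base) 0 := by
  rw [(C.link top C.le le_rfl).eq, C.wrap, M.vert_zero]

theorem Cycle.occ_base (C : M.Cycle c ρ seg base top) : Occ ρ seg base top base 0 := by
  have := (C.link base le_rfl C.le).pos
  exact ⟨le_rfl, C.le, Nat.zero_le _, by omega, fun _ => rfl⟩

theorem Cycle.traversal_init (C : M.Cycle c ρ seg base top) :
    M.Traversal ρ seg base top 0 Hj Hk base 0 where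
  base_le := le_rfl
  le_top := C.le
  le_seg := Nat.zero_le _
  zero _ := rfl
  occ x h1 h2 := by omega
  sorted x y h1 h2 h3 := by omega
  fresh x h1 h2 := by omega
  paired i l h1 h2 := by rcases h2 with h2 | h2 <;> have := h1.1 <;> omega
  bottom h1 := by omega
  empty _ := ⟨rfl, rfl⟩
  imp plan _ := ⟨fun x h1 h2 => by omega, fun h1 => by omega⟩

/-- At the source of the next robot, the traversal passes on to that robot. -/
theorem Traversal.skip (X : M.Crossing) (C : M.Cycle c ρ seg base top)
    (T : M.Traversal ρ seg base top h Hj Hk j k) (hk : k = seg (ρ j)) (hj : j < top) :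
    M.Traversal ρ seg base top h Hj Hk (j + 1) 1 := by
  subst hk
  have hb := T.base_le
  have hbef : ∀ i l, Occ ρ seg base top i l → (Bef i l (j + 1) 1 ↔ Bef i l j (seg (ρ j))) := by
    rintro i l ⟨h1, h2, h3, h4, h5⟩
    constructor
    · rintro (h6 | ⟨rfl, h6⟩)
      · rcases Nat.lt_succ_iff_lt_or_eq.1 h6 with h7 | rfl
        · exact .inl h7
        · exact .inr ⟨rfl, lt_of_le_of_ne h3 fun h8 => by have := h4 h8; omega⟩
      · have := h5 (by omega); omega
    · rintro (h6 | ⟨rfl, h6⟩)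
      · exact .inl (by omega)
      · exact .inl (by omega)
  have hl := C.link j hb hj.le
  constructor
  · omega
  · omega
  · exact (C.link (j + 1) (by omega) (by omega)).pos
  · omega
  · intro x h1 h2
    have := T.occ x h1 h2
    exact ⟨this.1, (hbef _ _ this.1).2 this.2⟩
  · exact T.sorted
  · intro x h1 h2 i l h3 h4
    exact T.fresh x h1 h2 i l h3 ((hbef i l h3).1 h4)
  · intro i l h1 h2
    refine (T.paired i l h1 ((hbef i l h1).1 h2)).imp_right ?_
    rintro ⟨i', l', h3, h4, h5⟩
    exact ⟨i', l', h3, (hbef _ _ h3).2 h4, h5⟩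
  · exact T.bottom
  · intro h0
    have := (T.empty h0).2
    have := hl.pos
    omega
  · intro plan hp
    refine ⟨(T.imp plan hp).1, fun h1 => ((T.imp plan hp).2 h1).trans ?_⟩
    refine (hp.exclusive hl.ne (Nat.zero_le _) (C.seg_le_len X hb hj.le) ?_).resolve_left
      (not_imp_zero_succ _ _ _ _)
    rw [M.vert_zero, hl.eq]

/-- A vertex that has not been visited before is pushed. -/
theorem Traversal.push (C : M.Cycle c ρ seg base top)
    (T : M.Traversal ρ seg base top h Hj Hk j k) (ho : Occ ρ seg base top j k)
    (hnew : ∀ i l, Occ ρ seg base top i l → Bef i l j k → M.vert (ρ i) l ≠ M.vert (ρ j) k) :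
    M.Traversal ρ seg base top (h + 1) (Function.update Hj (h + 1) j)
      (Function.update Hk (h + 1) k) j (k + 1) := by
  have hbef : ∀ i l, Bef i l j (k + 1) ↔ Bef i l j k ∨ i = j ∧ l = k := by
    intro i l; unfold Bef; omega
  have hself : Bef j k j (k + 1) := .inr ⟨rfl, by omega⟩
  have hupd : ∀ x, x ≤ h → Function.update Hj (h + 1) j x = Hj x ∧
      Function.update Hk (h + 1) k x = Hk x := fun x hx => by
    rw [Function.update_of_ne (by omega), Function.update_of_ne (by omega)]; exact ⟨rfl, rfl⟩
  have hcase : ∀ x, x ≤ h + 1 → x ≤ h ∨ x = h + 1 := by omega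
  constructor
  · exact T.base_le
  · exact T.le_top
  · by_contra hlt
    have hk : k = seg (ρ j) := by have := T.le_seg; omega
    have hj := ho.2.2.2.1 hk
    subst hj hk
    have hp := (C.link j C.le le_rfl).pos
    refine hnew base 0 C.occ_base ?_ C.vert_seg_top.symm
    rcases C.le.lt_or_eq with h1 | h1
    · exact .inl h1
    · exact .inr ⟨h1, hp⟩
  · omega
  · intro x h1 h2
    rcases hcase x h2 with h3 | rfl
    · rw [(hupd x h3).1, (hupd x h3).2]
      exact ⟨(T.occ x h1 h3).1, (hbef _ _).2 (.inl (T.occ x h1 h3).2)⟩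
    · simpa using ⟨ho, hself⟩
  · intro x y h1 h2 h3
    have h4 := hupd x (by omega)
    rw [h4.1, h4.2]
    rcases hcase y h3 with h5 | rfl
    · rw [(hupd y h5).1, (hupd y h5).2]
      exact T.sorted x y h1 h2 h5
    · simpa using (T.occ x h1 (by omega)).2
  · intro x h1 h2 i l h3 h4 h5
    rcases hcase x h2 with h6 | rfl
    · rw [(hupd x h6).1, (hupd x h6).2] at h5 ⊢
      rcases (hbef _ _).1 h4 with h7 | ⟨rfl, rfl⟩
      · exact T.fresh x h1 h6 i l h3 h7 h5
      · exact (hnew _ _ (T.occ x h1 h6).1 (T.occ x h1 h6).2).symm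
    · simp only [Function.update_self] at h5 ⊢
      rcases (hbef _ _).1 h4 with h7 | ⟨rfl, rfl⟩
      · exact hnew i l h3 h7
      · exact absurd rfl (h5 rfl)
  · intro i l h1 h2
    rcases (hbef _ _).1 h2 with h3 | ⟨rfl, rfl⟩
    · refine (T.paired i l h1 h3).imp ?_ ?_
      · rintro ⟨x, h4, h5, h6⟩
        exact ⟨x, h4, by omega, by rwa [(hupd x h5).1, (hupd x h5).2]⟩
      · rintro ⟨i', l', h4, h5, h6⟩
        exact ⟨i', l', h4, (hbef _ _).2 (.inl h5), h6⟩
    · exact .inl ⟨h + 1, by omega, le_rfl, by simp, by simp⟩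
  · intro _
    rcases Nat.eq_zero_or_pos h with rfl | h1
    · simpa using T.empty rfl
    · rw [(hupd 1 h1).1, (hupd 1 h1).2]
      exact T.bottom h1
  · omega
  · intro plan hp
    obtain ⟨h1, h2⟩ := T.imp plan hp
    refine ⟨fun x h3 h4 => ?_, fun _ => ?_⟩
    · rw [(hupd x (by omega)).1, (hupd x (by omega)).2]
      rcases (show x + 1 ≤ h ∨ x = h by omega) with h5 | rfl
      · rw [(hupd _ h5).1, (hupd _ h5).2]
        exact h1 x h3 h5
      · simpa using h2 h3
    · simp only [Function.update_self]
      exact fun i hi => hi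

/-- What is known when the vertex of the current visit is on the top of the stack: the robot of the
current visit must leave it before the robot of the stack entry may enter it. -/
theorem Traversal.imp_top (X : M.Crossing) (C : M.Cycle c ρ seg base top)
    (T : M.Traversal ρ seg base top h Hj Hk j k) (ho : Occ ρ seg base top j k) (h1 : 1 ≤ h)
    (hv : M.vert (ρ (Hj h)) (Hk h) = M.vert (ρ j) k) {plan : List (Fin n)}
    (hp : M.IsSolution plan) : Imp plan (ρ (Hj h)) (Hk h) (ρ j) (k + 1) := by
  obtain ⟨o1, o2⟩ := T.occ h h1 le_rfl
  have hne : Hj h = j → Hk h ≠ k := by rcases o2 with o2 | o2 <;> omega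
  refine hp.imp_of_imp (C.occ_ne X o1 ho hne hv)
    (o1.2.2.1.trans (C.seg_le_len X o1.1 o1.2.1)) (ho.2.2.1.trans (C.seg_le_len X ho.1 ho.2.1))
    hv ?_ ((T.imp plan hp).2 h1)
  rcases Nat.eq_zero_or_pos k with rfl | h3
  · have h4 := T.zero rfl
    have := o1.1
    rcases o2 with o2 | o2 <;> omega
  · exact h3

/-- If the stack is about to become empty, there is no solution: the first robot of the cycle cannot
be at its source before the current robot has passed there. -/
theorem Traversal.no_solution (X : M.Crossing) (C : M.Cycle c ρ seg base top)
    (T : M.Traversal ρ seg base top h Hj Hk j k) (ho : Occ ρ seg base top j k) (h1 : h = 1)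
    (hv : M.vert (ρ (Hj h)) (Hk h) = M.vert (ρ j) k) : ¬ ∃ plan, M.IsSolution plan := by
  rintro ⟨plan, hp⟩
  have := T.imp_top X C ho h1.ge hv hp
  subst h1
  rw [(T.bottom le_rfl).2] at this
  exact not_imp_zero_succ _ _ _ _ this

/-- A vertex whose first visit is on the top of the stack is popped; the waiting relations are
composed. -/
theorem Traversal.pop (X : M.Crossing) (C : M.Cycle c ρ seg base top)
    (T : M.Traversal ρ seg base top h Hj Hk j k) (ho : Occ ρ seg base top j k) (h2 : 2 ≤ h)
    (hv : M.vert (ρ (Hj h)) (Hk h) = M.vert (ρ j) k) :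
    M.Traversal ρ seg base top (h - 1) Hj Hk j (k + 1) := by
  have hbef : ∀ i l, Bef i l j (k + 1) ↔ Bef i l j k ∨ i = j ∧ l = k := by
    intro i l; unfold Bef; omega
  have hself : Bef j k j (k + 1) := .inr ⟨rfl, by omega⟩
  obtain ⟨o1, o2⟩ := T.occ h (by omega) le_rfl
  have hne : ∀ x, 1 ≤ x → x < h → Hj h = Hj x → Hk h ≠ Hk x := fun x h3 h4 => by
    rcases T.sorted x h h3 h4 le_rfl with h5 | h5 <;> omega
  have htop : ∀ x, 1 ≤ x → x < h → M.vert (ρ j) k ≠ M.vert (ρ (Hj x)) (Hk x) := fun x h3 h4 => by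
    rw [← hv]
    exact T.fresh x h3 (by omega) _ _ o1 o2 (hne x h3 h4)
  constructor
  · exact T.base_le
  · exact T.le_top
  · by_contra hlt
    have hk : k = seg (ρ j) := by have := T.le_seg; omega
    have hj := ho.2.2.2.1 hk
    subst hj hk
    refine htop 1 le_rfl (by omega) ?_
    rw [C.vert_seg_top, (T.bottom (by omega)).1, (T.bottom (by omega)).2]
  · omega
  · intro x h3 h4
    have := T.occ x h3 (by omega)
    exact ⟨this.1, (hbef _ _).2 (.inl this.2)⟩
  · intro x y h3 h4 h5
    exact T.sorted x y h3 h4 (by omega)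
  · intro x h3 h4 i l h5 h6 h7
    rcases (hbef _ _).1 h6 with h8 | ⟨rfl, rfl⟩
    · exact T.fresh x h3 (by omega) i l h5 h8 h7
    · exact htop x h3 (by omega)
  · intro i l h3 h4
    rcases (hbef _ _).1 h4 with h5 | ⟨rfl, rfl⟩
    · rcases T.paired i l h3 h5 with ⟨x, h6, h7, h8, h9⟩ | ⟨i', l', h6, h7, h8⟩
      · rcases h7.lt_or_eq with h7 | rfl
        · exact .inl ⟨x, h6, by omega, h8, h9⟩
        · subst h8 h9
          refine .inr ⟨j, k, ho, hself, ?_, hv.symm⟩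
          rcases o2 with o2 | o2 <;> omega
      · exact .inr ⟨i', l', h6, (hbef _ _).2 (.inl h7), h8⟩
    · refine .inr ⟨Hj h, Hk h, o1, (hbef _ _).2 (.inl o2), ?_, hv⟩
      rcases o2 with o2 | o2 <;> omega
  · intro _
    exact T.bottom (by omega)
  · omega
  · intro plan hp
    obtain ⟨h3, h4⟩ := T.imp plan hp
    refine ⟨fun x h5 h6 => h3 x h5 (by omega), fun _ => ?_⟩
    have h5 := h3 (h - 1) (by omega) (by omega)
    rw [Nat.sub_add_cancel (by omega)] at h5
    exact h5.trans (T.imp_top X C ho (by omega) hv hp)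

/-- If the current vertex was visited before, but is not on the top of the stack, then the top of
the stack has been visited once between the two visits. -/
theorem Traversal.chord (X : M.Crossing) (C : M.Cycle c ρ seg base top)
    (T : M.Traversal ρ seg base top h Hj Hk j k) (ho : Occ ρ seg base top j k) {a ka : ℕ}
    (oa : Occ ρ seg base top a ka) (ba : Bef a ka j k)
    (hv : M.vert (ρ a) ka = M.vert (ρ j) k) (htop : a = Hj h → ka ≠ Hk h) :
    1 ≤ h ∧ M.Chord ρ seg base top a ka (Hj h) (Hk h) j k := by
  have haj : a = j → ka ≠ k := by rcases ba with ba | ba <;> omega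
  obtain ⟨x, h1, h2, h3, h4⟩ : ∃ x, 1 ≤ x ∧ x ≤ h ∧ Hj x = a ∧ Hk x = ka := by
    refine (T.paired a ka oa ba).resolve_right ?_
    rintro ⟨i', l', h1, h2, h3, h4⟩
    refine C.occ_two X oa ho h1 haj h3 ?_ hv (h4.trans hv)
    rcases h2 with h2 | h2 <;> omega
  subst h3 h4
  have hxh : x < h := lt_of_le_of_ne h2 fun h => htop (by rw [h]) (by rw [h])
  obtain ⟨o1, o2⟩ := T.occ h (by omega) le_rfl
  have hs := T.sorted x h h1 hxh le_rfl
  have hne := C.occ_ne X oa ho haj hv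
  have haj' : Hj x ≠ j := fun h => hne (by rw [h])
  have halt : Hj x < j := by rcases ba with ba | ba <;> omega
  have ob := o1.1
  have oab := oa.1
  have hjt := ho.2.1
  refine ⟨by omega, oab, halt, hjt, ?_, ?_, ?_, ?_, ho.2.2.1, hv, ?_, ?_, ?_, ?_, ?_⟩
  · rcases hs with hs | hs <;> omega
  · rcases o2 with o2 | o2 <;> omega
  · exact lt_of_le_of_ne oa.2.2.1 fun h => by have := oa.2.2.2.1 h; omega
  · exact Nat.pos_of_ne_zero fun h => by have := ho.2.2.2.2 h; omega
  · exact Nat.pos_of_ne_zero fun h => by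
      have := o1.2.2.2.2 h
      rcases hs with hs | hs <;> omega
  · refine lt_of_le_of_ne o1.2.2.1 fun h => ?_
    have h5 := o1.2.2.2.1 h
    have h6 := ho.2.2.1
    rcases o2 with o2 | ⟨o2, o3⟩
    · omega
    · rw [← o2] at h6; omega
  · intro h5; rcases hs with hs | hs <;> omega
  · intro h5; rcases o2 with o2 | o2 <;> omega
  · intro i h5 h6 h7 l h8 h9 h10
    have hi1 : base ≤ i := by omega
    have hi2 : i ≤ top := by omega
    by_cases hocc : l = seg (ρ i) ∧ i ≠ top
    · have hl := C.link i hi1 hi2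
      rw [hocc.1, hl.eq]
      refine (C.link (Hj h) ob o1.2.1).free (Hk h) ?_ ?_ _ (C.zero _ (by omega) (by omega))
      · exact Nat.pos_of_ne_zero fun h => by
          have := o1.2.2.2.2 h
          rcases hs with hs | hs <;> omega
      · refine lt_of_le_of_ne o1.2.2.1 fun h => ?_
        have h5 := o1.2.2.2.1 h
        have h6 := ho.2.2.1
        rcases o2 with o2 | ⟨o2, o3⟩
        · omega
        · rw [← o2] at h6; omega
    · have ol : Occ ρ seg base top i l :=
        ⟨hi1, hi2, h9, fun h => by by_contra h'; exact hocc ⟨h, h'⟩, by omega⟩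
      by_cases hb : Bef i l j k
      · exact T.fresh h (by omega) le_rfl i l ol hb fun h => absurd h h7
      · have hij : i = j ∧ l = k := by
          unfold Bef at hb
          have : i = j := by omega
          have := h10 this
          omega
        rw [hij.1, hij.2, ← hv]
        exact T.fresh h (by omega) le_rfl _ _ oa ba htop

end MRMPGP

namespace MRMPGP

/-! ### Straight paths on the grid -/

/-- An injective integer sequence with unit steps is an arithmetic progression. -/
theorem line_of_unit_steps {f : ℕ → ℤ} {L : ℕ}
    (hstep : ∀ k, k < L → f (k + 1) = f k + 1 ∨ f (k + 1) = f k - 1)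
    (hinj : ∀ k l, k ≤ L → l ≤ L → f k = f l → k = l) :
    (∀ k, k ≤ L → f k = f 0 + if f 0 ≤ f L then (k : ℤ) else -k) ∧
      (L : ℤ) = if f 0 ≤ f L then f L - f 0 else f 0 - f L := by
  have key : (∀ k, k ≤ L → f k = f 0 + k) ∨ (∀ k, k ≤ L → f k = f 0 - k) := by
    rcases Nat.eq_zero_or_pos L with rfl | hL
    · left
      intro k hk
      obtain rfl : k = 0 := by omega
      simp
    · rcases hstep 0 hL with h1 | h1
      · left
        intro k
        induction k using Nat.strong_induction_on with
        | _ k ih =>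
          intro hk
          rcases k with _ | _ | k
          · simp
          · simpa using h1
          · have h2 := ih k (by omega) (by omega)
            have h3 := ih (k + 1) (by omega) (by omega)
            have h4 := hstep (k + 1) (by omega)
            have h5 : f (k + 1 + 1) ≠ f k := fun h => by
              have := hinj _ _ hk (by omega) h; omega
            push_cast at *
            omega
      · right
        intro k
        induction k using Nat.strong_induction_on with
        | _ k ih =>
          intro hk
          rcases k with _ | _ | k
          · simp
          · simpa using h1
          · have h2 := ih k (by omega) (by omega)
            have h3 := ih (k + 1) (by omega) (by omega)
            have h4 := hstep (k + 1) (by omega)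
            have h5 : f (k + 1 + 1) ≠ f k := fun h => by
              have := hinj _ _ hk (by omega) h; omega
            push_cast at *
            omega
  rcases key with key | key
  · have h1 := key L le_rfl
    have h2 : f 0 ≤ f L := by omega
    simp only [h2, if_true]
    exact ⟨key, by omega⟩
  · have h1 := key L le_rfl
    rcases Nat.eq_zero_or_pos L with rfl | hL
    · refine ⟨fun k hk => ?_, by simp⟩
      obtain rfl : k = 0 := by omega
      simp
    · have h2 : ¬ f 0 ≤ f L := by omega
      simp only [h2, if_false]
      exact ⟨fun k hk => by rw [key k hk]; omega, by omega⟩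

variable {a b n : ℕ} (M : MRMPGP (gridGraph a b) n)

/-- The path of `r` is contained in a row. A path that consists of one vertex counts as contained in
a row. -/
abbrev Hz (r : Fin n) : Prop := (M.src r).1 = (M.trg r).1

/-- The coordinate of a vertex that is constant on the path of `r`. -/
def cfix (r : Fin n) (v : Fin a × Fin b) : ℤ := if M.Hz r then (v.1 : ℕ) else (v.2 : ℕ)

/-- The coordinate of a vertex that varies on the path of `r`. -/
def cmov (r : Fin n) (v : Fin a × Fin b) : ℤ := if M.Hz r then (v.2 : ℕ) else (v.1 : ℕ)

/-- The row or the column that contains the path of `r`. -/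
def line (r : Fin n) : ℤ := M.cfix r (M.src r)

/-- The varying coordinate of the source. -/
def ps (r : Fin n) : ℤ := M.cmov r (M.src r)

/-- The varying coordinate of the target. -/
def pt (r : Fin n) : ℤ := M.cmov r (M.trg r)

/-- The least varying coordinate on the path. -/
def lo (r : Fin n) : ℤ := if M.ps r ≤ M.pt r then M.ps r else M.pt r

/-- The greatest varying coordinate on the path. -/
def hi (r : Fin n) : ℤ := if M.ps r ≤ M.pt r then M.pt r else M.ps r

variable {M}

theorem vert_ext {r : Fin n} {v w : Fin a × Fin b} (h1 : M.cfix r v = M.cfix r w)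
    (h2 : M.cmov r v = M.cmov r w) : v = w := by
  unfold cfix at h1
  unfold cmov at h2
  split_ifs at h1 h2 <;>
    exact Prod.ext (Fin.ext (by omega)) (Fin.ext (by omega))

theorem Straight.line_vert (hS : M.Straight) (r : Fin n) (k : ℕ) :
    M.cfix r (M.vert r k) = M.line r := by
  have hk := M.on_vert r k
  have hs := M.on_src r
  have ht : M.On r (M.trg r) := (M.path r).end_mem_support
  by_cases hz : M.Hz r
  · rcases hS r with ⟨i, hi⟩ | ⟨j, hj⟩
    · simp only [cfix, line, if_pos hz, hi _ hk, hi _ hs]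
    · have h1 : M.src r = M.trg r := Prod.ext hz ((hj _ hs).trans (hj _ ht).symm)
      have h2 := (M.isPath r).getVert_eq_start_iff le_rfl (i := M.len r)
      have h3 : M.len r = 0 := h2.1 (by rw [SimpleGraph.Walk.getVert_length]; exact h1.symm)
      have h4 : M.vert r k = M.src r := by
        rw [vert, (M.path r).getVert_of_length_le (by simp only [len] at h3; omega), h1]
      rw [h4, line]
  · rcases hS r with ⟨i, hi⟩ | ⟨j, hj⟩
    · exact absurd ((hi _ hs).trans (hi _ ht).symm) hz
    · simp only [cfix, line, if_neg hz, hj _ hk, hj _ hs]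

theorem Straight.step (hS : M.Straight) {r : Fin n} {k : ℕ} (hk : k < M.len r) :
    M.cmov r (M.vert r (k + 1)) = M.cmov r (M.vert r k) + 1 ∨
      M.cmov r (M.vert r (k + 1)) = M.cmov r (M.vert r k) - 1 := by
  have h := SimpleGraph.boxProd_adj.1
    (show (gridGraph a b).Adj (M.vert r k) (M.vert r (k + 1)) from (M.path r).adj_getVert_succ hk)
  have h1 := (hS.line_vert r k).trans (hS.line_vert r (k + 1)).symm
  rw [SimpleGraph.pathGraph_adj, SimpleGraph.pathGraph_adj] at h
  unfold cfix at h1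
  unfold cmov
  split_ifs at h1 ⊢ <;> omega

/-- The varying coordinate changes monotonically along a path. -/
theorem Straight.progression (hS : M.Straight) (r : Fin n) :
    (∀ k, k ≤ M.len r →
      M.cmov r (M.vert r k) = M.ps r + if M.ps r ≤ M.pt r then (k : ℤ) else -k) ∧
    (M.len r : ℤ) = if M.ps r ≤ M.pt r then M.pt r - M.ps r else M.ps r - M.pt r := by
  have := line_of_unit_steps (f := fun k => M.cmov r (M.vert r k)) (L := M.len r)
    (fun k hk => hS.step hk) (fun k l hk hl h => M.vert_inj hk hl
      (vert_ext ((hS.line_vert r k).trans (hS.line_vert r l).symm) h))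
  have h0 : M.cmov r (M.vert r 0) = M.ps r := by rw [M.vert_zero]; rfl
  have hL : M.cmov r (M.vert r (M.len r)) = M.pt r := by
    simp only [vert, len, SimpleGraph.Walk.getVert_length]; rfl
  simp only [h0, hL] at this
  exact this

theorem Straight.on_iff (hS : M.Straight) (r : Fin n) (v : Fin a × Fin b) :
    M.On r v ↔ M.cfix r v = M.line r ∧ M.lo r ≤ M.cmov r v ∧ M.cmov r v ≤ M.hi r := by
  obtain ⟨h1, h2⟩ := hS.progression r
  rw [MRMPGP.on_iff]
  constructor
  · rintro ⟨k, rfl, hk⟩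
    refine ⟨hS.line_vert r k, ?_⟩
    rw [h1 k hk, lo, hi]
    split_ifs at h2 ⊢ <;> omega
  · rintro ⟨h3, h4, h5⟩
    unfold lo at h4
    unfold hi at h5
    obtain ⟨k, hk⟩ : ∃ k : ℕ, (k : ℤ) =
        if M.ps r ≤ M.pt r then M.cmov r v - M.ps r else M.ps r - M.cmov r v :=
      ⟨_, Int.toNat_of_nonneg (by split_ifs at h4 h5 ⊢ <;> omega)⟩
    have hkl : k ≤ M.len r := by split_ifs at h2 h4 h5 hk <;> omega
    refine ⟨k, vert_ext ((hS.line_vert r k).trans h3.symm) ?_, hkl⟩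
    rw [h1 k hkl]
    split_ifs at hk ⊢ <;> omega

/-- Two robots that move in the same row or column keep their order. -/
theorem Straight.order (hS : M.Straight) {plan : List (Fin n)} (hp : M.IsSolution plan)
    {r u : Fin n} (hz : M.Hz r ↔ M.Hz u) (hl : M.line r = M.line u)
    (h0 : M.ps r < M.ps u) : M.pt r < M.pt u := by
  have hru : r ≠ u := fun h => by subst h; omega
  have hc : M.cmov r = M.cmov u := by funext v; simp only [cmov, hz]
  have hf : M.cfix r = M.cfix u := by funext v; simp only [cfix, hz]
  have key : ∀ i, M.cmov r (M.loc (cfg plan i) r) < M.cmov r (M.loc (cfg plan i) u) := by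
    intro i
    induction i with
    | zero =>
      have hs : ∀ s, M.loc start s = M.src s := fun s => M.vert_zero s
      rw [cfg_zero, hs, hs]
      rwa [ps, ps, ← hc] at h0
    | succ i ih =>
      have hne : M.cmov r (M.loc (cfg plan (i + 1)) r) ≠ M.cmov r (M.loc (cfg plan (i + 1)) u) :=
        fun h => hp.loc_ne (i + 1) hru (vert_ext (r := r) (by
          rw [loc_eq, loc_eq, hS.line_vert r, hf, hS.line_vert u, hl]) h)
      rcases lt_or_ge i plan.length with hi | hi
      · have hle : cfg plan i plan[i] < M.len plan[i] := (hp.legal i hi).1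
        rw [cfg_succ plan i hi] at hne ⊢
        by_cases hr : plan[i] = r
        · rw [hr] at hle hne ⊢
          have hsu : M.loc (advance (cfg plan i) r) u = M.loc (cfg plan i) u := by
            simp [loc, advance, hru.symm]
          have hsr : M.loc (advance (cfg plan i) r) r = M.vert r (cfg plan i r + 1) := by
            simp [loc, advance]
          rw [hsu, hsr] at hne ⊢
          have := hS.step hle
          rw [loc_eq] at ih
          omega
        · by_cases hu : plan[i] = u
          · rw [hu] at hle hne ⊢
            have hsu : M.loc (advance (cfg plan i) u) r = M.loc (cfg plan i) r := by
              simp [loc, advance, hru]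
            have hsr : M.loc (advance (cfg plan i) u) u = M.vert u (cfg plan i u + 1) := by
              simp [loc, advance]
            rw [hsu, hsr] at hne ⊢
            have := hS.step hle
            rw [← hc] at this
            rw [loc_eq M _ u] at ih
            omega
          · have h1 : M.loc (advance (cfg plan i) plan[i]) r = M.loc (cfg plan i) r := by
              simp [loc, advance, Ne.symm hr]
            have h2 : M.loc (advance (cfg plan i) plan[i]) u = M.loc (cfg plan i) u := by
              simp [loc, advance, Ne.symm hu]
            rw [h1, h2]
            exact ih
      · rw [cfg_of_length_le plan i hi]; exact ih
  have := key plan.length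
  rw [hp.cfg_length] at this
  simp only [loc, goal, SimpleGraph.Walk.getVert_length] at this
  rwa [pt, pt, ← hc]

/-- Two paths in the same row or column that meet leave no solution. -/
theorem Straight.no_solution_of_collinear (hS : M.Straight) (hN : M.NonBlockingTargets)
    {r u : Fin n} (hru : r ≠ u) (hz : M.Hz r ↔ M.Hz u) (hl : M.line r = M.line u)
    (h1 : M.lo r ≤ M.hi u) (h2 : M.lo u ≤ M.hi r) : ¬ ∃ plan, M.IsSolution plan := by
  rintro ⟨plan, hp⟩
  have hc : M.cmov r = M.cmov u := by funext v; simp only [cmov, hz]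
  have hf : M.cfix r = M.cfix u := by funext v; simp only [cfix, hz]
  have ht : ∀ s, M.cfix s (M.trg s) = M.line s := fun s => by
    have := hS.line_vert s (M.len s)
    simpa only [vert, len, SimpleGraph.Walk.getVert_length] using this
  have hn1 := hN r u hru
  have hn2 := hN u r hru.symm
  have e1 := hS.on_iff r (M.trg u)
  have e2 := hS.on_iff u (M.trg r)
  rw [hf, ht u, hc] at e1
  rw [← hf, ht r, ← hc] at e2
  have e3 := mt e1.2 hn1
  have e4 := mt e2.2 hn2
  change ¬ (_ ∧ M.lo r ≤ M.pt u ∧ M.pt u ≤ M.hi r) at e3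
  change ¬ (_ ∧ M.lo u ≤ M.pt r ∧ M.pt r ≤ M.hi u) at e4
  have h5 := hS.order hp hz hl
  have h6 := hS.order hp hz.symm hl.symm
  have h7 : M.ps r ≠ M.ps u := fun h => hru (hp.1 (vert_ext (r := r)
    (by rw [← line, hl, hf]; rfl) (by rw [← ps, h, hc]; rfl)))
  unfold lo at *
  unfold hi at *
  split_ifs at * <;> omega

/-- What an instance has to satisfy, besides non-blocking targets and multiplicity two, so that no
two paths share more than one vertex and no two sources coincide. -/
theorem Straight.crossing (hS : M.Straight) (hN : M.NonBlockingTargets)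
    (hm : M.vertexMultiplicity ≤ 2)
    (h1 : ∀ r u, r ≠ u → (M.Hz r ↔ M.Hz u) → M.line r = M.line u → M.lo r ≤ M.hi u →
      M.lo u ≤ M.hi r → False)
    (h2 : ∀ r u, ¬ (M.Hz r ↔ M.Hz u) → M.ps r = M.line u → M.ps u = M.line r → False) :
    M.Crossing := by
  have hdiff : ∀ {r s : Fin n} {v : Fin a × Fin b}, r ≠ s → M.On r v → M.On s v →
      ¬ (M.Hz r ↔ M.Hz s) := by
    intro r s v hrs hr hs hz
    have hc : M.cmov r = M.cmov s := by funext v; simp only [cmov, hz]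
    have hf : M.cfix r = M.cfix s := by funext v; simp only [cfix, hz]
    rw [hS.on_iff] at hr hs
    rw [← hc, ← hf] at hs
    exact h1 r s hrs hz (hr.1.symm.trans hs.1) (by omega) (by omega)
  have hcm : ∀ {r s : Fin n} (v : Fin a × Fin b), ¬ (M.Hz r ↔ M.Hz s) →
      M.cmov r v = M.cfix s v := by
    intro r s v hz
    unfold cmov cfix
    split_ifs <;> tauto
  refine ⟨?_, ?_, hN, ?_⟩
  · intro v r s t hr hs ht hrs
    by_contra hne
    push Not at hne
    have h3 : M.multiplicity v ≤ 2 := (Finset.le_sup (Finset.mem_univ v)).trans hm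
    have h4 : ({r, s, t} : Finset (Fin n)).card = 3 := by
      rw [Finset.card_eq_three]; exact ⟨r, s, t, hrs, hne.1, hne.2, rfl⟩
    have h5 : (({r, s, t} : Finset (Fin n)) : Set (Fin n)) ⊆
        {r : Fin n | v ∈ (M.path r).support} := by
      intro x hx
      simp only [Finset.coe_insert, Finset.coe_singleton, Set.mem_insert_iff,
        Set.mem_singleton_iff] at hx
      rcases hx with rfl | rfl | rfl <;> assumption
    have h6 := Set.ncard_le_ncard h5 (Set.toFinite _)
    rw [Set.ncard_coe_finset, h4] at h6
    unfold multiplicity at h3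
    omega
  · intro v w r s hrs hrv hsv hrw hsw
    have hz := hdiff hrs hrv hsv
    rw [hS.on_iff] at hrv hsv hrw hsw
    exact vert_ext (r := r) (hrv.1.trans hrw.1.symm)
      (by rw [hcm v hz, hcm w hz, hsv.1, hsw.1])
  · intro r s hrs
    by_contra hne
    have hz := hdiff hne (M.on_src r) (hrs ▸ M.on_src s)
    refine h2 r s hz ?_ ?_
    · rw [ps, hcm _ hz, hrs]; rfl
    · rw [ps, hcm _ fun h => hz h.symm, ← hrs]; rfl

/-- Perpendicular paths with the same source leave no solution. -/
theorem no_solution_of_src_eq {r u : Fin n} (hz : ¬ (M.Hz r ↔ M.Hz u))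
    (h1 : M.ps r = M.line u) (h2 : M.ps u = M.line r) : ¬ ∃ plan, M.IsSolution plan := by
  rintro ⟨plan, hp⟩
  have hru : r ≠ u := fun h => hz (by rw [h])
  refine hru (hp.1 ?_)
  unfold ps cmov line cfix at *
  split_ifs at h1 h2 <;> first | tauto | exact Prod.ext (Fin.ext (by omega)) (Fin.ext (by omega))

end MRMPGP

/-! ### Total correctness with running time -/

/-- Started in `s`, the program `p` halts in a state `s'` after `T` steps such that `Q s' T`. -/
def Tot (p : Program) (s : State) (Q : State → ℕ → Prop) : Prop :=
  ∃ s' T, Run p s s' T ∧ Q s' T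

theorem Tot.mono {p : Program} {s : State} {Q Q' : State → ℕ → Prop} (h : Tot p s Q)
    (hQ : ∀ s' T, Q s' T → Q' s' T) : Tot p s Q' := by
  obtain ⟨s', T, h1, h2⟩ := h
  exact ⟨s', T, h1, hQ _ _ h2⟩

@[simp] theorem tot_skip {s : State} {Q : State → ℕ → Prop} : Tot .skip s Q ↔ Q s 1 :=
  ⟨by rintro ⟨_, _, ⟨⟩, h⟩; exact h, fun h => ⟨_, _, .skip s, h⟩⟩

@[simp] theorem tot_assign {s : State} {x : ℕ} {e : Expr} {Q : State → ℕ → Prop} :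
    Tot (.assign x e) s Q ↔ Q (s.setReg x (e.eval s)) 1 :=
  ⟨by rintro ⟨_, _, ⟨⟩, h⟩; exact h, fun h => ⟨_, _, .assign s x e, h⟩⟩

@[simp] theorem tot_write {s : State} {A : ℕ} {i j e : Expr} {Q : State → ℕ → Prop} :
    Tot (.write A i j e) s Q ↔ Q (s.setArr A (i.eval s) (j.eval s) (e.eval s)) 1 :=
  ⟨by rintro ⟨_, _, ⟨⟩, h⟩; exact h, fun h => ⟨_, _, .write s A i j e, h⟩⟩

@[simp] theorem tot_emit {s : State} {e : Expr} {Q : State → ℕ → Prop} :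
    Tot (.emit e) s Q ↔ Q (s.emit (e.eval s)) 1 :=
  ⟨by rintro ⟨_, _, ⟨⟩, h⟩; exact h, fun h => ⟨_, _, .emit s e, h⟩⟩

theorem tot_seq {p q : Program} {s : State} {Q : State → ℕ → Prop} :
    Tot (.seq p q) s Q ↔ Tot p s fun s₁ T₁ => Tot q s₁ fun s₂ T₂ => Q s₂ (T₁ + T₂) := by
  constructor
  · rintro ⟨_, _, h, hQ⟩
    cases h with
    | seq h1 h2 => exact ⟨_, _, h1, _, _, h2, hQ⟩
  · rintro ⟨_, _, h1, _, _, h2, hQ⟩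
    exact ⟨_, _, .seq h1 h2, hQ⟩

@[simp] theorem tot_ite {t : Test} {p q : Program} {s : State} {Q : State → ℕ → Prop} :
    Tot (.ite t p q) s Q ↔ (t.holds s → Tot p s fun s' T => Q s' (T + 1)) ∧
      (¬ t.holds s → Tot q s fun s' T => Q s' (T + 1)) := by
  constructor
  · rintro ⟨_, _, h, hQ⟩
    cases h with
    | ite_true ht h => exact ⟨fun _ => ⟨_, _, h, hQ⟩, fun h' => absurd ht h'⟩
    | ite_false ht h => exact ⟨fun h' => absurd h' ht, fun _ => ⟨_, _, h, hQ⟩⟩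
  · rintro ⟨h1, h2⟩
    by_cases ht : t.holds s
    · obtain ⟨_, _, h, hQ⟩ := h1 ht
      exact ⟨_, _, .ite_true ht h, hQ⟩
    · obtain ⟨_, _, h, hQ⟩ := h2 ht
      exact ⟨_, _, .ite_false ht h, hQ⟩

/-- The rule for loops. The number `m` in the invariant is a potential that pays for the steps. -/
theorem Tot.while {t : Test} {p : Program} (I : ℕ → State → Prop)
    (h : ∀ m s, I m s → t.holds s → Tot p s fun s' T => ∃ m', I m' s' ∧ T + 1 + m' ≤ m)
    {m : ℕ} {s : State} (h0 : I m s) :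
    Tot (.while t p) s fun s' T => ¬ t.holds s' ∧ ∃ m', I m' s' ∧ T + m' ≤ m + 1 := by
  induction m using Nat.strong_induction_on generalizing s with
  | _ m ih =>
    by_cases ht : t.holds s
    · obtain ⟨s1, T1, h1, m1, h2, h3⟩ := h m s h0 ht
      obtain ⟨s2, T2, h4, h5, m2, h6, h7⟩ := ih m1 (by omega) h2
      exact ⟨s2, _, .while_true ht h1 h4, h5, m2, h6, by omega⟩
    · exact ⟨s, 1, .while_false ht, ht, m, h0, by omega⟩

/-- Sequential execution of a list of programs. -/
def block : List Program → Program
  | [] => .skip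
  | p :: l => .seq p (block l)

@[simp] theorem tot_block_nil {s : State} {Q : State → ℕ → Prop} :
    Tot (block []) s Q ↔ Q s 1 := tot_skip

@[simp] theorem tot_block_cons {p : Program} {l : List Program} {s : State}
    {Q : State → ℕ → Prop} :
    Tot (block (p :: l)) s Q ↔ Tot p s fun s₁ T₁ => Tot (block l) s₁ fun s₂ T₂ =>
      Q s₂ (T₁ + T₂) := tot_seq

/-- Run the body for the values `0, …, bound - 1` of the register `x`. -/
def forLoop (x : ℕ) (bound : Expr) (p : Program) : Program :=
  block [.assign x (.const 0),
    .while (.le (.addConst (.reg x) 1) bound)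
      (block [p, .assign x (.addConst (.reg x) 1)])]

/-- The rule for counting loops: `i` is the value of the counter, `m` a potential, and `B` a bound
for the steps of the body that the potential does not pay for. -/
theorem tot_forLoop {x : ℕ} {bound : Expr} {p : Program} (N B : ℕ)
    (I : ℕ → ℕ → State → Prop)
    (hI : ∀ i m s, I i m s → s.reg x = i ∧ bound.eval s = N)
    (h : ∀ i m s, i < N → I i m s → Tot p s fun s' T =>
      ∃ m', I (i + 1) m' (s'.setReg x (s'.reg x + 1)) ∧ T + m' ≤ m + B)
    {m : ℕ} {s : State} (h0 : I 0 m (s.setReg x 0)) :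
    Tot (forLoop x bound p) s fun s' T => ∃ m', I N m' s' ∧ T + m' ≤ m + N * (B + 3) + 3 := by
  have key := Tot.while (t := .le (.addConst (.reg x) 1) bound)
    (p := block [p, .assign x (.addConst (.reg x) 1)])
    (fun q s => ∃ i m', i ≤ N ∧ I i m' s ∧ q = m' + (N - i) * (B + 3))
    (by
      rintro q s ⟨i, m', hi, hs, rfl⟩ ht
      obtain ⟨h1, h2⟩ := hI i m' s hs
      simp only [Test.holds, Expr.eval, h1, h2] at ht
      have hlt : i < N := by omega
      simp only [tot_block_cons, tot_block_nil, tot_assign, Expr.eval]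
      refine (h i m' s hlt hs).mono ?_
      rintro s' T ⟨m'', h3, h4⟩
      refine ⟨_, ⟨i + 1, m'', hlt, h3, rfl⟩, ?_⟩
      obtain ⟨d, rfl⟩ := Nat.exists_eq_add_of_lt hlt
      have e1 : i + d + 1 - i = d + 1 := by omega
      have e2 : i + d + 1 - (i + 1) = d := by omega
      rw [e1, e2, Nat.succ_mul]
      omega)
    (m := m + (N - 0) * (B + 3)) (s := s.setReg x 0) ⟨0, m, Nat.zero_le _, h0, rfl⟩
  simp only [forLoop, tot_block_cons, tot_block_nil, tot_assign, Expr.eval]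
  refine key.mono ?_
  rintro s' T ⟨h1, q, ⟨i, m', hi, hs, rfl⟩, h3⟩
  obtain ⟨h4, h5⟩ := hI i m' s' hs
  simp only [Test.holds, Expr.eval, h4, h5] at h1
  obtain rfl : i = N := by omega
  refine ⟨m', hs, ?_⟩
  simp only [Nat.sub_self, Nat.zero_mul, Nat.add_zero, Nat.sub_zero] at h3
  omega

/-! ### Memory -/

/-- Change one entry of an array. -/
def upd (f : ℤ → ℤ → ℤ) (i j z : ℤ) : ℤ → ℤ → ℤ :=
  fun i' j' => if i' = i ∧ j' = j then z else f i' j'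

theorem upd_apply (f : ℤ → ℤ → ℤ) (i j z i' j' : ℤ) :
    upd f i j z i' j' = if i' = i ∧ j' = j then z else f i' j' := rfl

namespace State

variable (s : State) (x y A B : ℕ) (i j z : ℤ)

@[simp] theorem setReg_reg : (s.setReg x z).reg y = if y = x then z else s.reg y := by
  simp [setReg, Function.update_apply]

@[simp] theorem setReg_arr : (s.setReg x z).arr = s.arr := rfl

@[simp] theorem setReg_out : (s.setReg x z).out = s.out := rfl

@[simp] theorem setArr_reg : (s.setArr A i j z).reg = s.reg := rfl

@[simp] theorem setArr_out : (s.setArr A i j z).out = s.out := rfl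

@[simp] theorem setArr_arr :
    (s.setArr A i j z).arr B = if B = A then upd (s.arr A) i j z else s.arr B := by
  funext i' j'
  by_cases h : B = A
  · subst h; simp [setArr, upd]
  · simp [setArr, h]

@[simp] theorem emit_reg : (s.emit z).reg = s.reg := rfl

@[simp] theorem emit_arr : (s.emit z).arr = s.arr := rfl

@[simp] theorem emit_out : (s.emit z).out = s.out ++ [z] := rfl

end State

/-! ### Registers and arrays of the program -/

/-- The number of robots (input). -/
@[simp] abbrev rN : ℕ := 0
/-- The robot treated by the outer loop. -/
@[simp] abbrev rR : ℕ := 3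
/-- The robot treated by the inner loop. -/
@[simp] abbrev rU : ℕ := 4
/-- Set to `1` when it turns out that there is no solution. -/
@[simp] abbrev rFail : ℕ := 5
/-- A varying coordinate. -/
@[simp] abbrev rM : ℕ := 6
/-- A number of edges on a path. -/
@[simp] abbrev rK : ℕ := 7
/-- Another robot. -/
@[simp] abbrev rO : ℕ := 8
/-- The coordinate that is constant on a path. -/
@[simp] abbrev rF : ℕ := 9
/-- The varying coordinate of a source. -/
@[simp] abbrev rP : ℕ := 10
/-- The varying coordinate of a target. -/
@[simp] abbrev rQ : ℕ := 11

/-- The input array. -/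
@[simp] abbrev aIn : ℕ := 0
/-- Row `r`: whether the path of `r` is in a row, its line, the varying coordinate of the source,
the least and the greatest varying coordinate, and whether the varying coordinate increases. -/
@[simp] abbrev aRob : ℕ := 1
/-- Entry `(r, m)`: the number plus one of the robot that crosses the path of `r` at the varying
coordinate `m`, or zero. -/
@[simp] abbrev aCross : ℕ := 2
/-- Entry `(r, k)`: the varying coordinate of `r` after `k` edges. -/
@[simp] abbrev aMov : ℕ := 3
/-- Entry `(r, k)`: the number plus one of the other robot that visits the `k`-th vertex on the path
of `r`, or zero. -/
@[simp] abbrev aOth : ℕ := 4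
/-- Entry `(r, o)`: the number of edges plus one after which `r` meets the path of `o`. -/
@[simp] abbrev aIx : ℕ := 5

/-- An array entry. -/
abbrev ld (A : ℕ) (i j : Expr) : Expr := .read A i j

/-! ### Reading the input -/

/-- Compute the data of robot `rR`. -/
def readRobot : Program := block [
  .ite (.eq (ld aIn (.reg rR) (.const 0)) (ld aIn (.reg rR) (.const 2)))
    (block [
      .write aRob (.reg rR) (.const 0) (.const 1),
      .assign rF (ld aIn (.reg rR) (.const 0)),
      .assign rP (ld aIn (.reg rR) (.const 1)),
      .assign rQ (ld aIn (.reg rR) (.const 3))])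
    (block [
      .write aRob (.reg rR) (.const 0) (.const 0),
      .assign rF (ld aIn (.reg rR) (.const 1)),
      .assign rP (ld aIn (.reg rR) (.const 0)),
      .assign rQ (ld aIn (.reg rR) (.const 2))]),
  .write aRob (.reg rR) (.const 1) (.reg rF),
  .write aRob (.reg rR) (.const 2) (.reg rP),
  .ite (.le (.reg rP) (.reg rQ))
    (block [
      .write aRob (.reg rR) (.const 3) (.reg rP),
      .write aRob (.reg rR) (.const 4) (.reg rQ),
      .write aRob (.reg rR) (.const 5) (.const 1)])
    (block [
      .write aRob (.reg rR) (.const 3) (.reg rQ),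
      .write aRob (.reg rR) (.const 4) (.reg rP),
      .write aRob (.reg rR) (.const 5) (.const 0)])]

namespace MRMPGP

variable {a b n : ℕ}

/-- Row `r` of the array `A` holds the data of robot `r`. -/
structure RobotRow (M : MRMPGP (gridGraph a b) n) (A : ℤ → ℤ → ℤ) (r : Fin n) : Prop where
  hz : A r 0 = if M.Hz r then 1 else 0
  line : A r 1 = M.line r
  ps : A r 2 = M.ps r
  lo : A r 3 = M.lo r
  hi : A r 4 = M.hi r
  dir : A r 5 = if M.ps r ≤ M.pt r then 1 else 0

variable {M : MRMPGP (gridGraph a b) n}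

theorem inputArray_apply (r : Fin n) :
    inputArray M r 0 = ((M.src r).1 : ℕ) ∧ inputArray M r 1 = ((M.src r).2 : ℕ) ∧
    inputArray M r 2 = ((M.trg r).1 : ℕ) ∧ inputArray M r 3 = ((M.trg r).2 : ℕ) := by
  have : ((r : ℕ) : ℤ).toNat < n ∧ (0 : ℤ) ≤ (r : ℕ) := by simp
  simp [inputArray]

/-- The invariant of reading the input. -/
structure ReadInv (M : MRMPGP (gridGraph a b) n) (i : ℕ) (s : State) : Prop where
  reg_r : s.reg 3 = i
  reg_n : s.reg 0 = n
  fail : s.reg 5 = 0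
  input : s.arr 0 = inputArray M
  row : ∀ r : Fin n, (r : ℕ) < i → RobotRow M (s.arr 1) r
  zero : ∀ A, 2 ≤ A → s.arr A = fun _ _ => 0
  out : s.out = []

theorem tot_readRobot {i : ℕ} {s : State} (hi : i < n) (h : ReadInv M i s) :
    Tot readRobot s fun s' T => T ≤ 20 ∧ ReadInv M (i + 1) (s'.setReg 3 (s'.reg 3 + 1)) := by
  obtain ⟨h1, h2, h3, h4, h5, h6, h7⟩ := h
  set r : Fin n := ⟨i, hi⟩ with hr
  have hri : (i : ℤ) = ((r : ℕ) : ℤ) := rfl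
  obtain ⟨e0, e1, e2, e3⟩ := inputArray_apply (M := M) r
  have hrow : ∀ A : ℤ → ℤ → ℤ, (∀ q : Fin n, (q : ℕ) < i → ∀ k, A q k = s.arr 1 q k) →
      RobotRow M A r → ∀ q : Fin n, (q : ℕ) < i + 1 → RobotRow M A q := by
    intro A hA hAr q hq
    rcases Nat.lt_succ_iff_lt_or_eq.1 hq with hq | hq
    · obtain ⟨g1, g2, g3, g4, g5, g6⟩ := h5 q hq
      constructor <;> rw [hA q hq] <;> assumption
    · obtain rfl : q = r := Fin.ext hq
      exact hAr
  have hhz : ((M.src r).1 : ℕ) = ((M.trg r).1 : ℕ) ↔ M.Hz r := Fin.ext_iff.symm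
  simp only [readRobot, tot_block_cons, tot_block_nil, tot_ite, tot_assign, tot_write, Expr.eval,
    Test.holds, rR, aIn, aRob, rF, rP, rQ, State.setReg_reg, State.setReg_arr, State.setArr_reg,
    State.setArr_arr, Nat.reduceEqDiff, zero_ne_one, if_true, if_false, h1, h4, hri, e0,
    e1, e2, e3, Nat.cast_inj, hhz]
  have hne : ∀ q : Fin n, (q : ℕ) < i → ¬ q = r := fun q hq h => by
    rw [h] at hq; exact lt_irrefl _ hq
  refine ⟨fun hz => ⟨fun hle => ?_, fun hle => ?_⟩, fun hz => ⟨fun hle => ?_, fun hle => ?_⟩⟩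
  all_goals
    refine ⟨by norm_num, ?_⟩
    constructor
    · simp [hri]
    · simpa using h2
    · simpa using h3
    · simpa using h4
    · refine hrow _ ?_ ?_
      · intro q hq k
        simp [upd_apply, Fin.val_inj, hne q hq]
      · constructor <;>
          simp only [State.setReg_arr, State.setArr_arr, upd_apply, Nat.reduceEqDiff,
            MRMPGP.line, MRMPGP.ps, MRMPGP.pt, MRMPGP.lo, MRMPGP.hi, cfix, cmov, Int.reduceEq,
            and_true, and_false, if_true, if_false]
        all_goals
          solve
          | simp only [if_pos hz, if_pos hle]
          | simp only [if_pos hz, if_neg hle]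
          | simp only [if_neg hz, if_pos hle]
          | simp only [if_neg hz, if_neg hle]
    · intro A hA
      have : A ≠ 1 := by omega
      simp [this, h6 A hA]
    · simpa using h7

end MRMPGP

/-- Compute the data of all robots. -/
def readInput : Program := forLoop rR (.reg rN) readRobot

/-! ### Crossings -/

/-- Record where the robots `rR` and `rU` cross. If their paths share more than one vertex or they
start at the same vertex, set `rFail`. -/
def comparePair : Program :=
  .ite (.not (.eq (.reg rR) (.reg rU)))
    (.ite (.eq (ld aRob (.reg rR) (.const 0)) (ld aRob (.reg rU) (.const 0)))
      (.ite (.and (.eq (ld aRob (.reg rR) (.const 1)) (ld aRob (.reg rU) (.const 1)))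
          (.and (.le (ld aRob (.reg rR) (.const 3)) (ld aRob (.reg rU) (.const 4)))
            (.le (ld aRob (.reg rU) (.const 3)) (ld aRob (.reg rR) (.const 4)))))
        (.assign rFail (.const 1)) .skip)
      (.ite (.and (.and (.le (ld aRob (.reg rR) (.const 3)) (ld aRob (.reg rU) (.const 1)))
            (.le (ld aRob (.reg rU) (.const 1)) (ld aRob (.reg rR) (.const 4))))
          (.and (.le (ld aRob (.reg rU) (.const 3)) (ld aRob (.reg rR) (.const 1)))
            (.le (ld aRob (.reg rR) (.const 1)) (ld aRob (.reg rU) (.const 4)))))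
        (block [
          .write aCross (.reg rR) (ld aRob (.reg rU) (.const 1)) (.addConst (.reg rU) 1),
          .ite (.and (.eq (ld aRob (.reg rR) (.const 2)) (ld aRob (.reg rU) (.const 1)))
              (.eq (ld aRob (.reg rU) (.const 2)) (ld aRob (.reg rR) (.const 1))))
            (.assign rFail (.const 1)) .skip])
        .skip))
    .skip

/-- Compare all pairs of robots. -/
def comparePairs : Program := forLoop rR (.reg rN) (forLoop rU (.reg rN) comparePair)

namespace MRMPGP

variable {a b n : ℕ}

/-- What is known in the whole remaining computation. -/
structure Known (M : MRMPGP (gridGraph a b) n) (s : State) : Prop where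
  reg_n : s.reg 0 = n
  input : s.arr 0 = inputArray M
  row : ∀ r : Fin n, RobotRow M (s.arr 1) r
  out : s.out = []

/-- The paths of `r` and `u` are perpendicular and meet. -/
def Cross (M : MRMPGP (gridGraph a b) n) (r u : Fin n) : Prop :=
  ¬ (M.Hz r ↔ M.Hz u) ∧ (M.lo r ≤ M.line u ∧ M.line u ≤ M.hi r) ∧
    M.lo u ≤ M.line r ∧ M.line r ≤ M.hi u

/-- The paths of `r` and `u` do not meet in the same row or column, and the sources of `r` and `u`
are distinct if the paths are perpendicular. -/
def Good (M : MRMPGP (gridGraph a b) n) (r u : Fin n) : Prop :=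
  r ≠ u → ((M.Hz r ↔ M.Hz u) → ¬ (M.line r = M.line u ∧ M.lo r ≤ M.hi u ∧ M.lo u ≤ M.hi r)) ∧
    (¬ (M.Hz r ↔ M.Hz u) → ¬ (M.ps r = M.line u ∧ M.ps u = M.line r))

/-- The invariant of the comparisons, where the pairs in `D` have been compared. -/
structure PairInv (M : MRMPGP (gridGraph a b) n) (D : Fin n → Fin n → Prop) (s : State) :
    Prop where
  known : Known M s
  fail : (s.reg 5 = 0 ∧ ∀ r u, D r u → M.Good r u) ∨
    (s.reg 5 = 1 ∧ ¬ ∃ plan, M.IsSolution plan)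
  found : ∀ r u, D r u → M.Cross r u → s.arr 2 r (M.line u) ≠ 0
  only : ∀ r : Fin n, ∀ m, s.arr 2 r m ≠ 0 →
    ∃ u, M.Cross r u ∧ M.line u = m ∧ s.arr 2 r m = (u : ℕ) + 1
  zero : ∀ A, 3 ≤ A → s.arr A = fun _ _ => 0

variable {M : MRMPGP (gridGraph a b) n}

theorem tot_readInput :
    Tot readInput (inputState M) fun s' T => T ≤ n * 23 + 3 ∧ ReadInv M n s' := by
  refine (tot_forLoop n 20 (fun i m s => ReadInv M i s ∧ m = 0) ?_ ?_ (m := 0) ⟨?_, rfl⟩).mono ?_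
  · rintro i m s ⟨h, -⟩
    exact ⟨h.reg_r, h.reg_n⟩
  · rintro i m s hi ⟨h, rfl⟩
    refine (tot_readRobot hi h).mono fun s' T h => ⟨0, ⟨h.2, rfl⟩, by omega⟩
  · constructor
    · simp
    · simp [inputState]
    · simp [inputState]
    · funext r k; simp [inputState]
    · intro r hr; omega
    · intro A hA
      have : A ≠ 0 := by omega
      simp [inputState, this]
    · simp [inputState]
  · rintro s' T ⟨m, ⟨h, rfl⟩, h2⟩
    exact ⟨by omega, h⟩

theorem Known.setReg {s : State} (h : Known M s) {x : ℕ} {z : ℤ} (hx : x ≠ 0) :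
    Known M (s.setReg x z) :=
  ⟨by simpa [hx.symm] using h.reg_n, h.input, h.row, h.out⟩

theorem Known.setArr {s : State} (h : Known M s) {A : ℕ} {i j z : ℤ} (hA : 2 ≤ A) :
    Known M (s.setArr A i j z) := by
  have h0 : 0 ≠ A := by omega
  have h1 : 1 ≠ A := by omega
  exact ⟨h.reg_n, by simpa [h0] using h.input, by simpa [h1] using h.row, h.out⟩

theorem PairInv.mono {D D' : Fin n → Fin n → Prop} {s : State} (h : PairInv M D s)
    (hD : ∀ r u, D' r u → D r u) : PairInv M D' s :=
  ⟨h.known, h.fail.imp_left fun h => ⟨h.1, fun r u hr => h.2 r u (hD r u hr)⟩,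
    fun r u hr => h.found r u (hD r u hr), h.only, h.zero⟩

theorem PairInv.setReg {D : Fin n → Fin n → Prop} {s : State} (h : PairInv M D s) {x : ℕ} {z : ℤ}
    (hx : x ≠ 0) (hx' : x ≠ 5) : PairInv M D (s.setReg x z) :=
  ⟨h.known.setReg hx, by simpa [hx'.symm] using h.fail, h.found, h.only, h.zero⟩

theorem ite_one_zero_inj {p q : Prop} [Decidable p] [Decidable q] :
    ((if p then (1 : ℤ) else 0) = if q then 1 else 0) ↔ (p ↔ q) := by
  by_cases hp : p <;> by_cases hq : q <;> simp [hp, hq]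

theorem tot_comparePair (hS : M.Straight) (hN : M.NonBlockingTargets)
    {D : Fin n → Fin n → Prop} {s : State} (h : PairInv M D s) (r u : Fin n)
    (hr : s.reg 3 = r) (hu : s.reg 4 = u) :
    Tot comparePair s fun s' T => T ≤ 10 ∧ s'.reg 3 = r ∧ s'.reg 4 = u ∧
      PairInv M (fun p q => D p q ∨ p = r ∧ q = u) s' := by
  obtain ⟨r0, r1, r2, r3, r4, r5⟩ := h.known.row r
  obtain ⟨u0, u1, u2, u3, u4, u5⟩ := h.known.row u
  have hz : ((if M.Hz r then (1 : ℤ) else 0) = if M.Hz u then 1 else 0) ↔ (M.Hz r ↔ M.Hz u) :=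
    ite_one_zero_inj
  -- the cases in which nothing is written
  have key : M.Good r u → ¬ M.Cross r u → PairInv M (fun p q => D p q ∨ p = r ∧ q = u) s := by
    intro hg hc
    refine ⟨h.known, h.fail.imp_left fun h => ⟨h.1, ?_⟩, ?_, h.only, h.zero⟩
    · rintro p q (hpq | ⟨rfl, rfl⟩)
      · exact h.2 p q hpq
      · exact hg
    · rintro p q (hpq | ⟨rfl, rfl⟩) h1
      · exact h.found p q hpq h1
      · exact absurd h1 hc
  simp only [comparePair, tot_block_cons, tot_block_nil, tot_ite, tot_assign, tot_write, tot_skip,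
    Expr.eval, Test.holds, rR, rU, aRob, aCross, rFail, State.setArr_reg, State.setArr_arr,
    Nat.reduceEqDiff, if_false, hr, hu, r0, r1, r2, r3, r4, u0, u1, u2, u3, u4, hz, Nat.cast_inj,
    Fin.val_inj]
  refine ⟨fun hru => ⟨fun hzz => ⟨fun hb => ?_, fun hb => ?_⟩, fun hzz => ⟨fun hb => ?_,
    fun hb => ?_⟩⟩, fun hru => ?_⟩
  · refine ⟨by norm_num, by simpa using hr, by simpa using hu, ?_⟩
    have hno := hS.no_solution_of_collinear hN hru hzz hb.1 hb.2.1 hb.2.2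
    refine ⟨h.known.setReg (by norm_num), .inr ⟨by simp, hno⟩, ?_, h.only, h.zero⟩
    rintro p q (hpq | ⟨rfl, rfl⟩) h1
    · exact h.found p q hpq h1
    · exact absurd hzz h1.1
  · exact ⟨by norm_num, trivial, trivial, key (fun _ => ⟨fun _ => hb, fun h => absurd hzz h⟩)
      fun h => h.1 hzz⟩
  · have hcross : M.Cross r u := ⟨hzz, hb.1, hb.2⟩
    have hfound : ∀ p q, (D p q ∨ p = r ∧ q = u) → M.Cross p q →
        upd (s.arr 2) r (M.line u) ((u : ℕ) + 1) p (M.line q) ≠ 0 := by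
      intro p q hpq h1
      rw [upd_apply]
      split_ifs with h2
      · omega
      · rcases hpq with hpq | ⟨rfl, rfl⟩
        · exact h.found p q hpq h1
        · exact absurd ⟨rfl, rfl⟩ h2
    have honly : ∀ p : Fin n, ∀ m, upd (s.arr 2) r (M.line u) ((u : ℕ) + 1) p m ≠ 0 →
        ∃ q, M.Cross p q ∧ M.line q = m ∧
          upd (s.arr 2) r (M.line u) ((u : ℕ) + 1) p m = (q : ℕ) + 1 := by
      intro p m
      rw [upd_apply]
      split_ifs with h2
      · intro _
        obtain ⟨h3, rfl⟩ := h2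
        obtain rfl : p = r := Fin.ext (by exact_mod_cast h3)
        exact ⟨u, hcross, rfl, rfl⟩
      · exact h.only p m
    have hzero : ∀ A, 3 ≤ A → (s.setArr 2 r (M.line u) ((u : ℕ) + 1)).arr A = fun _ _ => 0 := by
      intro A hA
      have : A ≠ 2 := by omega
      simpa [this] using h.zero A hA
    refine ⟨fun hb2 => ?_, fun hb2 => ?_⟩
    · refine ⟨by norm_num, by simpa using hr, by simpa using hu, ?_⟩
      have hno := no_solution_of_src_eq hzz hb2.1 hb2.2
      exact ⟨(h.known.setArr le_rfl).setReg (by norm_num), .inr ⟨by simp, hno⟩,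
        by simpa using hfound, by simpa using honly, hzero⟩
    · refine ⟨by norm_num, trivial, trivial, h.known.setArr le_rfl,
        h.fail.imp_left fun h => ⟨h.1, ?_⟩,
        by simpa using hfound, by simpa using honly, hzero⟩
      rintro p q (hpq | ⟨rfl, rfl⟩)
      · exact h.2 p q hpq
      · exact fun _ => ⟨fun h => absurd h hzz, fun _ => hb2⟩
  · refine ⟨by norm_num, trivial, trivial, key (fun _ => ⟨fun h => absurd h hzz, fun _ h => hb ?_⟩)
      fun h => hb h.2⟩
    unfold MRMPGP.lo MRMPGP.hi
    split_ifs <;> omega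
  · rw [not_not] at hru
    exact ⟨by norm_num, trivial, trivial, key (fun h => absurd hru h) fun h => h.1 (by rw [hru])⟩

theorem tot_comparePairs (hS : M.Straight) (hN : M.NonBlockingTargets) {s : State}
    (h : ReadInv M n s) :
    Tot comparePairs s fun s' T => T ≤ n * (n * 13 + 3 + 3) + 3 ∧
      PairInv M (fun _ _ => True) s' := by
  have houter : ∀ i m s, i < n →
      (PairInv M (fun r _ => (r : ℕ) < i) s ∧ s.reg 3 = i ∧ m = 0) →
      Tot (forLoop rU (.reg rN) comparePair) s fun s' T =>
        ∃ m', (PairInv M (fun r _ => (r : ℕ) < i + 1) (s'.setReg 3 (s'.reg 3 + 1)) ∧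
          (s'.setReg 3 (s'.reg 3 + 1)).reg 3 = (i + 1 : ℕ) ∧ m' = 0) ∧
          T + m' ≤ m + (n * 13 + 3) := by
    rintro i m s hi ⟨h, hr, rfl⟩
    refine (tot_forLoop n 10 (fun j m s =>
      PairInv M (fun r u => (r : ℕ) < i ∨ (r : ℕ) = i ∧ (u : ℕ) < j) s ∧ s.reg 3 = i ∧
        s.reg 4 = j ∧ m = 0) ?_ ?_ (m := 0) ?_).mono ?_
    · rintro j m s ⟨h, h1, h2, h3⟩
      exact ⟨h2, h.known.reg_n⟩
    · rintro j m s hj ⟨h, h1, h2, rfl⟩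
      refine (tot_comparePair hS hN h ⟨i, hi⟩ ⟨j, hj⟩ h1 h2).mono ?_
      rintro s' T ⟨hT, h3, h4, h5⟩
      refine ⟨0, ⟨(h5.mono ?_).setReg (by norm_num) (by norm_num), ?_, ?_, rfl⟩, by omega⟩
      · rintro p q (hp | ⟨hp, hq⟩)
        · exact .inl (.inl hp)
        · rcases Nat.lt_succ_iff_lt_or_eq.1 hq with hq | hq
          · exact .inl (.inr ⟨hp, hq⟩)
          · exact .inr ⟨Fin.ext hp, Fin.ext hq⟩
      · simpa using h3
      · simp [h4]
    · refine ⟨(h.mono ?_).setReg (by norm_num) (by norm_num), by simpa using hr, by simp, rfl⟩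
      rintro p q (hp | ⟨_, hq⟩)
      · exact hp
      · omega
    · rintro s' T ⟨m', ⟨h1, h2, h3, rfl⟩, h4⟩
      refine ⟨0, ⟨(h1.mono ?_).setReg (by norm_num) (by norm_num), by simp [h2], rfl⟩, by omega⟩
      intro p q hp
      rcases Nat.lt_succ_iff_lt_or_eq.1 hp with hp | hp
      · exact .inl hp
      · exact .inr ⟨hp, q.2⟩
  refine (tot_forLoop n _ (fun i m s =>
    PairInv M (fun r _ => (r : ℕ) < i) s ∧ s.reg 3 = i ∧ m = 0) ?_ houter (m := 0) ?_).mono ?_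
  · rintro i m s ⟨h, h1, rfl⟩
    exact ⟨h1, h.known.reg_n⟩
  · refine ⟨⟨⟨by simpa using h.reg_n, h.input, fun r => h.row r r.2, h.out⟩,
      .inl ⟨by simpa using h.fail, fun r _ hr => absurd hr (by omega)⟩,
      fun r _ hr => absurd hr (by omega), ?_, fun A hA => h.zero A (by omega)⟩, by simp, rfl⟩
    intro r m hm
    rw [State.setReg_arr, h.zero 2 le_rfl] at hm
    exact absurd rfl hm
  · rintro s' T ⟨m, ⟨h1, _, rfl⟩, h3⟩
    exact ⟨by omega, h1.mono fun r _ _ => r.2⟩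

end MRMPGP

/-! ### Walking along the paths -/

/-- Record the data of the vertex at which robot `rR` is after `rK` edges. -/
def recordVertex : Program := block [
  .assign rO (ld aCross (.reg rR) (.reg rM)),
  .write aMov (.reg rR) (.reg rK) (.reg rM),
  .write aOth (.reg rR) (.reg rK) (.reg rO)]

/-- Go to the next vertex on the path of robot `rR`. -/
def walkStep : Program := block [
  .write aIx (.reg rR) (.addConst (.reg rO) (-1)) (.addConst (.reg rK) 1),
  .ite (.eq (ld aRob (.reg rR) (.const 5)) (.const 1))
    (.assign rM (.addConst (.reg rM) 1)) (.assign rM (.addConst (.reg rM) (-1))),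
  .assign rK (.addConst (.reg rK) 1),
  recordVertex]

/-- Walk along the path of robot `rR` up to the first vertex that is on no other path. -/
def walkRun : Program := block [
  .assign rM (ld aRob (.reg rR) (.const 2)),
  .assign rK (.const 0),
  recordVertex,
  .while (.not (.eq (.reg rO) (.const 0))) walkStep]

/-- Walk along all paths. -/
def walkRuns : Program := forLoop rR (.reg rN) walkRun

namespace MRMPGP

variable {a b n : ℕ}

/-- The number `z` encodes the other robot whose path contains the `k`-th vertex of the path of `r`:
it is zero if there is none, and otherwise the number of that robot plus one. -/
def OthVal (M : MRMPGP (gridGraph a b) n) (r : Fin n) (k : ℕ) (z : ℤ) : Prop :=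
  (∀ o, o ≠ r → M.On o (M.vert r k) → z = (o : ℕ) + 1) ∧ (M.Clear r k → z = 0)

/-- The tables `MV`, `OT` and `IX` are correct for the pairs of a robot and a number of edges in `P`
(in `Q`, for the table `IX`). -/
structure Tables (M : MRMPGP (gridGraph a b) n) (P Q : Fin n → ℕ → Prop)
    (MV OT IX : ℤ → ℤ → ℤ) : Prop where
  mov : ∀ (r : Fin n) (k : ℕ), P r k → MV r k = M.cmov r (M.vert r k)
  oth : ∀ (r : Fin n) (k : ℕ), P r k → M.OthVal r k (OT r k)
  ix : ∀ (r : Fin n) (k : ℕ) (o : Fin n), Q r k → o ≠ r → M.On o (M.vert r k) →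
    IX r o = (k : ℤ) + 1
  ix_only : ∀ r o : Fin n, IX r o ≠ 0 →
    o ≠ r ∧ ∃ k : ℕ, k < M.run r ∧ M.On o (M.vert r k) ∧ IX r o = (k : ℤ) + 1

/-- The invariant of walking. -/
structure WalkInv (M : MRMPGP (gridGraph a b) n) (P Q : Fin n → ℕ → Prop) (s : State) :
    Prop where
  known : Known M s
  fail : s.reg 5 = 0
  cross : ∀ (r : Fin n) (k : ℕ), M.OthVal r k (s.arr 2 r (M.cmov r (M.vert r k)))
  tables : M.Tables P Q (s.arr 3) (s.arr 4) (s.arr 5)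
  zero : ∀ A, 6 ≤ A → s.arr A = fun _ _ => 0

variable {M : MRMPGP (gridGraph a b) n}

theorem crossing_of_good (hS : M.Straight) (hN : M.NonBlockingTargets)
    (hm : M.vertexMultiplicity ≤ 2) (h : ∀ r u, M.Good r u) : M.Crossing :=
  hS.crossing hN hm (fun r u hru hz hl h1 h2 => (h r u hru).1 hz ⟨hl, h1, h2⟩)
    fun r u hz h1 h2 => (h r u fun h => hz (by rw [h])).2 hz ⟨h1, h2⟩

theorem cfix_eq_cmov {r u : Fin n} (hz : ¬ (M.Hz r ↔ M.Hz u)) (v : Fin a × Fin b) :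
    M.cfix u v = M.cmov r v ∧ M.cmov u v = M.cfix r v := by
  unfold cfix cmov
  by_cases h1 : M.Hz r <;> by_cases h2 : M.Hz u
  · exact absurd (iff_of_true h1 h2) hz
  · rw [if_neg h2, if_pos h1, if_neg h2, if_pos h1]; exact ⟨rfl, rfl⟩
  · rw [if_pos h2, if_neg h1, if_pos h2, if_neg h1]; exact ⟨rfl, rfl⟩
  · exact absurd (iff_of_false h1 h2) hz

/-- The table of crossings yields the other robot at every vertex of a path. -/
theorem PairInv.othVal (hS : M.Straight) (X : M.Crossing) {s : State}
    (h : PairInv M (fun _ _ => True) s) (hg : ∀ r u, M.Good r u) (r : Fin n) (k : ℕ) :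
    M.OthVal r k (s.arr 2 r (M.cmov r (M.vert r k))) := by
  have hr := M.on_vert r k
  have hr' := (hS.on_iff r _).1 hr
  -- a robot that is found at the coordinate of the vertex visits the vertex
  have hon : ∀ u, M.Cross r u → M.line u = M.cmov r (M.vert r k) → M.On u (M.vert r k) := by
    intro u hu hl
    obtain ⟨h1, h2⟩ := cfix_eq_cmov hu.1 (M.vert r k)
    exact (hS.on_iff u _).2 ⟨by omega, by rw [h2, hr'.1]; exact hu.2.2⟩
  have hne : ∀ u, M.Cross r u → u ≠ r := fun u hu h => hu.1 (by rw [h])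
  refine ⟨fun o ho hov => ?_, fun hc => ?_⟩
  · have ho' := (hS.on_iff o _).1 hov
    have hz : ¬ (M.Hz r ↔ M.Hz o) := fun hz => by
      have hc : M.cmov r = M.cmov o := by funext v; simp only [cmov, hz]
      have hf : M.cfix r = M.cfix o := by funext v; simp only [cfix, hz]
      rw [hc, hf] at hr'
      exact (hg r o ho.symm).1 hz ⟨by omega, by omega, by omega⟩
    obtain ⟨h1, h2⟩ := cfix_eq_cmov hz (M.vert r k)
    have hcr : M.Cross r o := ⟨hz, by omega, by omega⟩
    have h3 := h.found r o trivial hcr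
    rw [← ho'.1, h1] at h3
    obtain ⟨u, hu, hl, h4⟩ := h.only r _ h3
    rw [h4]
    rcases X.two hr hov (hon u hu hl) ho.symm with h5 | h5
    · exact absurd h5.symm (hne u hu)
    · rw [h5]
  · by_contra h3
    obtain ⟨u, hu, hl, h4⟩ := h.only r _ h3
    exact hc u (hne u hu) (hon u hu hl)

theorem OthVal.run_le {r : Fin n} {k : ℕ} {z : ℤ} (h : M.OthVal r k z) (hz : z = 0) :
    M.run r ≤ k := by
  by_contra hk
  obtain ⟨o, ho, hov⟩ := exists_other (not_le.1 hk)
  have := h.1 o ho hov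
  omega

theorem OthVal.exists {r : Fin n} {k : ℕ} {z : ℤ} (h : M.OthVal r k z) (hz : z ≠ 0) :
    ∃ o, o ≠ r ∧ M.On o (M.vert r k) ∧ z = (o : ℕ) + 1 := by
  have hc : ¬ M.Clear r k := fun hc => hz (h.2 hc)
  simp only [Clear, not_forall, not_not] at hc
  obtain ⟨o, ho, hov⟩ := hc
  exact ⟨o, ho, hov, h.1 o ho hov⟩

theorem Tables.mono {P Q P' Q' : Fin n → ℕ → Prop} {MV OT IX : ℤ → ℤ → ℤ}
    (h : M.Tables P Q MV OT IX) (hP : ∀ r k, P' r k → P r k)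
    (hQ : ∀ r k, Q' r k → Q r k ∨ M.Clear r k) : M.Tables P' Q' MV OT IX :=
  ⟨fun r k hr => h.mov r k (hP r k hr), fun r k hr => h.oth r k (hP r k hr),
    fun r k o hr ho hov => (hQ r k hr).elim (fun hr => h.ix r k o hr ho hov)
      fun hr => absurd hov (hr o ho), h.ix_only⟩

/-- Add a vertex to the tables. -/
theorem Tables.record {P Q : Fin n → ℕ → Prop} {MV OT IX : ℤ → ℤ → ℤ}
    (h : M.Tables P Q MV OT IX) (r : Fin n) (k : ℕ) {z : ℤ} (hz : M.OthVal r k z) :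
    M.Tables (fun p l => P p l ∨ p = r ∧ l = k) Q (upd MV r k (M.cmov r (M.vert r k)))
      (upd OT r k z) IX := by
  refine ⟨fun p l hp => ?_, fun p l hp => ?_, h.ix, h.ix_only⟩
  all_goals
    rw [upd_apply]
    split_ifs with h1
    · obtain ⟨h2, h3⟩ := h1
      obtain rfl : p = r := Fin.ext (by exact_mod_cast h2)
      obtain rfl : l = k := by exact_mod_cast h3
      first | rfl | exact hz
    · rcases hp with hp | ⟨rfl, rfl⟩
      · first | exact h.mov p l hp | exact h.oth p l hp
      · exact absurd ⟨rfl, rfl⟩ h1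

/-- Add an index to the tables. An earlier index is not overwritten, as two paths share at most one
vertex. -/
theorem Tables.index (X : M.Crossing) {P Q : Fin n → ℕ → Prop} {MV OT IX : ℤ → ℤ → ℤ}
    (h : M.Tables P Q MV OT IX) {r o : Fin n} {k : ℕ} (hk : k < M.run r) (ho : o ≠ r)
    (hov : M.On o (M.vert r k)) :
    M.Tables P (fun p l => Q p l ∨ p = r ∧ l = k) MV OT (upd IX r o (k + 1)) := by
  refine ⟨h.mov, h.oth, fun p l u hp hu huv => ?_, fun p u => ?_⟩
  · rw [upd_apply]
    split_ifs with h1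
    · obtain ⟨h2, h3⟩ := h1
      obtain rfl : p = r := Fin.ext (by exact_mod_cast h2)
      obtain rfl : u = o := Fin.ext (by exact_mod_cast h3)
      rcases hp with hp | ⟨-, rfl⟩
      · have h4 := h.ix p l u hp hu huv
        obtain ⟨-, l', h5, h6, h7⟩ := h.ix_only p u (by omega)
        have hl : l = l' := by omega
        subst hl
        rw [X.eq_of_on ho (h5.le.trans (X.run_le_len p)) (hk.le.trans (X.run_le_len p)) huv hov]
      · rfl
    · rcases hp with hp | ⟨rfl, rfl⟩
      · exact h.ix p l u hp hu huv
      · rcases X.two (M.on_vert p l) hov huv ho.symm with h2 | h2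
        · exact absurd h2.symm hu
        · exact absurd ⟨rfl, by rw [h2]⟩ h1
  · rw [upd_apply]
    split_ifs with h1
    · obtain ⟨h2, h3⟩ := h1
      obtain rfl : p = r := Fin.ext (by exact_mod_cast h2)
      obtain rfl : u = o := Fin.ext (by exact_mod_cast h3)
      exact fun _ => ⟨ho, k, hk, hov, rfl⟩
    · exact h.ix_only p u

theorem WalkInv.setReg {P Q : Fin n → ℕ → Prop} {s : State} (h : WalkInv M P Q s) {x : ℕ} {z : ℤ}
    (hx : x ≠ 0) (hx' : x ≠ 5) : WalkInv M P Q (s.setReg x z) :=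
  ⟨h.known.setReg hx, by simpa [hx'.symm] using h.fail, h.cross, h.tables, h.zero⟩

theorem WalkInv.mono {P Q P' Q' : Fin n → ℕ → Prop} {s : State} (h : WalkInv M P Q s)
    (hP : ∀ r k, P' r k → P r k) (hQ : ∀ r k, Q' r k → Q r k ∨ M.Clear r k) :
    WalkInv M P' Q' s :=
  ⟨h.known, h.fail, h.cross, h.tables.mono hP hQ, h.zero⟩

theorem tot_recordVertex {P Q : Fin n → ℕ → Prop} {s : State} (h : WalkInv M P Q s) (r : Fin n)
    (k : ℕ) (h3 : s.reg 3 = r) (h7 : s.reg 7 = k) (h6 : s.reg 6 = M.cmov r (M.vert r k)) :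
    Tot recordVertex s fun s' T => T ≤ 4 ∧ s'.reg 3 = r ∧ s'.reg 7 = k ∧
      s'.reg 6 = M.cmov r (M.vert r k) ∧ M.OthVal r k (s'.reg 8) ∧
      WalkInv M (fun p l => P p l ∨ p = r ∧ l = k) Q s' := by
  simp only [recordVertex, tot_block_cons, tot_block_nil, tot_assign, tot_write, Expr.eval, rR, rM,
    rK, rO, aCross, aMov, aOth, State.setReg_reg, State.setReg_arr, State.setArr_reg,
    State.setArr_arr, Nat.reduceEqDiff, if_true, if_false, h3, h6, h7]
  have hz := h.cross r k
  refine ⟨by norm_num, trivial, trivial, trivial, hz,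
    ((h.known.setReg (by norm_num)).setArr (by norm_num)).setArr (by norm_num),
    by simpa using h.fail, by simpa using h.cross, by simpa using h.tables.record r k hz, ?_⟩
  intro A hA
  have h1 : A ≠ 3 := by omega
  have h2 : A ≠ 4 := by omega
  simpa [h1, h2] using h.zero A hA

/-- The vertices of the paths of the first `i` robots, and the first `k` vertices after the source
of the next robot. -/
def Walked (M : MRMPGP (gridGraph a b) n) (i k : ℕ) (p : Fin n) (l : ℕ) : Prop :=
  (p : ℕ) < i ∧ l ≤ M.run p ∨ (p : ℕ) = i ∧ l < k

theorem tot_walkStep (hS : M.Straight) (X : M.Crossing) {P Q : Fin n → ℕ → Prop} {s : State}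
    (h : WalkInv M P Q s) (r : Fin n)
    (k : ℕ) (h3 : s.reg 3 = r) (h7 : s.reg 7 = k) (h6 : s.reg 6 = M.cmov r (M.vert r k))
    (h8 : M.OthVal r k (s.reg 8)) (h0 : s.reg 8 ≠ 0) (hk : k < M.run r) :
    Tot walkStep s fun s' T => T ≤ 10 ∧ s'.reg 3 = r ∧ s'.reg 7 = (k + 1 : ℕ) ∧
      s'.reg 6 = M.cmov r (M.vert r (k + 1)) ∧ M.OthVal r (k + 1) (s'.reg 8) ∧
      WalkInv M (fun p l => P p l ∨ p = r ∧ l = k + 1) (fun p l => Q p l ∨ p = r ∧ l = k) s' := by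
  obtain ⟨o, ho, hov, h9⟩ := h8.exists h0
  have hdir := (h.known.row r).dir
  have hlen := X.run_le_len r
  have hp1 := (hS.progression r).1 k (by omega)
  have hp2 := (hS.progression r).1 (k + 1) (by omega)
  have hw : ∀ m : ℤ, m = M.cmov r (M.vert r (k + 1)) → Tot recordVertex
      (((s.setArr 5 r o (k + 1)).setReg 6 m).setReg 7 (k + 1)) fun s' T =>
      T ≤ 4 ∧ s'.reg 3 = r ∧ s'.reg 7 = (k + 1 : ℕ) ∧
      s'.reg 6 = M.cmov r (M.vert r (k + 1)) ∧ M.OthVal r (k + 1) (s'.reg 8) ∧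
      WalkInv M (fun p l => P p l ∨ p = r ∧ l = k + 1) (fun p l => Q p l ∨ p = r ∧ l = k) s' := by
    rintro m rfl
    refine tot_recordVertex (WalkInv.setReg (WalkInv.setReg ?_ (by norm_num) (by norm_num))
      (by norm_num) (by norm_num)) r (k + 1) (by simpa using h3) (by simp) (by simp)
    refine ⟨h.known.setArr (by norm_num), h.fail, by simpa using h.cross,
      by simpa using h.tables.index X hk ho hov, fun A hA => ?_⟩
    have h1 : A ≠ 5 := by omega
    simpa [h1] using h.zero A hA
  have e : (s.reg 8 + -1) = (o : ℕ) := by omega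
  simp only [walkStep, tot_block_cons, tot_block_nil, tot_ite, tot_assign, tot_write, Expr.eval,
    Test.holds, rR, rM, rK, rO, aRob, aIx, State.setReg_reg, State.setReg_arr, State.setArr_reg,
    State.setArr_arr, Nat.reduceEqDiff, if_true, if_false, h3, h6, h7, e, hdir]
  refine ⟨fun hd => ?_, fun hd => ?_⟩
  all_goals
    refine (hw _ ?_).mono ?_
    · by_cases hle : M.ps r ≤ M.pt r
      · simp only [if_pos hle, not_true_eq_false] at hd hp1 hp2
        all_goals push_cast at hp2; omega
      · simp only [if_neg hle, zero_ne_one, not_false_eq_true] at hd hp1 hp2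
        all_goals push_cast at hp2; omega
    · rintro s' T ⟨h1, h2⟩
      exact ⟨by omega, h2⟩

theorem tot_walkRun (hS : M.Straight) (X : M.Crossing) {s : State} {i : ℕ} (hi : i < n)
    (h : WalkInv M (M.Walked i 0) (M.Walked i 0) s) (h3 : s.reg 3 = i) :
    Tot walkRun s fun s' T => T ≤ 11 * n + 12 ∧ s'.reg 3 = i ∧
      WalkInv M (M.Walked (i + 1) 0) (M.Walked (i + 1) 0) s' := by
  set r : Fin n := ⟨i, hi⟩ with hr
  have hps := (h.known.row r).ps
  have hrun := X.run_le r
  have h3' : s.reg 3 = (r : ℕ) := h3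
  have hW : ∀ {k p l}, M.Walked i (k + 1) p l → M.Walked i k p l ∨ p = r ∧ l = k := by
    rintro k p l (h | ⟨h1, h2⟩)
    · exact .inl (.inl h)
    · rcases Nat.lt_succ_iff_lt_or_eq.1 h2 with h2 | h2
      · exact .inl (.inr ⟨h1, h2⟩)
      · exact .inr ⟨Fin.ext h1, h2⟩
  have hloop := fun m s => Tot.while (m := m) (s := s) 
    (t := .not (.eq (.reg rO) (.const 0))) (p := walkStep)
    (fun m s => ∃ k, k ≤ M.run r ∧ s.reg 3 = (r : ℕ) ∧ s.reg 7 = k ∧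
      s.reg 6 = M.cmov r (M.vert r k) ∧ M.OthVal r k (s.reg 8) ∧
      WalkInv M (M.Walked i (k + 1)) (M.Walked i k) s ∧ m + 11 * k = 11 * M.run r) (by
    rintro m s ⟨k, hk, h3, h7, h6, h8, h, hm⟩ ht
    simp only [Test.holds, Expr.eval, rO] at ht
    have hk' : k < M.run r := by
      refine hk.lt_of_ne fun h => ht (h8.2 ?_)
      rw [h]; exact X.clear_run r
    refine (tot_walkStep hS X h r k h3 h7 h6 h8 ht hk').mono ?_
    rintro s' T ⟨h1, h2, h3, h4, h5, h6⟩
    exact ⟨11 * M.run r - 11 * (k + 1), ⟨k + 1, hk', h2, h3, h4, h5,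
      h6.mono (fun _ _ => hW) (fun _ _ h => .inl (hW h)), by omega⟩, by omega⟩)
  simp only [walkRun, tot_block_cons, tot_block_nil, tot_assign, Expr.eval, rR, rM, rK, aRob,
    State.setReg_reg, State.setReg_arr, Nat.reduceEqDiff, if_true, if_false, h3', hps]
  refine (tot_recordVertex ((h.setReg (by norm_num) (by norm_num)).setReg (by norm_num)
    (by norm_num)) r 0 (by simpa using h3') (by simp) (by simp [MRMPGP.ps])).mono ?_
  rintro s1 T1 ⟨g1, g2, g3, g4, g5, g6⟩
  refine (hloop (11 * M.run r) s1 ⟨0, Nat.zero_le _, g2, g3, g4, g5,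
    g6.mono (fun _ _ => hW) (fun _ _ h => .inl h), rfl⟩).mono ?_
  rintro s2 T2 ⟨e1, m, ⟨k, e2, e3, e4, e5, e6, e7, e8⟩, e9⟩
  simp only [Test.holds, Expr.eval, rO, not_not] at e1
  obtain rfl : k = M.run r := le_antisymm e2 (e6.run_le e1)
  refine ⟨by omega, e3, ?_⟩
  refine e7.mono ?_ ?_
  · rintro p l (⟨h1, h2⟩ | ⟨h1, h2⟩)
    · rcases Nat.lt_succ_iff_lt_or_eq.1 h1 with h1 | h1
      · exact .inl ⟨h1, h2⟩
      · obtain rfl : p = r := Fin.ext h1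
        exact .inr ⟨h1, Nat.lt_succ_of_le h2⟩
    · omega
  · rintro p l (⟨h1, h2⟩ | ⟨h1, h2⟩)
    · rcases Nat.lt_succ_iff_lt_or_eq.1 h1 with h1 | h1
      · exact .inl (.inl ⟨h1, h2⟩)
      · obtain rfl : p = r := Fin.ext h1
        rcases h2.lt_or_eq with h2 | rfl
        · exact .inl (.inr ⟨h1, h2⟩)
        · exact .inr (X.clear_run _)
    · omega

theorem tot_walkRuns (hS : M.Straight) (X : M.Crossing) {s : State}
    (h : PairInv M (fun _ _ => True) s) (hg : ∀ r u, M.Good r u) (h5 : s.reg 5 = 0) :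
    Tot walkRuns s fun s' T => T ≤ n * (11 * n + 12 + 3) + 3 ∧
      WalkInv M (fun r k => k ≤ M.run r) (fun r k => k ≤ M.run r) s' := by
  refine (tot_forLoop n (11 * n + 12) (fun i m s =>
    WalkInv M (M.Walked i 0) (M.Walked i 0) s ∧ s.reg 3 = i ∧ m = 0) ?_ ?_ (m := 0) ?_).mono ?_
  · rintro i m s ⟨h, h1, rfl⟩
    exact ⟨h1, h.known.reg_n⟩
  · rintro i m s hi ⟨h, h1, rfl⟩
    refine (tot_walkRun hS X hi h h1).mono ?_
    rintro s' T ⟨h2, h3, h4⟩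
    exact ⟨0, ⟨h4.setReg (by norm_num) (by norm_num), by simp [h3], rfl⟩, by omega⟩
  · refine ⟨WalkInv.setReg ⟨h.known, h5, h.othVal hS X hg, ⟨?_, ?_, ?_, ?_⟩,
      fun A hA => h.zero A (by omega)⟩ (by norm_num) (by norm_num), by simp, rfl⟩
    · rintro r k (⟨h1, h2⟩ | ⟨h1, h2⟩) <;> omega
    · rintro r k (⟨h1, h2⟩ | ⟨h1, h2⟩) <;> omega
    · rintro r k o (⟨h1, h2⟩ | ⟨h1, h2⟩) <;> omega
    · intro r o h1
      rw [h.zero 5 (by norm_num)] at h1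
      exact absurd rfl h1
  · rintro s' T ⟨m, ⟨h1, h2, rfl⟩, h3⟩
    exact ⟨by omega, h1.mono (fun r k hk => .inl ⟨r.2, hk⟩) fun r k hk => .inl (.inl ⟨r.2, hk⟩)⟩

end MRMPGP

/-! ### Moving robots -/

/-- The number of robots on the stack. -/
@[simp] abbrev rD : ℕ := 12
/-- The result of a scan. -/
@[simp] abbrev rMode : ℕ := 13
/-- An entry of the table `aIx`. -/
@[simp] abbrev rZ : ℕ := 14
/-- The robot that is to be moved. -/
@[simp] abbrev rX : ℕ := 22
/-- The number of edges on its path after which it is to stop. -/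
@[simp] abbrev rY : ℕ := 23
/-- The number of moves in the buffer. -/
@[simp] abbrev rCnt : ℕ := 24
/-- The robot on top of the stack. -/
@[simp] abbrev rCur : ℕ := 27

/-- Entry `(r, 0)`: the number of edges that `r` has traversed. -/
@[simp] abbrev aPos : ℕ := 6
/-- Entry `(r, 0)`: the height of `r` in the stack, or zero. -/
@[simp] abbrev aInst : ℕ := 7
/-- Entry `(r, 0)`: the number of edges from the source of `r` to the robot that blocks it. -/
@[simp] abbrev aSeg : ℕ := 8
/-- Entry `(j, 0)`: the robot at height `j` in the stack. -/
@[simp] abbrev aStk : ℕ := 9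
/-- Row `i`: the robot that makes the `i`-th move, and where it stops. -/
@[simp] abbrev aBuf : ℕ := 11

/-- The number zero. -/
abbrev c0 : Expr := .const 0

/-- Move the robot `rX` until it has traversed `rY` edges. -/
def moveRobot : Program := block [
  .write aBuf (.reg rCnt) c0 (.reg rX),
  .write aBuf (.reg rCnt) (.const 1) (.reg rY),
  .write aPos (.reg rX) c0 (.reg rY),
  .write aInst (.reg rX) c0 c0,
  .assign rCnt (.addConst (.reg rCnt) 1)]

/-- One step of a scan. -/
def scanStep : Program := block [
  .assign rO (ld aOth (.reg rCur) (.reg rK)),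
  .ite (.eq (.reg rO) c0) (.assign rMode (.const 1))
    (block [
      .assign rO (.addConst (.reg rO) (-1)),
      .assign rZ (ld aIx (.reg rO) (.reg rCur)),
      .ite (.and (.le (.const 1) (.reg rZ)) (.le (.reg rZ) (ld aPos (.reg rO) c0)))
        (.assign rMode (.const 1))
        (.ite (.eq (.reg rZ) (.addConst (ld aPos (.reg rO) c0) 1))
          (.assign rMode (.const 2))
          (.assign rK (.addConst (.reg rK) 1)))])]

/-- Find the first vertex on the path of the robot on top of the stack at which that robot may stay
(mode `1`) or which is occupied (mode `2`). -/
def scan : Program := block [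
  .assign rCur (ld aStk (.reg rD) c0),
  .assign rK (.const 1),
  .assign rMode c0,
  .while (.eq (.reg rMode) c0) scanStep]

/-- The states `s` and `s'` differ only in the registers in `X` and the arrays in `Y`. -/
structure Same (X Y : List ℕ) (s s' : State) : Prop where
  reg : ∀ x, x ∉ X → s'.reg x = s.reg x
  arr : ∀ A, A ∉ Y → s'.arr A = s.arr A
  out : s'.out = s.out

namespace Same

variable {X Y : List ℕ} {s s' s'' : State}

theorem refl (s : State) : Same X Y s s := ⟨fun _ _ => rfl, fun _ _ => rfl, rfl⟩

theorem trans (h : Same X Y s s') (h' : Same X Y s' s'') : Same X Y s s'' :=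
  ⟨fun x hx => (h'.reg x hx).trans (h.reg x hx), fun A hA => (h'.arr A hA).trans (h.arr A hA),
    h'.out.trans h.out⟩

theorem mono {X' Y' : List ℕ} (h : Same X Y s s') (hX : X ⊆ X' := by decide)
    (hY : Y ⊆ Y' := by decide) : Same X' Y' s s' :=
  ⟨fun x hx => h.reg x fun h => hx (hX h), fun A hA => h.arr A fun h => hA (hY h), h.out⟩

theorem setReg (h : Same X Y s s') {x : ℕ} {z : ℤ} (hx : x ∈ X := by decide) :
    Same X Y s (s'.setReg x z) :=
  ⟨fun y hy => by
    have : y ≠ x := fun h => hy (h ▸ hx)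
    simp [this, h.reg y hy], h.arr, h.out⟩

theorem setArr (h : Same X Y s s') {A : ℕ} {i j z : ℤ} (hA : A ∈ Y := by decide) :
    Same X Y s (s'.setArr A i j z) :=
  ⟨h.reg, fun B hB => by
    have : B ≠ A := fun h => hB (h ▸ hA)
    simp [this, h.arr B hB], h.out⟩

end Same

namespace MRMPGP

variable {a b n : ℕ}

/-- The state `s` represents the configuration `c`, which is reached from the start by the moves
`ms`; in these moves robots are moved to certain numbers of edges. -/
structure Pool (M : MRMPGP (gridGraph a b) n) (c : Config n) (ms : List (Fin n × ℕ)) (s : State) :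
    Prop where
  known : Known M s
  fail : s.reg 5 = 0
  tables : M.Tables (fun r k => k ≤ M.run r) (fun r k => k ≤ M.run r) (s.arr 3) (s.arr 4) (s.arr 5)
  pos : ∀ r : Fin n, s.arr 6 r 0 = c r
  cnt : s.reg 24 = ms.length
  buf : ∀ (i : ℕ) (h : i < ms.length), s.arr 11 i 0 = (ms[i].1 : ℕ) ∧ s.arr 11 i 1 = ms[i].2
  le_run : ∀ r, c r ≤ M.run r
  ms_le : ∀ m ∈ ms, m.2 ≤ M.run m.1
  reach : M.CReach start (ms.map fun m => (m.1, M.vert m.1 m.2)) c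

variable {M : MRMPGP (gridGraph a b) n} {c : Config n} {ms : List (Fin n × ℕ)} {s s' : State}

theorem Known.same {X Y : List ℕ} (h : Known M s) (hs : Same X Y s s')
    (hX : 0 ∉ X := by decide) (hY : 0 ∉ Y ∧ 1 ∉ Y := by decide) : Known M s' :=
  ⟨(hs.reg 0 hX).trans h.reg_n, (hs.arr 0 hY.1).trans h.input, by rw [hs.arr 1 hY.2]; exact h.row,
    hs.out.trans h.out⟩

theorem Pool.same {X Y : List ℕ} (h : M.Pool c ms s) (hs : Same X Y s s')
    (hX : 0 ∉ X ∧ 5 ∉ X ∧ 24 ∉ X := by decide)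
    (hY : 0 ∉ Y ∧ 1 ∉ Y ∧ 3 ∉ Y ∧ 4 ∉ Y ∧ 5 ∉ Y ∧ 6 ∉ Y ∧ 11 ∉ Y := by decide) :
    M.Pool c ms s' := by
  obtain ⟨x0, x5, x24⟩ := hX
  obtain ⟨y0, y1, y3, y4, y5, y6, y11⟩ := hY
  constructor
  · exact h.known.same hs x0 ⟨y0, y1⟩
  · rw [hs.reg _ x5]; exact h.fail
  · rw [hs.arr _ y3, hs.arr _ y4, hs.arr _ y5]; exact h.tables
  · rw [hs.arr _ y6]; exact h.pos
  · rw [hs.reg _ x24]; exact h.cnt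
  · rw [hs.arr _ y11]; exact h.buf
  · exact h.le_run
  · exact h.ms_le
  · exact h.reach

theorem tot_moveRobot (h : M.Pool c ms s) {r : Fin n} {k : ℕ} (hk : k ≤ M.run r)
    (h22 : s.reg 22 = r) (h23 : s.reg 23 = k)
    (hr : M.CReach start (ms.map (fun m => (m.1, M.vert m.1 m.2)) ++ [(r, M.vert r k)])
      (Function.update c r k)) :
    Tot moveRobot s fun s' T => T ≤ 6 ∧ M.Pool (Function.update c r k) (ms ++ [(r, k)]) s' ∧
      Same [24] [6, 7, 11] s s' ∧ s'.arr 7 = upd (s.arr 7) r 0 0 := by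
  have h24 := h.cnt
  simp only [moveRobot, tot_block_cons, tot_block_nil, tot_assign, tot_write, Expr.eval, aBuf, rCnt,
    rX, rY, aPos, aInst, State.setReg_reg, State.setReg_arr, State.setArr_reg,
    State.setArr_arr, Nat.reduceEqDiff, if_true, if_false, h22, h23, h24]
  have hs : Same [24] [6, 7, 11] s (((((s.setArr 11 ms.length 0 r).setArr 11 ms.length 1 k).setArr
    6 r 0 k).setArr 7 r 0 0).setReg 24 (ms.length + 1)) :=
    ((((Same.refl s).setArr).setArr).setArr).setArr.setReg
  refine ⟨by norm_num, ?_, hs, trivial⟩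
  constructor
  · exact h.known.same hs
  · rw [hs.reg 5 (by decide)]; exact h.fail
  · rw [hs.arr 3 (by decide), hs.arr 4 (by decide), hs.arr 5 (by decide)]; exact h.tables
  · intro p
    simp only [State.setReg_arr, State.setArr_arr, Nat.reduceEqDiff, if_true, if_false, upd_apply,
      and_true, Function.update_apply, Nat.cast_inj, Fin.val_inj, h.pos p, Nat.cast_ite]
  · simp
  · intro i hi
    simp only [List.length_append, List.length_singleton] at hi
    simp only [State.setReg_arr, State.setArr_arr, Nat.reduceEqDiff, if_true, if_false, upd_apply,
      Nat.cast_inj, List.getElem_append]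
    by_cases h1 : i < ms.length
    · obtain ⟨h2, h3⟩ := h.buf i h1
      have h4 : i ≠ ms.length := by omega
      simp [h4, h1, h2, h3]
    · have h4 : i = ms.length := by omega
      simp [h4]
  · intro p
    rw [Function.update_apply]
    split_ifs with h1
    · rw [h1]; exact hk
    · exact h.le_run p
  · intro m hm
    rcases List.mem_append.1 hm with hm | hm
    · exact h.ms_le m hm
    · rw [List.mem_singleton.1 hm]; exact hk
  · simpa using hr

/-! ### Scanning -/

/-- What the tables say about a vertex of the path of `r` that is also on another path. -/
theorem Tables.lookup (X : M.Crossing) {MV OT IX : ℤ → ℤ → ℤ}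
    (h : M.Tables (fun r k => k ≤ M.run r) (fun r k => k ≤ M.run r) MV OT IX)
    {r : Fin n} {k : ℕ} (hk : k < M.run r) :
    ∃ o : Fin n, o ≠ r ∧ M.On o (M.vert r k) ∧ OT r k = (o : ℕ) + 1 ∧
      (∀ w, w ≠ r → M.On w (M.vert r k) → w = o) ∧
      (IX o r ≠ 0 → ∃ l : ℕ, l < M.run o ∧ IX o r = (l : ℤ) + 1 ∧ M.vert o l = M.vert r k) ∧
      ∀ l : ℕ, l ≤ M.run o → M.vert o l = M.vert r k → IX o r = (l : ℤ) + 1 := by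
  obtain ⟨o, ho, hov⟩ := exists_other hk
  refine ⟨o, ho, hov, (h.oth r k hk.le).1 o ho hov, fun w hw hwv => ?_, fun h0 => ?_,
    fun l hl hlv => ?_⟩
  · rcases X.two (M.on_vert r k) hov hwv ho.symm with h1 | h1
    · exact absurd h1.symm hw
    · exact h1.symm
  · obtain ⟨h1, l, h2, h3, h4⟩ := h.ix_only o r h0
    exact ⟨l, h2, h4, X.one ho (M.on_vert o l) h3 hov (M.on_vert r k)⟩
  · exact h.ix o l r hl ho.symm (hlv ▸ M.on_vert r k)

/-- A robot whose source is on another path has a positive run. -/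
theorem run_pos_of_vert_eq (X : M.Crossing) {r o : Fin n} {k : ℕ} (ho : o ≠ r)
    (h : M.vert r k = M.src o) : 0 < M.run o := by
  rw [Nat.pos_iff_ne_zero]
  intro h0
  have h1 := X.clear_run o
  rw [h0] at h1
  refine h1 r ho.symm ?_
  rw [M.vert_zero, ← h]
  exact M.on_vert r k

/-- The result of a scan for the robot `r`: either `r` may move to its `k`-th vertex (mode `1`), or
it is blocked there by the robot number `z`, which is at its source (mode `2`). -/
structure Scanned (M : MRMPGP (gridGraph a b) n) (c : Config n) (ms : List (Fin n × ℕ)) (r : Fin n)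
    (k : ℕ) (md z : ℤ) : Prop where
  pos : 0 < k
  le : k ≤ M.run r
  mode : md = 1 ∨ md = 2
  move : md = 1 →
    M.CReach start (ms.map (fun m => (m.1, M.vert m.1 m.2)) ++ [(r, M.vert r k)])
      (Function.update c r k) ∧ M.Clean (Function.update c r k)
  blocked : md = 2 → ∃ o : Fin n, z = (o : ℕ) ∧ c o = 0 ∧ 0 < M.run o ∧ M.Link c r o k

theorem tot_scanStep (X : M.Crossing) (h : M.Pool c ms s) (hc : M.Clean c) {r : Fin n} {k : ℕ}
    (h0 : c r = 0) (h27 : s.reg 27 = r) (h7 : s.reg 7 = k) (h13 : s.reg 13 = 0) (hk : 0 < k)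
    (hkr : k ≤ M.run r)
    (hfree : ∀ l, 0 < l → l < k → ∀ w, w ≠ r → M.loc c w ≠ M.vert r l) :
    Tot scanStep s fun s' T => T ≤ 9 ∧ Same [7, 8, 13, 14] [] s s' ∧
      (s'.reg 7 = (k + 1 : ℕ) ∧ s'.reg 13 = 0 ∧ k + 1 ≤ M.run r ∧
        (∀ l, 0 < l → l < k + 1 → ∀ w, w ≠ r → M.loc c w ≠ M.vert r l) ∨
      s'.reg 7 = k ∧ M.Scanned c ms r k (s'.reg 13) (s'.reg 8)) := by
  have hlen : ∀ w, M.run w ≤ M.len w := X.run_le_len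
  have hcl : ∀ w, c w ≤ M.len w := fun w => (h.le_run w).trans (hlen w)
  have hmove : (∀ w, w ≠ r → ∀ l, c w ≤ l → l ≤ M.len w → M.vert w l ≠ M.vert r k) →
      ∀ z, M.Scanned c ms r k 1 z := fun hend z =>
    ⟨hk, hkr, .inl rfl, fun _ => h.reach.advance_clean hc (hkr.trans (hlen r)) (by omega)
      (fun l hl hl' => hfree l (by omega) hl') hcl hend, fun h => absurd h (by norm_num)⟩
  have hS : Same [7, 8, 13, 14] [] s s := Same.refl s
  simp only [scanStep, tot_block_cons, tot_block_nil, tot_ite, tot_assign, Expr.eval, Test.holds,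
    rO, aOth, rCur, rK, rMode, rZ, aIx, aPos, State.setReg_reg, State.setReg_arr, Nat.reduceEqDiff,
    if_true, if_false, h27, h7]
  by_cases hz : s.arr 4 r k = 0
  · refine ⟨fun _ => ⟨by norm_num, hS.setReg.setReg, .inr ⟨trivial, ?_⟩⟩, fun h => absurd hz h⟩
    obtain rfl : k = M.run r := le_antisymm hkr ((h.tables.oth r k hkr).run_le hz)
    exact hmove (fun w hw l _ _ h1 => X.clear_run r w hw (h1 ▸ M.on_vert w l)) _
  · have hkr' : k < M.run r := by
      refine hkr.lt_of_ne fun h1 => hz ?_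
      refine (h.tables.oth r k hkr).2 ?_
      rw [h1]; exact X.clear_run r
    obtain ⟨o, ho, hov, h1, h2, h3, h4⟩ := h.tables.lookup X hkr'
    have e1 : s.arr 4 r k + -1 = (o : ℕ) := by omega
    have e2 := h.pos o
    simp only [e1, e2]
    refine ⟨fun h => absurd h hz, fun _ => ⟨fun h5 => ?_, fun h5 => ⟨fun h6 => ?_, fun h6 => ?_⟩⟩⟩
    -- the other robot has passed the vertex
    · refine ⟨by norm_num, hS.setReg.setReg.setReg.setReg, .inr ⟨trivial, hmove ?_ _⟩⟩
      intro w hw l hl hll hv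
      obtain rfl := h2 w hw (hv ▸ M.on_vert w l)
      obtain ⟨l', h7, h8, h9⟩ := h3 (by omega)
      have := M.vert_inj hll (h7.le.trans (hlen w)) (hv.trans h9.symm)
      omega
    -- the other robot is at the vertex, hence at its source, as the configuration is clean
    · refine ⟨by norm_num, hS.setReg.setReg.setReg.setReg, .inr ⟨trivial, hk, hkr, .inr rfl,
        fun h => absurd h (by norm_num), fun _ => ⟨o, rfl, ?_⟩⟩⟩
      obtain ⟨l', h7, h8, h9⟩ := h3 (by omega)
      obtain rfl : l' = c o := by omega
      have hco : c o = 0 := by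
        by_contra h10
        exact hc o (Nat.pos_of_ne_zero h10) r ho.symm k (by omega) (hkr.trans (hlen r)) h9.symm
      rw [hco, M.vert_zero] at h9
      refine ⟨hco, run_pos_of_vert_eq X ho h9.symm, hk, hkr', h9.symm, ho, fun l hl hlk w hw => ?_⟩
      by_cases hwr : w = r
      · intro hv
        subst hwr
        have := M.vert_inj (Nat.zero_le _) ((hlk.trans hkr').le.trans (hlen w))
          ((M.vert_zero w).trans hv)
        omega
      · have := hfree l hl hlk w hwr
        rwa [M.loc_eq, hw, M.vert_zero] at this
    -- the other robot still has to pass the vertex, but is not there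
    · refine ⟨by norm_num, hS.setReg.setReg.setReg.setReg, .inl ⟨by push_cast; rfl, h13, hkr', ?_⟩⟩
      intro l hl hlk w hw hv
      rcases Nat.lt_succ_iff_lt_or_eq.1 hlk with hlk | rfl
      · exact hfree l hl hlk w hw hv
      · have hcw : c w = 0 := by
          by_contra h10
          rw [M.loc_eq] at hv
          exact hc w (Nat.pos_of_ne_zero h10) r hw.symm l (by omega) (hkr.trans (hlen r)) hv.symm
        rw [M.loc_eq, hcw] at hv
        obtain rfl := h2 w hw (hv ▸ M.on_vert w 0)
        have := h4 0 (Nat.zero_le _) hv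
        omega

theorem tot_scan (X : M.Crossing) (h : M.Pool c ms s) (hc : M.Clean c) {r : Fin n} {d : ℕ}
    (h12 : s.reg 12 = d) (h9 : s.arr 9 d 0 = r) (h0 : c r = 0) (hr : 0 < M.run r) :
    Tot scan s fun s' T => T ≤ 10 * n + 14 ∧ Same [7, 8, 13, 14, 27] [] s s' ∧ s'.reg 27 = r ∧
      ∃ k : ℕ, s'.reg 7 = k ∧ M.Scanned c ms r k (s'.reg 13) (s'.reg 8) := by
  have hrun := X.run_le r
  have hloop := fun m s₁ => Tot.while (m := m) (s := s₁) (t := .eq (.reg rMode) c0) (p := scanStep)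
    (fun m s' => Same [7, 8, 13, 14, 27] [] s s' ∧ s'.reg 27 = r ∧ ∃ k : ℕ, s'.reg 7 = k ∧
      (s'.reg 13 = 0 ∧ 0 < k ∧ k ≤ M.run r ∧
        (∀ l, 0 < l → l < k → ∀ w, w ≠ r → M.loc c w ≠ M.vert r l) ∧
        m + 10 * k = 10 * M.run r + 10 ∨
       M.Scanned c ms r k (s'.reg 13) (s'.reg 8))) (by
    rintro m s' ⟨h1, h2, k, h3, h4⟩ ht
    simp only [Test.holds, Expr.eval, rMode] at ht
    rcases h4 with ⟨h4, h5, h6, h7, h8⟩ | h4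
    · refine (tot_scanStep X (h.same h1) hc h0 h2 h3 h4 h5 h6 h7).mono ?_
      rintro s'' T ⟨g1, g2, g3⟩
      have g4 := h1.trans g2.mono
      have g5 := (g2.reg 27 (by decide)).trans h2
      rcases g3 with ⟨g6, g7, g8, g9⟩ | ⟨g6, g7⟩
      · exact ⟨m - 10, ⟨g4, g5, k + 1, g6, .inl ⟨g7, by omega, g8, g9, by omega⟩⟩, by omega⟩
      · exact ⟨0, ⟨g4, g5, k, g6, .inr g7⟩, by omega⟩
    · have := h4.mode
      omega)
  simp only [scan, tot_block_cons, tot_block_nil, tot_assign, Expr.eval, rCur, rK, rMode, rD, aStk,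
    State.setReg_reg, State.setReg_arr, Nat.reduceEqDiff, if_true, if_false, h12, h9]
  refine (hloop (10 * M.run r) _ ⟨((Same.refl s).setReg).setReg.setReg, by simp, 1, by simp,
    .inl ⟨by simp, by norm_num, hr, fun l h1 h2 => by omega, by omega⟩⟩).mono ?_
  rintro s' T ⟨g1, m, ⟨g2, g3, k, g4, g5⟩, g6⟩
  simp only [Test.holds, Expr.eval, rMode] at g1
  rcases g5 with ⟨g5, -⟩ | g5
  · exact absurd g5 g1
  · exact ⟨by omega, g2, g3, k, g4, g5⟩

end MRMPGP

/-! ### Searching for a chord of a cycle -/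

/-- The least height of a robot of the cycle. -/
@[simp] abbrev rBase : ℕ := 15
/-- A height in the robot stack. -/
@[simp] abbrev rJ : ℕ := 16
/-- The number of entries in the stack of visits. -/
@[simp] abbrev rH : ℕ := 17
/-- The result of the traversal of a cycle. -/
@[simp] abbrev rRes : ℕ := 18
/-- The height of the first robot of the chord. -/
@[simp] abbrev rA : ℕ := 19

/-- The stack of visits; row `x` holds the height of the robot, and its number of edges. -/
@[simp] abbrev aVis : ℕ := 10

/-- One step of the traversal of a cycle. -/
def traverseStep : Program := block [
  .assign rCur (ld aStk (.reg rJ) c0),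
  .ite (.and (.eq (.reg rK) (ld aSeg (.reg rCur) c0)) (.le (.addConst (.reg rJ) 1) (.reg rD)))
    (block [.assign rJ (.addConst (.reg rJ) 1), .assign rK (.const 1)])
    (block [
      .assign rO (.addConst (ld aOth (.reg rCur) (.reg rK)) (-1)),
      .assign rZ (ld aIx (.reg rO) (.reg rCur)),
      .assign rA (ld aInst (.reg rO) c0),
      .ite (.and (.and (.le (.reg rBase) (.reg rA)) (.le (.addConst (.reg rA) 1) (.reg rJ)))
          (.and (.le (.const 1) (.reg rZ)) (.le (.reg rZ) (ld aSeg (.reg rO) c0))))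
        (.ite (.and (.eq (ld aVis (.reg rH) c0) (.reg rA))
            (.eq (.addConst (ld aVis (.reg rH) (.const 1)) 1) (.reg rZ)))
          (.ite (.le (.reg rH) (.const 1)) (.assign rRes (.const 2))
            (block [.assign rH (.addConst (.reg rH) (-1)), .assign rK (.addConst (.reg rK) 1)]))
          (.assign rRes (.const 1)))
        (block [
          .assign rH (.addConst (.reg rH) 1),
          .write aVis (.reg rH) c0 (.reg rJ),
          .write aVis (.reg rH) (.const 1) (.reg rK),
          .assign rK (.addConst (.reg rK) 1)])])]

/-- Traverse the cycle of the robots at the heights `rBase, …, rD`. The result `2` means that there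
is no solution, and the result `1` that a chord has been found. -/
def traverse : Program := block [
  .assign rJ (.reg rBase),
  .assign rK c0,
  .assign rH c0,
  .assign rRes c0,
  .while (.eq (.reg rRes) c0) traverseStep]

namespace MRMPGP

variable {a b n : ℕ}

/-- The robot stack in the state `s` holds the robots `ρ 1, …, ρ top`, of which the last ones, from
height `base` on, form a cycle. -/
structure CycleData (M : MRMPGP (gridGraph a b) n) (c : Config n) (ρ : ℕ → Fin n) (seg : Fin n → ℕ)
    (base top : ℕ) (s : State) : Prop where
  cycle : M.Cycle c ρ seg base top
  base_pos : 1 ≤ base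
  reg_base : s.reg 15 = base
  reg_top : s.reg 12 = top
  stk : ∀ j : ℕ, 1 ≤ j → j ≤ top → s.arr 9 j 0 = (ρ j : ℕ)
  inst : ∀ j : ℕ, 1 ≤ j → j ≤ top → s.arr 7 (ρ j : ℕ) 0 = j
  inst_out : ∀ r : Fin n, (∀ j : ℕ, 1 ≤ j → j ≤ top → ρ j ≠ r) → s.arr 7 r 0 = 0
  segs : ∀ j : ℕ, 1 ≤ j → j ≤ top → s.arr 8 (ρ j : ℕ) 0 = seg (ρ j)

variable {M : MRMPGP (gridGraph a b) n} {c : Config n} {ms : List (Fin n × ℕ)} {s s' : State}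
  {ρ : ℕ → Fin n} {seg : Fin n → ℕ} {base top : ℕ}

theorem CycleData.same {X Y : List ℕ} (h : CycleData M c ρ seg base top s) (hs : Same X Y s s')
    (hX : 12 ∉ X ∧ 15 ∉ X := by decide) (hY : 7 ∉ Y ∧ 8 ∉ Y ∧ 9 ∉ Y := by decide) :
    CycleData M c ρ seg base top s' := by
  obtain ⟨x1, x2⟩ := hX
  obtain ⟨y1, y2, y3⟩ := hY
  refine ⟨h.cycle, h.base_pos, ?_, ?_, ?_, ?_, ?_, ?_⟩
  · rw [hs.reg _ x2]; exact h.reg_base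
  · rw [hs.reg _ x1]; exact h.reg_top
  · rw [hs.arr _ y3]; exact h.stk
  · rw [hs.arr _ y1]; exact h.inst
  · rw [hs.arr _ y1]; exact h.inst_out
  · rw [hs.arr _ y2]; exact h.segs

/-- The test in the traversal detects visits of vertices that have been visited before. The other
robot `o` on the vertex must have a smaller height, within the cycle, and meet the path of the
current robot before the source of its successor. -/
theorem CycleData.closing (X : M.Crossing) (D : CycleData M c ρ seg base top s)
    (hP : M.Pool c ms s) {j k : ℕ} (ho : Occ ρ seg base top j k) :
    ∃ o : Fin n, s.arr 4 (ρ j : ℕ) k = (o : ℕ) + 1 ∧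
      ((((base : ℤ) ≤ s.arr 7 o 0 ∧ s.arr 7 o 0 + 1 ≤ j) ∧
          1 ≤ s.arr 5 o (ρ j : ℕ) ∧ s.arr 5 o (ρ j : ℕ) ≤ s.arr 8 o 0) →
        ∃ i l : ℕ, s.arr 7 o 0 = i ∧ s.arr 5 o (ρ j : ℕ) = (l : ℤ) + 1 ∧
          Occ ρ seg base top i l ∧ i < j ∧ M.vert (ρ i) l = M.vert (ρ j) k) ∧
      (¬ (((base : ℤ) ≤ s.arr 7 o 0 ∧ s.arr 7 o 0 + 1 ≤ j) ∧
          1 ≤ s.arr 5 o (ρ j : ℕ) ∧ s.arr 5 o (ρ j : ℕ) ≤ s.arr 8 o 0) →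
        ∀ i l, Occ ρ seg base top i l → Bef i l j k → M.vert (ρ i) l ≠ M.vert (ρ j) k) := by
  have C := D.cycle
  have hb := D.base_pos
  have hlj := C.link j ho.1 ho.2.1
  have hk : k < M.run (ρ j) := ho.2.2.1.trans_lt hlj.lt_run
  obtain ⟨o, h1, h2, h3, h4, h5, h6⟩ := hP.tables.lookup X hk
  refine ⟨o, h3, ?_, ?_⟩
  · rintro ⟨⟨g1, g2⟩, g3, g4⟩
    obtain ⟨i, e1, e2, e3⟩ : ∃ i : ℕ, 1 ≤ i ∧ i ≤ top ∧ ρ i = o := by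
      by_contra hcon
      have := D.inst_out o fun i e1 e2 e3 => hcon ⟨i, e1, e2, e3⟩
      omega
    subst e3
    have e4 := D.inst i e1 e2
    have e5 := D.segs i e1 e2
    obtain ⟨l, f1, f2, f3⟩ := h5 (by omega)
    refine ⟨i, l, e4, f2, ⟨by omega, e2, by omega, by omega, ?_⟩, by omega, f3⟩
    rintro rfl
    -- the source of a robot of the cycle is visited by the previous robot only
    rw [M.vert_zero] at f3
    have g5 := C.zero i (by omega) e2
    rcases Nat.eq_zero_or_pos k with hk0 | hk0
    · have := ho.2.2.2.2 hk0
      omega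
    · rcases ho.2.2.1.lt_or_eq with hks | hks
      · exact absurd f3 (hlj.free k hk0 hks _ g5)
      · have := ho.2.2.2.1 hks
        subst this
        rw [hks, hlj.eq, C.wrap] at f3
        exact C.inj _ _ (by omega) e2 le_rfl C.le (X.inj f3)
  · intro g1 i l hi hbef hv
    have hne : i = j → l ≠ k := by rcases hbef with h | h <;> omega
    have hr := C.occ_ne X hi ho hne hv
    have hij : i < j := by
      rcases hbef with h | ⟨h, -⟩
      · exact h
      · exact absurd (by rw [h]) hr
    obtain rfl := h4 (ρ i) hr (hv ▸ M.on_vert (ρ i) l)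
    have := hi.1
    have := hi.2.1
    have e4 := D.inst i (by omega) (by omega)
    have e5 := D.segs i (by omega) (by omega)
    have e6 := h6 l (hi.2.2.1.trans (C.link i hi.1 hi.2.1).lt_run.le) hv
    have e7 : l < seg (ρ i) := hi.2.2.1.lt_of_ne fun h => by
      have := hi.2.2.2.1 h
      have := ho.2.1
      omega
    exact g1 ⟨⟨by omega, by omega⟩, by omega, by omega⟩

/-- The invariant of the traversal. -/
structure TravInv (M : MRMPGP (gridGraph a b) n) (ρ : ℕ → Fin n) (seg : Fin n → ℕ)
    (base top : ℕ) (h j k : ℕ) (s : State) : Prop where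
  reg_j : s.reg 16 = j
  reg_k : s.reg 7 = k
  reg_h : s.reg 17 = h
  reg_res : s.reg 18 = 0
  trav : ∃ Hj Hk : ℕ → ℕ, M.Traversal ρ seg base top h Hj Hk j k ∧
    ∀ x : ℕ, 1 ≤ x → x ≤ h → s.arr 10 x 0 = Hj x ∧ s.arr 10 x 1 = Hk x

/-- The result of the traversal: there is no solution, or a chord has been found. -/
def Traversed (M : MRMPGP (gridGraph a b) n) (ρ : ℕ → Fin n) (seg : Fin n → ℕ)
    (base top : ℕ) (s : State) : Prop :=
  (s.reg 18 = 2 ∧ ¬ ∃ plan, M.IsSolution plan) ∨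
  s.reg 18 = 1 ∧ ∃ p kp q kq z kz : ℕ, M.Chord ρ seg base top p kp q kq z kz ∧
    s.reg 19 = p ∧ s.arr 10 (s.reg 17) 0 = q ∧ s.arr 10 (s.reg 17) 1 = kq ∧ s.reg 16 = z ∧
    s.reg 7 = kz

theorem tot_traverseStep (X : M.Crossing) (hP : M.Pool c ms s)
    (D : CycleData M c ρ seg base top s) {h j k : ℕ} (I : TravInv M ρ seg base top h j k s) :
    Tot traverseStep s fun s' T => T ≤ 14 ∧ Same [7, 8, 14, 16, 17, 18, 19, 27] [10] s s' ∧
      ((∃ h', k = seg (ρ j) ∧ j < top ∧ TravInv M ρ seg base top h' (j + 1) 1 s') ∨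
        (∃ h', TravInv M ρ seg base top h' j (k + 1) s') ∨ Traversed M ρ seg base top s') := by
  obtain ⟨h16, h7, h17, h18, Hj, Hk, T, hH⟩ := I
  have C := D.cycle
  have hb := D.base_pos
  have hbj := T.base_le
  have hjt := T.le_top
  have e1 := D.stk j (by omega) hjt
  have e2 := D.segs j (by omega) hjt
  have e3 := D.reg_top
  have e4 := D.reg_base
  have hS : Same [7, 8, 14, 16, 17, 18, 19, 27] [10] s s := Same.refl s
  simp only [traverseStep, tot_block_cons, tot_block_nil, tot_ite, tot_assign, tot_write, Expr.eval,
    Test.holds, rO, aOth, rCur, rK, rJ, rH, rRes, rA, rD, rZ, rBase, aIx, aInst, aSeg, aStk, aVis,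
    State.setReg_reg, State.setReg_arr, State.setArr_reg, State.setArr_arr, Nat.reduceEqDiff,
    if_true, if_false, h16, h7, h17, h18, e1, e2, e3, e4]
  refine ⟨fun g1 => ?_, fun g1 => ?_⟩
  · have g2 : k = seg (ρ j) := by omega
    have g3 : j < top := by omega
    exact ⟨by norm_num, hS.setReg.setReg.setReg, .inl ⟨h, g2, g3, by simp, by simp,
      by simpa using h17, by simpa using h18, Hj, Hk, T.skip X C g2 g3, hH⟩⟩
  have ho : Occ ρ seg base top j k := ⟨hbj, hjt, T.le_seg, fun g2 => by omega, T.zero⟩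
  obtain ⟨o, f1, f2, f3⟩ := D.closing X hP ho
  have e5 : s.arr 4 (ρ j : ℕ) k + -1 = (o : ℕ) := by omega
  simp only [e5]
  refine ⟨fun g2 => ?_, fun g2 => ?_⟩
  · obtain ⟨i, l, f4, f5, f6, f7, f8⟩ := f2 g2
    have hh : 1 ≤ h := by
      rw [Nat.one_le_iff_ne_zero]
      intro h0
      have := (T.empty h0).1
      have := f6.1
      omega
    obtain ⟨f9, f10⟩ := hH h hh le_rfl
    refine ⟨fun g3 => ?_, fun g3 => ?_⟩
    · have f11 : Hj h = i := by omega
      have f12 : Hk h = l := by omega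
      have hv : M.vert (ρ (Hj h)) (Hk h) = M.vert (ρ j) k := by rw [f11, f12, f8]
      refine ⟨fun g4 => ?_, fun g4 => ?_⟩
      · exact ⟨by norm_num, hS.setReg.setReg.setReg.setReg.setReg, .inr (.inr (.inl ⟨by simp,
          T.no_solution X C ho (by omega) hv⟩))⟩
      · refine ⟨by norm_num, hS.setReg.setReg.setReg.setReg.setReg.setReg, .inr (.inl ⟨h - 1,
          by simpa using h16, by simp, ?_, by simpa using h18, Hj, Hk,
          T.pop X C ho (by omega) hv, fun x h1 h2 => hH x h1 (by omega)⟩)⟩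
        simp
        omega
    · obtain ⟨h1, h2⟩ := T.chord X C ho f6 (.inl f7) f8 (by omega)
      refine ⟨by norm_num, hS.setReg.setReg.setReg.setReg.setReg, .inr (.inr (.inr ⟨by simp, i, l,
        _, _, _, _, h2, by simpa using f4, ?_, ?_, by simpa using h16, by simpa using h7⟩))⟩
      · simpa [h17] using f9
      · simpa [h17] using f10
  · have hnew := f3 g2
    refine ⟨by norm_num, hS.setReg.setReg.setReg.setReg.setReg.setArr.setArr.setReg,
      .inr (.inl ⟨h + 1, by simpa using h16, by simp, by simp, by simpa using h18, _, _,
        T.push C ho hnew, fun x h1 h2 => ?_⟩)⟩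
    simp only [State.setReg_arr, State.setArr_arr, if_true, upd_apply, Function.update_apply]
    by_cases hx : x = h + 1
    · subst hx
      simp
    · have hx' : (x : ℤ) ≠ h + 1 := by omega
      simpa [hx, hx'] using hH x h1 (by omega)

theorem tot_traverse (X : M.Crossing) (hP : M.Pool c ms s)
    (D : CycleData M c ρ seg base top s) :
    Tot traverse s fun s' T => T ≤ 15 * ((top + 1 - base) * (n + 2)) + 21 ∧
      Same [7, 8, 14, 16, 17, 18, 19, 27] [10] s s' ∧ Traversed M ρ seg base top s' := by
  have C := D.cycle
  have hloop := fun m s₁ => Tot.while (m := m) (s := s₁) (t := .eq (.reg rRes) c0)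
    (p := traverseStep)
    -- for each robot there are at most `n + 2` visits, including the skipped one
    (fun m s' => Same [7, 8, 14, 16, 17, 18, 19, 27] [10] s s' ∧
      ((∃ h j k, TravInv M ρ seg base top h j k s' ∧
        m = 15 * ((top - j) * (n + 2) + (n + 1 - k) + 1)) ∨ Traversed M ρ seg base top s')) (by
    rintro m s' ⟨h1, h2⟩ ht
    simp only [Test.holds, Expr.eval, rRes] at ht
    rcases h2 with ⟨h, j, k, h3, rfl⟩ | h2
    · refine (tot_traverseStep X (hP.same h1) (D.same h1) h3).mono ?_
      rintro s'' T ⟨g1, g2, g3⟩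
      have g4 := h1.trans g2
      obtain ⟨_, _, _, _, _, _, T1, _⟩ := h3
      have hk := T1.le_seg
      have hlr := (C.link j T1.base_le T1.le_top).lt_run
      have hrn := X.run_le (ρ j)
      rcases g3 with ⟨h', g5, g6, g7⟩ | ⟨h', g5⟩ | g5
      · refine ⟨_, ⟨g4, .inl ⟨h', j + 1, 1, g7, rfl⟩⟩, ?_⟩
        obtain ⟨e, rfl⟩ := Nat.exists_eq_add_of_lt g6
        rw [show j + e + 1 - j = e + 1 by omega, show j + e + 1 - (j + 1) = e by omega]
        have e1 : (e + 1) * (n + 2) = e * (n + 2) + (n + 2) := by ring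
        omega
      · exact ⟨_, ⟨g4, .inl ⟨h', j, k + 1, g5, rfl⟩⟩, by omega⟩
      · exact ⟨0, ⟨g4, .inr g5⟩, by omega⟩
    · rcases h2 with h2 | h2 <;> omega)
  have e4 := D.reg_base
  simp only [traverse, tot_block_cons, tot_block_nil, tot_assign, Expr.eval, rBase, rJ, rK, rH,
    rRes, State.setReg_reg, State.setReg_arr, Nat.reduceEqDiff, if_true, if_false, e4]
  refine (hloop (15 * ((top - base) * (n + 2) + (n + 1 - 0) + 1)) _
    ⟨(Same.refl s).setReg.setReg.setReg.setReg, .inl ⟨0, base, 0, ⟨by simp, by simp, by simp,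
    by simp, fun _ => 0, fun _ => 0, C.traversal_init, fun x h1 h2 => by omega⟩, rfl⟩⟩).mono ?_
  rintro s' T ⟨g1, m, ⟨g2, g3⟩, g4⟩
  simp only [Test.holds, Expr.eval, rRes] at g1
  have e5 : top + 1 - base = (top - base) + 1 := by have := C.le; omega
  have e6 : (top - base + 1) * (n + 2) = (top - base) * (n + 2) + (n + 2) := by ring
  rw [e5, e6]
  refine ⟨by omega, g2, ?_⟩
  rcases g3 with ⟨h, j, k, g5, -⟩ | g3
  · exact absurd g5.reg_res g1
  · exact g3

end MRMPGP

/-! ### Resolving a cycle along a chord -/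

/-- The height of the robot in between. -/
@[simp] abbrev rB : ℕ := 20
/-- The height of the robot that is moved next. -/
@[simp] abbrev rI : ℕ := 26

/-- Move the robot at height `rI` to its destination, and pass on to the one below. -/
def rotateStep : Program := block [
  .assign rX (ld aStk (.reg rI) c0),
  .assign rY (ld aSeg (.reg rX) c0),
  moveRobot,
  .assign rI (.addConst (.reg rI) (-1))]

/-- Move the robots at the heights `hi, …, lo` to their destinations. -/
def rotateRange (lo hi : Expr) : Program := block [
  .assign rI hi,
  .while (.le lo (.reg rI)) rotateStep]

/-- Resolve a cycle. -/
def rotate : Program := block [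
  .assign rB (ld aVis (.reg rH) c0),
  .write aSeg (ld aStk (.reg rJ) c0) c0 (.reg rK),
  .assign rX (ld aStk (.reg rB) c0),
  .assign rY (ld aVis (.reg rH) (.const 1)),
  moveRobot,
  rotateRange (.reg rA) (.addConst (.reg rB) (-1)),
  rotateRange (.reg rB) (.reg rJ),
  rotateRange (.reg rBase) (.addConst (.reg rA) (-1)),
  rotateRange (.addConst (.reg rJ) 1) (.reg rD)]

namespace MRMPGP

variable {a b n : ℕ}

/-- The invariant of a rotation: the robots with height in `S` are at their destinations, and `L`
moves have been made. -/
structure RotInv (M : MRMPGP (gridGraph a b) n) (c : Config n) (ρ : ℕ → Fin n) (seg : Fin n → ℕ)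
    (base top q kq z kz : ℕ) (S : ℕ → Prop) (L : ℕ) (s : State) : Prop where
  pool : ∃ e ms, M.Pool e ms s ∧ ms.length = L ∧
    Mid c e ρ (dest ρ seg z kz) base top q kq S
  base_pos : 1 ≤ base
  inj : ∀ i j, 1 ≤ i → i ≤ top → 1 ≤ j → j ≤ top → ρ i = ρ j → i = j
  stk : ∀ j : ℕ, 1 ≤ j → j ≤ top → s.arr 9 j 0 = (ρ j : ℕ)
  segs : ∀ j : ℕ, 1 ≤ j → j ≤ top → s.arr 8 (ρ j : ℕ) 0 = dest ρ seg z kz (ρ j)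
  inst : ∀ j : ℕ, 1 ≤ j → j < base → s.arr 7 (ρ j : ℕ) 0 = j
  inst_out : ∀ r : Fin n, (∀ j : ℕ, 1 ≤ j → j ≤ top → ρ j ≠ r) → s.arr 7 r 0 = 0
  inst_mem : ∀ j, base ≤ j → j ≤ top → S j → s.arr 7 (ρ j : ℕ) 0 = 0

variable {M : MRMPGP (gridGraph a b) n} {c : Config n} {ms : List (Fin n × ℕ)} {s s' : State}
  {ρ : ℕ → Fin n} {seg : Fin n → ℕ} {base top p kp q kq z kz L : ℕ} {S S' : ℕ → Prop}

theorem RotInv.congr (I : RotInv M c ρ seg base top q kq z kz S L s) {L' : ℕ} (hL : L = L')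
    (hS : ∀ i, S i ↔ S' i) : RotInv M c ρ seg base top q kq z kz S' L' s := by
  obtain rfl : S = S' := funext fun i => propext (hS i)
  exact hL ▸ I

theorem RotInv.same {X Y : List ℕ} (I : RotInv M c ρ seg base top q kq z kz S L s)
    (hs : Same X Y s s') (hX : 0 ∉ X ∧ 5 ∉ X ∧ 24 ∉ X := by decide)
    (hY : 0 ∉ Y ∧ 1 ∉ Y ∧ 3 ∉ Y ∧ 4 ∉ Y ∧ 5 ∉ Y ∧ 6 ∉ Y ∧ 11 ∉ Y := by decide)
    (hY' : 7 ∉ Y ∧ 8 ∉ Y ∧ 9 ∉ Y := by decide) :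
    RotInv M c ρ seg base top q kq z kz S L s' := by
  obtain ⟨y1, y2, y3⟩ := hY'
  obtain ⟨⟨e, ms, h1, h2⟩, h3, h4, h5, h6, h7, h8, h9⟩ := I
  refine ⟨⟨e, ms, h1.same hs hX hY, h2⟩, h3, h4, ?_, ?_, ?_, ?_, ?_⟩
  · rw [hs.arr _ y3]; exact h5
  · rw [hs.arr _ y2]; exact h6
  · rw [hs.arr _ y1]; exact h7
  · rw [hs.arr _ y1]; exact h8
  · rw [hs.arr _ y1]; exact h9

theorem tot_rotateStep (X : M.Crossing) (hc : M.Clean c) (C : M.Cycle c ρ seg base top)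
    (H : M.Chord ρ seg base top p kp q kq z kz)
    (I : RotInv M c ρ seg base top q kq z kz S L s) {j : ℕ} (J : StepOK base top p q z S j)
    (h26 : s.reg 26 = j) :
    Tot rotateStep s fun s' T => T ≤ 10 ∧ Same [22, 23, 24, 26] [6, 7, 11] s s' ∧
      s'.reg 26 = j - 1 ∧
      RotInv M c ρ seg base top q kq z kz (fun i => S i ∨ i = j) (L + 1) s' := by
  obtain ⟨⟨e, ms, h1, h2, E⟩, h3, h4, h5, h6, h7, h8, h9⟩ := I
  have hj1 := J.base_le
  have hj2 := J.le_top
  obtain ⟨hr, E'⟩ := C.step X hc H E h1.reach J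
  have hk := (C.dest_le H hj1 hj2).trans (C.link j hj1 hj2).lt_run.le
  have hS : Same [22, 23, 24, 26] [6, 7, 11] s
      ((s.setReg 22 (ρ j : ℕ)).setReg 23 (dest ρ seg z kz (ρ j))) := (Same.refl s).setReg.setReg
  have hS' : Same [22, 23] [] s ((s.setReg 22 (ρ j : ℕ)).setReg 23 (dest ρ seg z kz (ρ j))) :=
    (Same.refl s).setReg.setReg
  simp only [rotateStep, tot_block_cons, tot_block_nil, tot_assign, Expr.eval, rX, rY, rI, aStk,
    aSeg, State.setReg_reg, State.setReg_arr, Nat.reduceEqDiff, if_true, if_false, h26,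
    h5 j (by omega) hj2, h6 j (by omega) hj2]
  refine (tot_moveRobot (h1.same hS') hk (by simp) (by simp) hr).mono ?_
  rintro s' T ⟨g1, g2, g3, g4⟩
  have g5 : Same [22, 23, 24, 26] [6, 7, 11] s s' := hS.trans g3.mono
  have g6 : s'.reg 26 = j := by
    rw [g3.reg 26 (by decide), hS'.reg 26 (by decide), h26]
  refine ⟨by omega, g5.setReg, by simp [g6]; rfl, ?_⟩
  refine RotInv.same (s := s') (X := [26]) (Y := [])
    ⟨⟨_, _, g2, by simp [h2], E'⟩, h3, h4, ?_, ?_, ?_, ?_, ?_⟩ (Same.refl s').setReg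
  · rw [g5.arr 9 (by decide)]; exact h5
  · rw [g5.arr 8 (by decide)]; exact h6
  all_goals
    rw [g4, State.setReg_arr, State.setReg_arr]
    simp only [upd_apply, and_true, Nat.cast_inj, Fin.val_inj]
  · intro i hi1 hi2
    rw [if_neg fun h => ?_]
    · exact h7 i hi1 hi2
    · have := h4 i j hi1 (by omega) (by omega) hj2 h
      omega
  · intro r hr
    rw [if_neg fun h => hr j (by omega) hj2 h.symm]
    exact h8 r hr
  · intro i hi1 hi2 hi3
    split_ifs with h
    · rfl
    · exact h9 i hi1 hi2 (hi3.resolve_right fun h' => h (by rw [h']))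

theorem tot_rotateRange (X : M.Crossing) (hc : M.Clean c) (C : M.Cycle c ρ seg base top)
    (H : M.Chord ρ seg base top p kp q kq z kz)
    (I : RotInv M c ρ seg base top q kq z kz S L s) {lo hi : Expr} (l u : ℕ)
    (hl : ∀ s', Same [22, 23, 24, 26] [6, 7, 11] s s' → lo.eval s' = l)
    (hu : hi.eval s + 1 = u)
    (J : ∀ j, l ≤ j → j < u → StepOK base top p q z (fun i => S i ∨ j < i ∧ i < u) j) :
    Tot (rotateRange lo hi) s fun s' T => T ≤ 11 * (u - l) + 3 ∧
      Same [22, 23, 24, 26] [6, 7, 11] s s' ∧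
      RotInv M c ρ seg base top q kq z kz (fun i => S i ∨ l ≤ i ∧ i < u) (L + (u - l)) s' := by
  have hloop := fun m s₁ => Tot.while (m := m) (s := s₁) (t := .le lo (.reg rI)) (p := rotateStep)
    (fun m s' => Same [22, 23, 24, 26] [6, 7, 11] s s' ∧ ∃ v : ℕ, v ≤ u ∧ (l ≤ v ∨ v = u) ∧
      s'.reg 26 + 1 = v ∧ m = 11 * (v - l) ∧
      RotInv M c ρ seg base top q kq z kz (fun i => S i ∨ v ≤ i ∧ i < u) (L + (u - v)) s') (by
    rintro m s' ⟨g1, v, g2, g3, g4, rfl, g5⟩ ht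
    simp only [Test.holds, Expr.eval, rI, hl s' g1] at ht
    obtain ⟨j, rfl⟩ : ∃ j, v = j + 1 := ⟨v - 1, by omega⟩
    have hJ := J j (by omega) (by omega)
    refine (tot_rotateStep X hc C H g5 hJ (by omega)).mono ?_
    rintro s'' T ⟨f1, f2, f3, f4⟩
    refine ⟨_, ⟨g1.trans f2, j, by omega, by omega, by omega, rfl, f4.congr (by omega) ?_⟩,
      by omega⟩
    intro i
    constructor
    · rintro ((h | h) | h)
      · exact .inl h
      · exact .inr (by omega)
      · exact .inr (by omega)
    · rintro (h | h)
      · exact .inl (.inl h)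
      · by_cases hij : i = j
        · exact .inr hij
        · exact .inl (.inr (by omega)))
  simp only [rotateRange, tot_block_cons, tot_block_nil, tot_assign, rI]
  have hS : Same [26] [] s (s.setReg 26 (hi.eval s)) := (Same.refl s).setReg
  refine (hloop (11 * (u - l)) _ ⟨hS.mono, u, le_rfl, .inr rfl, by simpa using hu, rfl,
    (I.same hS).congr (by omega) fun i => ⟨.inl, fun h => h.resolve_right (by omega)⟩⟩).mono ?_
  rintro s' T ⟨g1, m, ⟨g2, v, g3, g4, g5, rfl, g6⟩, g7⟩
  simp only [Test.holds, Expr.eval, rI, hl s' g2] at g1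
  refine ⟨by omega, g2, g6.congr (by omega) fun i => ?_⟩
  have : v ≤ i ∧ i < u ↔ l ≤ i ∧ i < u := by omega
  rw [this]

/-- What a rotation achieves. -/
structure Rotated (M : MRMPGP (gridGraph a b) n) (c : Config n) (L : ℕ) (ρ : ℕ → Fin n)
    (seg : Fin n → ℕ) (base top : ℕ) (e : Config n) (ms : List (Fin n × ℕ)) (s : State) :
    Prop where
  pool : M.Pool e ms s
  clean : M.Clean e
  length : ms.length = L + (top + 1 - base) + 1
  out : ∀ r, (∀ j, base ≤ j → j ≤ top → ρ j ≠ r) → e r = c r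
  pos : ∀ j, base ≤ j → j ≤ top → 0 < e (ρ j)
  stk : ∀ j : ℕ, 1 ≤ j → j < base → s.arr 9 j 0 = (ρ j : ℕ)
  segs : ∀ j : ℕ, 1 ≤ j → j < base → s.arr 8 (ρ j : ℕ) 0 = seg (ρ j)
  inst : ∀ j : ℕ, 1 ≤ j → j < base → s.arr 7 (ρ j : ℕ) 0 = j
  inst_out : ∀ r : Fin n, (∀ j : ℕ, 1 ≤ j → j < base → ρ j ≠ r) → s.arr 7 r 0 = 0

theorem tot_rotate (X : M.Crossing) (hP : M.Pool c ms s) (hc : M.Clean c)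
    (D : CycleData M c ρ seg base top s) (H : M.Chord ρ seg base top p kp q kq z kz)
    (h19 : s.reg 19 = p) (h20 : s.arr 10 (s.reg 17) 0 = q) (h21 : s.arr 10 (s.reg 17) 1 = kq)
    (h16 : s.reg 16 = z) (h7 : s.reg 7 = kz) :
    Tot rotate s fun s' T => T ≤ 11 * (top + 1 - base) + 23 ∧
      Same [20, 22, 23, 24, 26] [6, 7, 8, 11] s s' ∧
      ∃ e ms', Rotated M c ms.length ρ seg base top e ms' s' := by
  have C := D.cycle
  have hb := D.base_pos
  have hinj : ∀ i j, 1 ≤ i → i ≤ top → 1 ≤ j → j ≤ top → ρ i = ρ j → i = j :=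
    fun i j h1 h2 h3 h4 h => by
      have h5 := D.inst i h1 h2
      have h6 := D.inst j h3 h4
      rw [h] at h5
      omega
  have k1 := H.base_le
  have k2 := H.a_lt
  have k3 := H.z_le
  have k4 := H.a_le_b
  have k5 := H.b_le_z
  obtain ⟨hr, E⟩ := C.first X hc H hP.reach
  have hkq : kq ≤ M.run (ρ q) := H.kb_lt.le.trans (C.link q (by omega) (by omega)).lt_run.le
  simp only [rotate, tot_block_cons, tot_block_nil, tot_assign, tot_write, Expr.eval, rX, rY, rB,
    rK, rJ, rH, aVis, aStk, aSeg, State.setReg_reg, State.setReg_arr, State.setArr_reg,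
    State.setArr_arr, Nat.reduceEqDiff, if_true, if_false, h7, h16, h20, h21,
    D.stk z (by omega) k3, D.stk q (by omega) (by omega)]
  have hS : Same [20, 22, 23] [8] s ((((s.setReg 20 q).setArr 8 (ρ z : ℕ) 0 kz).setReg 22
      (ρ q : ℕ)).setReg 23 kq) := (((Same.refl s).setReg).setArr.setReg).setReg
  refine (tot_moveRobot (hP.same hS) hkq (by simp) (by simp) hr).mono ?_
  rintro s1 T1 ⟨g1, g2, g3, g4⟩
  have g5 : Same [20, 22, 23, 24, 26] [6, 7, 8, 11] s s1 := hS.mono.trans g3.mono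
  have I0 : RotInv M c ρ seg base top q kq z kz (fun _ => False) (ms.length + 1) s1 := by
    refine ⟨⟨_, _, g2, by simp, E⟩, hb, hinj, ?_, ?_, ?_, ?_, fun _ _ _ h => h.elim⟩
    · rw [g5.arr 9 (by decide)]; exact D.stk
    · rw [g3.arr 8 (by decide)]
      intro j hj1 hj2
      simp only [State.setReg_arr, State.setArr_arr, if_true, upd_apply, and_true, Nat.cast_inj,
        Fin.val_inj, dest, Function.update_apply]
      split_ifs
      · rfl
      · exact D.segs j hj1 hj2
    all_goals
      rw [g4]
      simp only [State.setReg_arr, State.setArr_arr, Nat.reduceEqDiff, if_false, upd_apply,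
        and_true, Nat.cast_inj, Fin.val_inj]
    · intro j hj1 hj2
      rw [if_neg fun h => ?_]
      · exact D.inst j hj1 (by omega)
      · have := hinj j q hj1 (by omega) (by omega) (by omega) h
        omega
    · intro r hr
      rw [if_neg fun h => hr q (by omega) (by omega) h.symm]
      exact D.inst_out r hr
  have r19 : ∀ {s'}, Same [22, 23, 24, 26] [6, 7, 11] s1 s' → s'.reg 19 = p ∧ s'.reg 16 = z ∧
      s'.reg 15 = base ∧ s'.reg 12 = top ∧ s'.reg 20 = q := fun h => by
    rw [h.reg 19 (by decide), h.reg 16 (by decide), h.reg 15 (by decide), h.reg 12 (by decide),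
      h.reg 20 (by decide), g5.reg 19 (by decide), g5.reg 16 (by decide), g5.reg 15 (by decide),
      g5.reg 12 (by decide), g3.reg 20 (by decide)]
    exact ⟨h19, h16, D.reg_base, D.reg_top, by simp⟩
  refine (tot_rotateRange X hc C H I0 p q (fun s' h => ?_) ?_ ?_).mono ?_
  · exact (r19 h).1
  · simp only [Expr.eval, (r19 (Same.refl s1)).2.2.2.2]; omega
  · intro j hj1 hj2
    constructor <;> (try simp only [false_or]) <;> omega
  rintro s2 T2 ⟨f1, f2, I1⟩
  refine (tot_rotateRange X hc C H I1 q (z + 1) (fun s' h => ?_) ?_ ?_).mono ?_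
  · exact (r19 (f2.trans h)).2.2.2.2
  · simp only [Expr.eval, (r19 f2).2.1]; omega
  · intro j hj1 hj2
    constructor <;> (try simp only [false_or]) <;> omega
  rintro s3 T3 ⟨f3, f4, I2⟩
  replace f4 := f2.trans f4
  refine (tot_rotateRange X hc C H I2 base p (fun s' h => ?_) ?_ ?_).mono ?_
  · exact (r19 (f4.trans h)).2.2.1
  · simp only [Expr.eval, (r19 f4).1]; omega
  · intro j hj1 hj2
    constructor <;> (try simp only [false_or]) <;> omega
  rintro s4 T4 ⟨f5, f6, I3⟩
  replace f6 := f4.trans f6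
  refine (tot_rotateRange X hc C H I3 (z + 1) (top + 1) (fun s' h => ?_) ?_ ?_).mono ?_
  · simp only [Expr.eval, (r19 (f6.trans h)).2.1]; push_cast; rfl
  · simp only [Expr.eval, (r19 f6).2.2.2.1]; push_cast; rfl
  · intro j hj1 hj2
    constructor <;> (try simp only [false_or]) <;> omega
  rintro s5 T5 ⟨f7, f8, I4⟩
  replace f8 := f6.trans f8
  refine ⟨by omega, g5.trans f8.mono, ?_⟩
  obtain ⟨⟨e, ms', h1, h2, E4⟩, h3, h4, h5, h6, h7, h8, h9⟩ := I4
  have hall : ∀ j, base ≤ j → j ≤ top → ((((False ∨ p ≤ j ∧ j < q) ∨ q ≤ j ∧ j < z + 1) ∨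
    base ≤ j ∧ j < p) ∨ z + 1 ≤ j ∧ j < top + 1) := by omega
  refine ⟨e, ms', h1, C.last X hc H E4 hall, by omega, E4.out, ?_, ?_, ?_, h7, ?_⟩
  · intro j hj1 hj2
    rw [E4.mem j hj1 hj2 (hall j hj1 hj2)]
    exact C.dest_pos H hj1 hj2
  · exact fun j hj1 hj2 => h5 j hj1 (by omega)
  · intro j hj1 hj2
    rw [h6 j hj1 (by omega), dest, Function.update_of_ne]
    intro h
    have := hinj j z hj1 (by omega) (by omega) k3 h
    omega
  · intro r hr
    by_cases h : ∃ j, base ≤ j ∧ j ≤ top ∧ ρ j = r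
    · obtain ⟨j, hj1, hj2, rfl⟩ := h
      exact h9 j hj1 hj2 (hall j hj1 hj2)
    · refine h8 r fun j hj1 hj2 hj => ?_
      by_cases hjb : j < base
      · exact hr j hj1 hjb hj
      · exact h ⟨j, by omega, hj2, hj⟩

end MRMPGP

/-! ### Serving a robot -/

/-- Resolve the cycle of the robots at the heights `rBase, …, rD`, or find out that there is no
solution. -/
def resolveCycle : Program := block [
  traverse,
  .ite (.eq (.reg rRes) (.const 2))
    (block [.assign rFail (.const 1), .assign rD c0])
    (block [rotate, .assign rD (.addConst (.reg rBase) (-1))])]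

/-- Serve the robot on top of the stack: it leaves its source, or a robot that blocks it is put on
the stack, or a cycle of blocked robots is resolved. -/
def serveStep : Program := block [
  scan,
  .ite (.eq (.reg rMode) (.const 1))
    (block [
      .assign rX (.reg rCur),
      .assign rY (.reg rK),
      moveRobot,
      .assign rD (.addConst (.reg rD) (-1))])
    (block [
      .write aSeg (.reg rCur) c0 (.reg rK),
      .ite (.eq (ld aInst (.reg rO) c0) c0)
        (block [
          .assign rD (.addConst (.reg rD) 1),
          .write aStk (.reg rD) c0 (.reg rO),
          .write aInst (.reg rO) c0 (.reg rD)])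
        (block [
          .assign rBase (ld aInst (.reg rO) c0),
          resolveCycle])])]

namespace MRMPGP

variable {a b n : ℕ}

/-- The number of robots that are still at their sources. -/
def waiting (c : Config n) : ℕ := (Finset.univ.filter fun r => c r = 0).card

/-- The robots `ρ 1, …, ρ d` are at their sources, and each of them is blocked by the next one. They
form the robot stack in the arrays `INST`, `SEG` and `STK`. -/
structure Stack (M : MRMPGP (gridGraph a b) n) (c : Config n) (d : ℕ) (ρ : ℕ → Fin n)
    (seg : Fin n → ℕ) (INST SEG STK : ℤ → ℤ → ℤ) : Prop where
  stk : ∀ j : ℕ, 1 ≤ j → j ≤ d → STK j 0 = (ρ j : ℕ)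
  inst : ∀ j : ℕ, 1 ≤ j → j ≤ d → INST (ρ j : ℕ) 0 = j
  inst_out : ∀ r : Fin n, (∀ j : ℕ, 1 ≤ j → j ≤ d → ρ j ≠ r) → INST r 0 = 0
  zero : ∀ j, 1 ≤ j → j ≤ d → c (ρ j) = 0
  run_pos : ∀ j, 1 ≤ j → j ≤ d → 0 < M.run (ρ j)
  segs : ∀ j : ℕ, 1 ≤ j → j < d → SEG (ρ j : ℕ) 0 = seg (ρ j)
  link : ∀ j, 1 ≤ j → j < d → M.Link c (ρ j) (ρ (j + 1)) (seg (ρ j))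

/-- The invariant of serving robots. -/
structure Serve (M : MRMPGP (gridGraph a b) n) (c : Config n) (ms : List (Fin n × ℕ)) (d : ℕ)
    (ρ : ℕ → Fin n) (seg : Fin n → ℕ) (s : State) : Prop where
  pool : M.Pool c ms s
  clean : M.Clean c
  reg_top : s.reg 12 = d
  stack : M.Stack c d ρ seg (s.arr 7) (s.arr 8) (s.arr 9)
  moves : ms.length + 2 * waiting c ≤ 2 * n

/-- It has turned out that there is no solution. -/
structure Failed (M : MRMPGP (gridGraph a b) n) (s : State) : Prop where
  fail : s.reg 5 = 1
  reg_top : s.reg 12 = 0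
  reg_n : s.reg 0 = n
  out : s.out = []
  no_solution : ¬ ∃ plan, M.IsSolution plan

variable {M : MRMPGP (gridGraph a b) n} {c : Config n} {ms : List (Fin n × ℕ)} {s s' : State}
  {d : ℕ} {ρ : ℕ → Fin n} {seg : Fin n → ℕ} {INST SEG STK : ℤ → ℤ → ℤ}

theorem waiting_update {r : Fin n} {k : ℕ} (h0 : c r = 0) (hk : 0 < k) :
    waiting (Function.update c r k) + 1 = waiting c := by
  have : (Finset.univ.filter fun w => c w = 0) =
      insert r (Finset.univ.filter fun w => Function.update c r k w = 0) := by
    ext w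
    by_cases hw : w = r
    · subst hw; simp [h0]
    · simp [hw]
  unfold waiting
  rw [this, Finset.card_insert_of_notMem]
  simp [hk.ne']

theorem waiting_cycle {e : Config n} {base top : ℕ}
    (hinj : ∀ i j, base ≤ i → i ≤ top → base ≤ j → j ≤ top → ρ i = ρ j → i = j)
    (h0 : ∀ j, base ≤ j → j ≤ top → c (ρ j) = 0)
    (hout : ∀ r, (∀ j, base ≤ j → j ≤ top → ρ j ≠ r) → e r = c r)
    (hpos : ∀ j, base ≤ j → j ≤ top → 0 < e (ρ j)) :
    waiting e + (top + 1 - base) = waiting c := by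
  have h1 : (Finset.univ.filter fun w => c w = 0) =
      (Finset.univ.filter fun w => e w = 0) ∪ (Finset.Icc base top).image ρ := by
    ext w
    simp only [Finset.mem_filter, Finset.mem_univ, true_and, Finset.mem_union, Finset.mem_image,
      Finset.mem_Icc]
    by_cases hw : ∃ j, (base ≤ j ∧ j ≤ top) ∧ ρ j = w
    · obtain ⟨j, hj, rfl⟩ := hw
      exact iff_of_true (h0 j hj.1 hj.2) (.inr ⟨j, hj, rfl⟩)
    · rw [hout w fun j hj1 hj2 hj => hw ⟨j, ⟨hj1, hj2⟩, hj⟩]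
      exact ⟨.inl, fun h => h.resolve_right hw⟩
  unfold waiting
  rw [h1, Finset.card_union_of_disjoint, Finset.card_image_of_injOn, Nat.card_Icc]
  · intro i hi j hj h
    simp only [Finset.coe_Icc, Set.mem_Icc] at hi hj
    exact hinj i j hi.1 hi.2 hj.1 hj.2 h
  · rw [Finset.disjoint_left]
    intro w hw hw'
    simp only [Finset.mem_filter, Finset.mem_univ, true_and, Finset.mem_image,
      Finset.mem_Icc] at hw hw'
    obtain ⟨j, hj, rfl⟩ := hw'
    have := hpos j hj.1 hj.2
    omega

namespace Stack

theorem inj (h : M.Stack c d ρ seg INST SEG STK) {i j : ℕ} (hi : 1 ≤ i) (hi' : i ≤ d) (hj : 1 ≤ j)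
    (hj' : j ≤ d) (hij : ρ i = ρ j) : i = j := by
  have h1 := h.inst i hi hi'
  have h2 := h.inst j hj hj'
  rw [hij] at h1
  omega

theorem le_waiting (h : M.Stack c d ρ seg INST SEG STK) : d ≤ waiting c := by
  have : (Finset.Icc 1 d).image ρ ⊆ Finset.univ.filter fun w => c w = 0 := by
    intro w hw
    simp only [Finset.mem_image, Finset.mem_Icc] at hw
    obtain ⟨j, hj, rfl⟩ := hw
    simpa using h.zero j hj.1 hj.2
  have h2 := Finset.card_le_card this
  rwa [Finset.card_image_of_injOn, Nat.card_Icc, Nat.add_sub_cancel] at h2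
  intro i hi j hj hij
  simp only [Finset.coe_Icc, Set.mem_Icc] at hi hj
  exact h.inj hi.1 hi.2 hj.1 hj.2 hij

/-- The top robot leaves its source and the stack. -/
theorem pop (h : M.Stack c d ρ seg INST SEG STK) (hd : 1 ≤ d) (k : ℕ) :
    M.Stack (Function.update c (ρ d) k) (d - 1) ρ seg (upd INST (ρ d : ℕ) 0 0) SEG STK := by
  have hne : ∀ j, 1 ≤ j → j ≤ d - 1 → ρ j ≠ ρ d := fun j h1 h2 h3 => by
    have := h.inj h1 (by omega) hd le_rfl h3
    omega
  constructor
  · exact fun j h1 h2 => h.stk j h1 (by omega)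
  · intro j h1 h2
    rw [upd_apply, if_neg fun h3 => hne j h1 h2 (Fin.ext (by exact_mod_cast h3.1))]
    exact h.inst j h1 (by omega)
  · intro r hr
    rw [upd_apply]
    split_ifs with h1
    · rfl
    · refine h.inst_out r fun j hj1 hj2 hj3 => ?_
      rcases Nat.lt_or_ge (d - 1) j with h2 | h2
      · obtain rfl : j = d := by omega
        exact h1 ⟨by rw [hj3], rfl⟩
      · exact hr j hj1 h2 hj3
  · intro j h1 h2
    rw [Function.update_of_ne (hne j h1 h2)]
    exact h.zero j h1 (by omega)
  · exact fun j h1 h2 => h.run_pos j h1 (by omega)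
  · exact fun j h1 h2 => h.segs j h1 (by omega)
  · refine fun j h1 h2 => (h.link j h1 (by omega)).mono fun w hw => ?_
    by_cases hwd : w = ρ d
    · rw [hwd]; exact h.zero d hd le_rfl
    · rwa [Function.update_of_ne hwd] at hw

/-- The robot `o` blocks the top robot. -/
theorem push (h : M.Stack c d ρ seg INST SEG STK) (hd : 1 ≤ d) {o : Fin n} {k : ℕ} (h0 : c o = 0)
    (hr : 0 < M.run o) (hl : M.Link c (ρ d) o k) (hi : INST o 0 = 0) :
    M.Stack c (d + 1) (Function.update ρ (d + 1) o) (Function.update seg (ρ d) k)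
      (upd INST o 0 (d + 1)) (upd SEG (ρ d : ℕ) 0 k) (upd STK (d + 1) 0 o) := by
  have hρ : ∀ j, j ≤ d → Function.update ρ (d + 1) o j = ρ j := fun j hj =>
    Function.update_of_ne (by omega) _ _
  have hρ' : Function.update ρ (d + 1) o (d + 1) = o := Function.update_self ..
  have hcase : ∀ j, j ≤ d + 1 → j ≤ d ∨ j = d + 1 := by omega
  have hne : ∀ j, 1 ≤ j → j ≤ d → ρ j ≠ o := fun j h1 h2 h3 => by
    have := h.inst j h1 h2
    rw [h3] at this
    omega
  have hned : ∀ j, 1 ≤ j → j < d → ρ j ≠ ρ d := fun j h1 h2 h3 => by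
    have := h.inj h1 h2.le hd le_rfl h3
    omega
  constructor
  · intro j h1 h2
    rw [upd_apply]
    rcases hcase j h2 with h3 | rfl
    · rw [if_neg (by omega), hρ j h3]
      exact h.stk j h1 h3
    · rw [hρ', if_pos (by simp)]
  · intro j h1 h2
    rw [upd_apply]
    rcases hcase j h2 with h3 | rfl
    · rw [hρ j h3, if_neg fun h4 => hne j h1 h3 (Fin.ext (by exact_mod_cast h4.1))]
      exact h.inst j h1 h3
    · rw [hρ', if_pos (by simp)]; push_cast; rfl
  · intro r hr'
    rw [upd_apply, if_neg fun h4 => hr' (d + 1) (by omega) le_rfl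
      (by rw [hρ']; exact Fin.ext (by exact_mod_cast h4.1.symm))]
    refine h.inst_out r fun j h1 h2 => ?_
    rw [← hρ j h2]
    exact hr' j h1 (by omega)
  · intro j h1 h2
    rcases hcase j h2 with h3 | rfl
    · rw [hρ j h3]; exact h.zero j h1 h3
    · rwa [hρ']
  · intro j h1 h2
    rcases hcase j h2 with h3 | rfl
    · rw [hρ j h3]; exact h.run_pos j h1 h3
    · rwa [hρ']
  · intro j h1 h2
    rw [hρ j (by omega), upd_apply]
    rcases Nat.lt_succ_iff_lt_or_eq.1 h2 with h3 | rfl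
    · rw [if_neg fun h4 => hned j h1 h3 (Fin.ext (by exact_mod_cast h4.1)),
        Function.update_of_ne (hned j h1 h3)]
      exact h.segs j h1 h3
    · simp
  · intro j h1 h2
    rw [hρ j (by omega)]
    rcases Nat.lt_succ_iff_lt_or_eq.1 h2 with h3 | rfl
    · rw [hρ _ (by omega), Function.update_of_ne (hned j h1 h3)]
      exact h.link j h1 h3
    · rw [hρ', Function.update_self]
      exact hl

/-- A robot of the stack blocks the top robot. -/
theorem cycle (h : M.Stack c d ρ seg INST SEG STK) {i k : ℕ} (hi : 1 ≤ i) (hd : i ≤ d)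
    (hl : M.Link c (ρ d) (ρ i) k) :
    M.Cycle c (Function.update ρ (d + 1) (ρ i)) (Function.update seg (ρ d) k) i d := by
  have hρ : ∀ j, j ≤ d → Function.update ρ (d + 1) (ρ i) j = ρ j := fun j hj =>
    Function.update_of_ne (by omega) _ _
  have hned : ∀ j, 1 ≤ j → j < d → ρ j ≠ ρ d := fun j h1 h2 h3 => by
    have := h.inj h1 h2.le (hi.trans hd) le_rfl h3
    omega
  constructor
  · exact hd
  · rw [hρ i hd, Function.update_self]
  · intro j j' h1 h2 h3 h4
    rw [hρ j h2, hρ j' h4]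
    exact h.inj (by omega) h2 (by omega) h4
  · intro j h1 h2
    rw [hρ j h2]
    exact h.zero j (by omega) h2
  · intro j h1 h2
    rw [hρ j h2]
    rcases h2.lt_or_eq with h3 | rfl
    · rw [hρ (j + 1) h3, Function.update_of_ne (hned j (by omega) h3)]
      exact h.link j (by omega) h3
    · rw [Function.update_self, Function.update_self]
      exact hl

end Stack

/-- The result of serving the top robot: no solution, or progress, measured by the decrease `δ` of
`2 * waiting c - d`, which is `1` if a robot leaves the stack or is added to it, and `m` if a cycle
of `m` robots is resolved. In case of failure, at most `d` robots have been traversed. The robot at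
the bottom of the stack stays there until it leaves its source. -/
def Served (M : MRMPGP (gridGraph a b) n) (c : Config n) (d : ℕ) (r : Fin n) (s : State) (T : ℕ) :
    Prop :=
  (M.Failed s ∧ T + 1 ≤ 80 * (d * (n + 2))) ∨
  ∃ c' ms' d' ρ' seg' δ, M.Serve c' ms' d' ρ' seg' s ∧ (∀ w, c' w = 0 → c w = 0) ∧
    (c' r ≠ 0 ∨ 1 ≤ d' ∧ ρ' 1 = r) ∧ 2 * waiting c' + δ + d = 2 * waiting c + d' ∧
    T + 1 ≤ 80 * (δ * (n + 2))

/-- The case in which a robot of the stack blocks the top robot. -/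
theorem tot_resolve (X : M.Crossing) (I : M.Serve c ms d ρ seg s) {i k : ℕ} (hi : 1 ≤ i)
    (hd : i ≤ d) (hl : M.Link c (ρ d) (ρ i) k) (h15 : s'.reg 15 = i)
    (hs : Same [7, 8, 13, 14, 15, 27] [8] s s') (h8 : s'.arr 8 = upd (s.arr 8) (ρ d : ℕ) 0 k) :
    Tot resolveCycle s' fun s'' T =>
      s''.reg 3 = s.reg 3 ∧
        (M.Failed s'' ∧ T ≤ 15 * ((d + 1 - i) * (n + 2)) + 11 * (d + 1 - i) + 60 ∨
        ∃ c' ms', M.Serve c' ms' (i - 1) ρ seg s'' ∧ (∀ w, c' w = 0 → c w = 0) ∧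
          (∀ j, i ≤ j → j ≤ d → c' (ρ j) ≠ 0) ∧
          waiting c' + (d + 1 - i) = waiting c ∧
          T ≤ 15 * ((d + 1 - i) * (n + 2)) + 11 * (d + 1 - i) + 60) := by
  have K := I.stack
  have C := K.cycle hi hd hl
  have hρ : ∀ j, j ≤ d → Function.update ρ (d + 1) (ρ i) j = ρ j := fun j hj =>
    Function.update_of_ne (by omega) _ _
  have hned : ∀ j, 1 ≤ j → j < d → ρ j ≠ ρ d := fun j h1 h2 h3 => by
    have := K.inj h1 h2.le (hi.trans hd) le_rfl h3
    omega
  have hP := I.pool.same hs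
  have D : CycleData M c (Function.update ρ (d + 1) (ρ i)) (Function.update seg (ρ d) k) i d
      s' := by
    refine ⟨C, hi, h15, ?_, ?_, ?_, ?_, ?_⟩
    · rw [hs.reg 12 (by decide)]; exact I.reg_top
    · intro j h1 h2
      rw [hs.arr 9 (by decide), hρ j h2]; exact K.stk j h1 h2
    · intro j h1 h2
      rw [hs.arr 7 (by decide), hρ j h2]; exact K.inst j h1 h2
    · intro r hr
      rw [hs.arr 7 (by decide)]
      exact K.inst_out r fun j h1 h2 => by rw [← hρ j h2]; exact hr j h1 h2
    · intro j h1 h2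
      rw [h8, hρ j h2, upd_apply]
      rcases h2.lt_or_eq with h3 | rfl
      · rw [if_neg fun h4 => hned j h1 h3 (Fin.ext (by exact_mod_cast h4.1)),
          Function.update_of_ne (hned j h1 h3)]
        exact K.segs j h1 h3
      · simp
  simp only [resolveCycle, tot_block_cons, tot_block_nil, tot_assign, tot_ite, Test.holds,
    Expr.eval, rRes, rFail, rD, rBase]
  refine (tot_traverse X hP D).mono ?_
  rintro s1 T1 ⟨g1, g2, g3⟩
  have g4 := hP.same g2
  refine ⟨fun g5 => ?_, fun g5 => ?_⟩
  · have hno : ¬ ∃ plan, M.IsSolution plan := by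
      rcases g3 with g3 | g3
      · exact g3.2
      · omega
    refine ⟨?_, .inl ⟨⟨by simp, by simp, by simpa using g4.known.reg_n, g4.known.out, hno⟩,
      by omega⟩⟩
    simp [g2.reg 3 (by decide), hs.reg 3 (by decide)]
  · rcases g3 with g3 | ⟨-, p, kp, q, kq, z, kz, H, f1, f2, f3, f4, f5⟩
    · exact absurd g3.1 g5
    refine (tot_rotate X g4 I.clean (D.same g2) H f1 f2 f3 f4 f5).mono ?_
    rintro s2 T2 ⟨e1, e2, e, ms', R⟩
    have e3 : s2.reg 15 = i := by rw [e2.reg 15 (by decide), g2.reg 15 (by decide), h15]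
    have hout : ∀ r, (∀ j, i ≤ j → j ≤ d → ρ j ≠ r) → e r = c r := fun r hr =>
      R.out r fun j h1 h2 => by rw [hρ j h2]; exact hr j h1 h2
    have hpos : ∀ j, i ≤ j → j ≤ d → 0 < e (ρ j) := fun j h1 h2 => by
      rw [← hρ j h2]; exact R.pos j h1 h2
    have hmono : ∀ w, e w = 0 → c w = 0 := fun w hw => by
      rw [← hout w fun j h1 h2 h3 => ?_]
      · exact hw
      · have := hpos j h1 h2
        rw [h3] at this
        omega
    have hw := waiting_cycle (fun j j' h1 h2 h3 h4 => K.inj (by omega) h2 (by omega) h4)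
      (fun j h1 h2 => K.zero j (by omega) h2) hout hpos
    refine ⟨?_, .inr ⟨e, ms', ⟨R.pool.same (Same.refl (X := [12]) (Y := []) s2).setReg, R.clean,
      ?_, ?_, ?_⟩, hmono, fun j h1 h2 => (hpos j h1 h2).ne', hw, by omega⟩⟩
    · simp [e2.reg 3 (by decide), g2.reg 3 (by decide), hs.reg 3 (by decide)]
    · simp only [State.setReg_reg, if_true, e3]; omega
    · constructor
      · intro j h1 h2
        rw [← hρ j (by omega)]
        exact R.stk j h1 (by omega)
      · intro j h1 h2
        rw [← hρ j (by omega)]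
        exact R.inst j h1 (by omega)
      · intro r hr
        exact R.inst_out r fun j h1 h2 => by rw [hρ j (by omega)]; exact hr j h1 (by omega)
      · intro j h1 h2
        rw [hout (ρ j) fun j' h3 h4 h5 => ?_]
        · exact K.zero j h1 (by omega)
        · have := K.inj (by omega) h4 h1 (by omega) h5
          omega
      · exact fun j h1 h2 => K.run_pos j h1 (by omega)
      · intro j h1 h2
        have := R.segs j h1 (by omega)
        rwa [hρ j (by omega), Function.update_of_ne (hned j h1 (by omega))] at this
      · exact fun j h1 h2 => (K.link j h1 (by omega)).mono hmono
    · have := R.length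
      have := I.moves
      omega

theorem tot_serveStep (X : M.Crossing) (I : M.Serve c ms d ρ seg s) (hd : 1 ≤ d) :
    Tot serveStep s fun s' T => s'.reg 3 = s.reg 3 ∧ Served M c d (ρ 1) s' T := by
  have K := I.stack
  have h0 := K.zero d hd le_rfl
  simp only [serveStep, tot_block_cons, tot_block_nil, tot_ite, tot_assign, tot_write, Expr.eval,
    Test.holds, rMode, rX, rY, rCur, rK, rD, aSeg, aInst, rO, aStk, rBase]
  refine (tot_scan X I.pool I.clean I.reg_top (K.stk d hd le_rfl) h0 
    (K.run_pos d hd le_rfl)).mono ?_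
  rintro s1 T1 ⟨g1, g2, g3, k, g4, S⟩
  have hP := I.pool.same g2
  have h12 : s1.reg 12 = d := (g2.reg 12 (by decide)).trans I.reg_top
  have h3 : s1.reg 3 = s.reg 3 := g2.reg 3 (by decide)
  have hK : M.Stack c d ρ seg (s1.arr 7) (s1.arr 8) (s1.arr 9) := by
    rw [g2.arr 7 (by decide), g2.arr 8 (by decide), g2.arr 9 (by decide)]; exact K
  refine ⟨fun hm => ?_, fun hm => ?_⟩
  · obtain ⟨e1, e2⟩ := S.move hm
    have hs : Same [22, 23] [] s1 ((s1.setReg 22 (s1.reg 27)).setReg 23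
        ((s1.setReg 22 (s1.reg 27)).reg 7)) := (Same.refl s1).setReg.setReg
    refine (tot_moveRobot (hP.same hs) S.le (by simpa using g3) (by simpa using g4) e1).mono ?_
    rintro s2 T2 ⟨f1, f2, f3, f4⟩
    have f5 := hs.mono.trans (f3.mono (X' := [22, 23, 24]) (Y' := [6, 7, 11]))
    have hwait := waiting_update h0 S.pos
    refine ⟨by simp [f5.reg 3 (by decide), h3], .inr ⟨_, _, d - 1, ρ, seg, 1,
      ⟨f2.same (Same.refl (X := [12]) (Y := []) s2).setReg, e2, ?_, ?_, ?_⟩, ?_, ?_, by omega,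
      by omega⟩⟩
    · simp only [State.setReg_reg, if_true, f5.reg 12 (by decide), h12]; omega
    · rw [State.setReg_arr, f4, f5.arr 8 (by decide), f5.arr 9 (by decide)]
      exact hK.pop hd k
    · have := I.moves
      simp
      omega
    · intro w hw
      by_cases hwd : w = ρ d
      · rw [hwd]; exact h0
      · rwa [Function.update_of_ne hwd] at hw
    · rcases hd.lt_or_eq with h | h
      · exact .inr ⟨by omega, rfl⟩
      · subst h
        rw [Function.update_self]
        exact .inl S.pos.ne'
  · obtain ⟨o, e1, e2, e3, e4⟩ := S.blocked (S.mode.resolve_left hm)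
    simp only [State.setArr_reg, State.setArr_arr, Nat.reduceEqDiff, if_false, State.setReg_reg,
      State.setReg_arr, if_true, h12, g3, g4, e1]
    refine ⟨fun hin => ?_, fun hin => ?_⟩
    · refine ⟨h3, .inr ⟨c, ms, d + 1, Function.update ρ (d + 1) o,
        Function.update seg (ρ d) k, 1, ⟨hP.same (X := [12]) (Y := [7, 8, 9])
        (((Same.refl s1).setArr).setReg).setArr.setArr, I.clean, by simp, ?_, I.moves⟩,
        fun w h => h, .inr ⟨by omega, ?_⟩, by omega, by omega⟩⟩
      · simpa using hK.push hd e2 e3 e4 hin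
      · exact Function.update_of_ne (by omega) _ _
    · obtain ⟨i, hi1, hi2, hi3⟩ : ∃ i, 1 ≤ i ∧ i ≤ d ∧ ρ i = o := by
        by_contra hcon
        exact hin (hK.inst_out o fun j h1 h2 h3 => hcon ⟨j, h1, h2, h3⟩)
      subst hi3
      have hi4 := hK.inst i hi1 hi2
      refine (tot_resolve X I hi1 hi2 e4 (by simp [hi4])
        (g2.mono.trans ((Same.refl s1).setArr.setReg)) (by simp [g2.arr 8 (by decide)])).mono ?_
      have hm1 : (d + 1 - i) * 2 ≤ (d + 1 - i) * (n + 2) := Nat.mul_le_mul_left _ (by omega)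
      have hm2 : 1 * (n + 2) ≤ (d + 1 - i) * (n + 2) := Nat.mul_le_mul_right _ (by omega)
      have hm3 : (d + 1 - i) * (n + 2) ≤ d * (n + 2) := Nat.mul_le_mul_right _ (by omega)
      rintro s2 T2 ⟨f1, f2⟩
      refine ⟨f1, ?_⟩
      rcases f2 with ⟨f2, f3⟩ | ⟨c', ms', f2, f3, f4, f5, f6⟩
      · exact .inl ⟨f2, by omega⟩
      · refine .inr ⟨c', ms', i - 1, ρ, seg, d + 1 - i, f2, f3, ?_, by omega, by omega⟩
        rcases hi1.lt_or_eq with h | h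
        · exact .inr ⟨by omega, rfl⟩
        · exact .inl (f4 1 h.ge hd)

end MRMPGP

/-! ### Serving all robots -/

/-- Serve robots until `rR` has left its source, unless this robot has done so already or no other
robot passes its source. -/
def serveRobot : Program :=
  .ite (.and (.eq (.reg rFail) c0) (.and (.eq (ld aPos (.reg rR) c0) c0)
      (.not (.eq (ld aOth (.reg rR) c0) c0))))
    (block [
      .assign rD (.const 1),
      .write aStk (.const 1) c0 (.reg rR),
      .write aInst (.reg rR) c0 (.const 1),
      .while (.le (.const 1) (.reg rD)) serveStep])
    .skip

/-- Make all robots leave their sources if other robots pass there. -/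
def serveRobots : Program := block [.assign rCnt c0, forLoop rR (.reg rN) serveRobot]

/-! ### Output -/

/-- Output the move number `rJ`. -/
def emitMove : Program := block [
  .assign rX (ld aBuf (.reg rJ) c0),
  .assign rM (ld aMov (.reg rX) (ld aBuf (.reg rJ) (.const 1))),
  .emit (.reg rX),
  .ite (.eq (ld aRob (.reg rX) c0) (.const 1))
    (block [.emit (ld aRob (.reg rX) (.const 1)), .emit (.reg rM)])
    (block [.emit (.reg rM), .emit (ld aRob (.reg rX) (.const 1))])]

/-- Output the move of robot `rR` to its target. -/
def emitTarget : Program := block [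
  .emit (.reg rR),
  .emit (ld aIn (.reg rR) (.const 2)),
  .emit (ld aIn (.reg rR) (.const 3))]

/-- Report the result. -/
def report : Program :=
  .ite (.eq (.reg rFail) c0)
    (block [
      .emit (.const 1),
      forLoop rJ (.reg rCnt) emitMove,
      forLoop rR (.reg rN) emitTarget])
    (.emit c0)

/-- The motion planning algorithm. -/
def planner : Program := block [
  readInput,
  comparePairs,
  .ite (.eq (.reg rFail) c0) (block [walkRuns, serveRobots]) .skip,
  report]

namespace MRMPGP

variable {a b n : ℕ}

/-- The invariant of serving robots while the robot stack is empty. -/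
structure Idle (M : MRMPGP (gridGraph a b) n) (c : Config n) (ms : List (Fin n × ℕ)) (s : State) :
    Prop where
  pool : M.Pool c ms s
  clean : M.Clean c
  inst : ∀ r : Fin n, s.arr 7 r 0 = 0
  moves : ms.length + 2 * waiting c ≤ 2 * n

/-- The invariant after serving the first `i` robots, with the potential `m`, which pays `80 (n +
2)` steps twice for each robot that is still at its source. -/
def ServedUpTo (M : MRMPGP (gridGraph a b) n) (i m : ℕ) (s : State) : Prop :=
  M.Failed s ∧ m = 0 ∨ ∃ c ms, M.Idle c ms s ∧
    (∀ p : Fin n, (p : ℕ) < i → c p = 0 → M.run p = 0) ∧ m = 80 * (2 * waiting c * (n + 2))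

variable {M : MRMPGP (gridGraph a b) n} {c : Config n} {ms : List (Fin n × ℕ)} {s s' : State}
  {d : ℕ} {ρ : ℕ → Fin n} {seg : Fin n → ℕ}

theorem Failed.setReg {x : ℕ} {z : ℤ} (h : M.Failed s) (h0 : x ≠ 0) (h5 : x ≠ 5) (h12 : x ≠ 12) :
    M.Failed (s.setReg x z) :=
  ⟨by simpa [h5.symm] using h.fail, by simpa [h12.symm] using h.reg_top,
    by simpa [h0.symm] using h.reg_n, h.out, h.no_solution⟩

theorem Idle.setReg {x : ℕ} {z : ℤ} (h : M.Idle c ms s)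
    (hx : 0 ∉ [x] ∧ 5 ∉ [x] ∧ 24 ∉ [x] := by decide) : M.Idle c ms (s.setReg x z) :=
  ⟨h.pool.same (Same.refl (X := [x]) (Y := []) s |>.setReg (by simp)) hx, h.clean, h.inst, h.moves⟩

theorem Serve.idle (h : M.Serve c ms 0 ρ seg s) : M.Idle c ms s :=
  ⟨h.pool, h.clean, fun r => h.stack.inst_out r fun j h1 h2 => by omega, h.moves⟩

/-- A robot whose source is passed by another robot starts the robot stack. -/
theorem Idle.serve (h : M.Idle c ms s) {r : Fin n} (h0 : c r = 0) (hr : 0 < M.run r) :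
    M.Serve c ms 1 (fun _ => r) (fun _ => 0)
      (((s.setReg 12 1).setArr 9 1 0 r).setArr 7 r 0 1) := by
  refine ⟨h.pool.same (((Same.refl (X := [12]) (Y := [7, 9]) s).setReg).setArr).setArr, h.clean,
    by simp, ?_, h.moves⟩
  constructor
  · intro j h1 h2
    obtain rfl : j = 1 := by omega
    simp [upd_apply]
  · intro j h1 h2
    obtain rfl : j = 1 := by omega
    simp [upd_apply]
  · intro w hw
    have h1 := hw 1 le_rfl le_rfl
    have h2 : w ≠ r := fun h => h1 h.symm
    simpa [upd_apply, Fin.val_inj, h2] using h.inst w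
  · exact fun _ _ _ => h0
  · exact fun _ _ _ => hr
  · intro j h1 h2; omega
  · intro j h1 h2; omega

theorem tot_serveRobot (X : M.Crossing) {i m : ℕ} (hi : i < n) (h : M.ServedUpTo i m s)
    (h3 : s.reg 3 = i) :
    Tot serveRobot s fun s' T => s'.reg 3 = i ∧ ∃ m', M.ServedUpTo (i + 1) m' s' ∧
      T + m' ≤ m + 10 := by
  set r : Fin n := ⟨i, hi⟩ with hr
  have hri : (i : ℤ) = ((r : ℕ) : ℤ) := rfl
  simp only [serveRobot, tot_block_cons, tot_block_nil, tot_ite, tot_assign, tot_write, tot_skip,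
    Expr.eval, Test.holds, rFail, rR, rD, aPos, aOth, aStk, aInst, State.setReg_reg,
    State.setReg_arr, State.setArr_reg, Nat.reduceEqDiff, if_false, h3, hri]
  rcases h with ⟨h, rfl⟩ | ⟨c, ms, h, h1, rfl⟩
  · have h5 := h.fail
    refine ⟨fun g => absurd g.1 (by omega), fun _ => ⟨trivial, 0, .inl ⟨h, rfl⟩, by norm_num⟩⟩
  have hcase : ∀ {c' : Config n}, (∀ w, c' w = 0 → c w = 0) → (c' r = 0 → M.run r = 0) →
      ∀ p : Fin n, (p : ℕ) < i + 1 → c' p = 0 → M.run p = 0 := fun hm h2 p hp hp0 => by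
    rcases Nat.lt_succ_iff_lt_or_eq.1 hp with hp | hp
    · exact h1 p hp (hm p hp0)
    · obtain rfl : p = r := Fin.ext hp
      exact h2 hp0
  have e1 := h.pool.fail
  have e2 := h.pool.pos r
  have e3 := h.pool.tables.oth r 0 (Nat.zero_le _)
  refine ⟨fun g => ?_, fun g => ⟨trivial, _, .inr ⟨c, ms, h, hcase (fun _ h => h) ?_, rfl⟩,
    by omega⟩⟩
  swap
  · intro hc0
    have e4 : s.arr 4 r 0 = 0 := by
      by_contra e4
      exact g ⟨e1, by rw [e2, hc0]; rfl, e4⟩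
    exact Nat.le_zero.1 (e3.run_le e4)
  obtain ⟨-, g2, g3⟩ := g
  have hc0 : c r = 0 := by omega
  have hrun : 0 < M.run r := by
    rw [Nat.pos_iff_ne_zero]
    intro h0
    refine g3 (e3.2 ?_)
    rw [← h0]; exact X.clear_run r
  have hloop := fun m s₁ => Tot.while (m := m) (s := s₁) (t := .le (.const 1) (.reg rD))
    (p := serveStep)
    (fun m s => s.reg 3 = (r : ℕ) ∧ (M.Failed s ∧ m = 0 ∨ ∃ c' ms' d ρ seg p,
      M.Serve c' ms' d ρ seg s ∧ (∀ w, c' w = 0 → c w = 0) ∧ (c' r ≠ 0 ∨ 1 ≤ d ∧ ρ 1 = r) ∧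
      p + d = 2 * waiting c' ∧ m = 80 * (p * (n + 2)))) (by
    rintro m s ⟨f1, f2⟩ ht
    simp only [Test.holds, Expr.eval, rD] at ht
    rcases f2 with ⟨f2, -⟩ | ⟨c', ms', d, ρ, seg, p, f2, f3, f4, f5, rfl⟩
    · have := f2.reg_top
      omega
    have hd : 1 ≤ d := by have := f2.reg_top; omega
    refine (tot_serveStep X f2 hd).mono ?_
    rintro s' T ⟨k1, k2⟩
    have hdw := f2.stack.le_waiting
    rcases k2 with ⟨k2, k3⟩ | ⟨c2, ms2, d2, ρ2, seg2, δ, k2, k3, k4, k5, k6⟩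
    · have : d * (n + 2) ≤ p * (n + 2) := Nat.mul_le_mul_right _ (by omega)
      exact ⟨0, ⟨k1.trans f1, .inl ⟨k2, rfl⟩⟩, by omega⟩
    · have hdw2 := k2.stack.le_waiting
      obtain ⟨q, rfl⟩ : ∃ q, p = q + δ := ⟨p - δ, by omega⟩
      have : (q + δ) * (n + 2) = q * (n + 2) + δ * (n + 2) := by ring
      refine ⟨_, ⟨k1.trans f1, .inr ⟨c2, ms2, d2, ρ2, seg2, q, k2, fun w hw => f3 w (k3 w hw), ?_,
        by omega, rfl⟩⟩, by omega⟩
      rcases f4 with f4 | ⟨f4, f6⟩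
      · exact .inl fun h => f4 (k3 r h)
      · rwa [f6] at k4)
  have hw : 1 ≤ waiting c := (h.serve hc0 hrun).stack.le_waiting
  refine (hloop (80 * ((2 * waiting c - 1) * (n + 2))) _ ⟨by simpa using h3, .inr ⟨c, ms, 1,
    fun _ => r, fun _ => 0, 2 * waiting c - 1, h.serve hc0 hrun, fun _ h => h, .inr ⟨le_rfl, rfl⟩,
    by omega, rfl⟩⟩).mono ?_
  have : (2 * waiting c - 1) * (n + 2) ≤ 2 * waiting c * (n + 2) :=
    Nat.mul_le_mul_right _ (by omega)
  rintro s' T ⟨k1, m', ⟨k2, k3⟩, k4⟩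
  simp only [Test.holds, Expr.eval, rD] at k1
  refine ⟨k2, m', ?_, by omega⟩
  rcases k3 with k3 | ⟨c', ms', d, ρ, seg, p, f2, f3, f4, f5, rfl⟩
  · exact .inl k3
  · have := f2.reg_top
    obtain rfl : d = 0 := by omega
    obtain rfl : p = 2 * waiting c' := f5
    exact .inr ⟨c', ms', f2.idle, hcase f3 fun h => absurd h (f4.resolve_right (by omega)), rfl⟩

/-- What is known when no robot at its source is passed by another robot, or it has turned out that
there is no solution. -/
def Outcome (M : MRMPGP (gridGraph a b) n) (s : State) : Prop :=
  (s.reg 5 = 1 ∧ s.out = [] ∧ ¬ ∃ plan, M.IsSolution plan) ∨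
  ∃ c ms, M.Pool c ms s ∧ M.Clean c ∧ (∀ r, c r = 0 → M.run r = 0) ∧ ms.length ≤ 2 * n

theorem tot_serveRobots (X : M.Crossing)
    (h : WalkInv M (fun r k => k ≤ M.run r) (fun r k => k ≤ M.run r) s) :
    Tot serveRobots s fun s' T => T ≤ 80 * (2 * n * (n + 2)) + n * 13 + 5 ∧ M.Outcome s' := by
  simp only [serveRobots, tot_block_cons, tot_block_nil, tot_assign, Expr.eval, rCnt]
  have hw : waiting (start : Config n) = n := by simp [waiting, start]
  refine (tot_forLoop n 10 (fun i m s => M.ServedUpTo i m s ∧ s.reg 3 = i) ?_ ?_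
    (m := 80 * (2 * n * (n + 2))) ?_).mono ?_
  · rintro i m s ⟨h1 | ⟨c, ms, h1, -⟩, h2⟩
    · exact ⟨h2, h1.1.reg_n⟩
    · exact ⟨h2, h1.pool.known.reg_n⟩
  · rintro i m s hi ⟨h1, h2⟩
    refine (tot_serveRobot X hi h1 h2).mono ?_
    rintro s' T ⟨h3, m', h4, h5⟩
    refine ⟨m', ⟨?_, by simp [h3]⟩, h5⟩
    rcases h4 with ⟨h4, h6⟩ | ⟨c, ms, h4, h6⟩
    · exact .inl ⟨h4.setReg (by norm_num) (by norm_num) (by norm_num), h6⟩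
    · exact .inr ⟨c, ms, h4.setReg, h6⟩
  · refine ⟨.inr ⟨start, [], Idle.setReg ⟨⟨h.known.setReg (by norm_num), by simpa using h.fail,
      h.tables, fun r => ?_, by simp, by simp, fun r => Nat.zero_le _, by simp, .nil⟩,
      fun r hr => absurd hr (lt_irrefl 0), fun r => ?_, by simp [hw]⟩, fun p hp => by omega,
      by rw [hw]⟩, by simp⟩
    · simp [h.zero 6 le_rfl, start]
    · simp [h.zero 7 (by norm_num)]
  · rintro s' T ⟨m, ⟨h1, h2⟩, h3⟩
    refine ⟨by omega, ?_⟩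
    rcases h1 with ⟨h1, -⟩ | ⟨c, ms, h1, h4, -⟩
    · exact .inl ⟨h1.fail, h1.out, h1.no_solution⟩
    · exact .inr ⟨c, ms, h1.pool, h1.clean, fun r => h4 r r.2, by have := h1.moves; omega⟩

/-! ### The compact plan -/

/-- The compact plan that is output: the moves `ms`, then every robot goes to its target. -/
def fullPlan (M : MRMPGP (gridGraph a b) n) (ms : List (Fin n × ℕ)) :
    List (Fin n × (Fin a × Fin b)) :=
  (ms.map fun m => (m.1, M.vert m.1 m.2)) ++ (List.finRange n).map fun r => (r, M.trg r)

/-- The first `i` robots can go straight to their targets: no other robot is on their remaining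
paths, at its source, at its target, or in between. -/
theorem creach_targets (X : M.Crossing) {ms : List (Fin n × (Fin a × Fin b))}
    (hr : M.CReach start ms c) (hc : M.Clean c) (hlen : ∀ r, c r ≤ M.len r)
    (h0 : ∀ r, c r = 0 → M.run r = 0) (i : ℕ) (hi : i ≤ n) :
    M.CReach start (ms ++ ((List.finRange n).take i).map fun r => (r, M.trg r))
      (fun r => if (r : ℕ) < i then M.len r else c r) := by
  induction i with
  | zero => simpa using hr
  | succ i ih =>
    have h1 := ih (by omega)
    set r : Fin n := ⟨i, hi⟩ with hri
    have h2 := h1.snoc r (M.len r) (by simp [hri]; exact hlen _) le_rfl ?_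
    · have h3 : (List.finRange n).take (i + 1) = (List.finRange n).take i ++ [r] := by
        rw [List.take_succ_eq_append_getElem (by simpa using hi)]
        simp [hri]
      rw [h3, List.map_append, ← List.append_assoc]
      convert h2 using 1
      · simp [vert, len]
      · funext w
        rw [Function.update_apply]
        by_cases hw : w = r
        · subst hw; simp [hri]
        · have : (w : ℕ) ≠ i := fun h => hw (Fin.ext h)
          have h4 : (w : ℕ) < i + 1 ↔ (w : ℕ) < i := by omega
          simp only [if_neg hw, h4]
    · intro k hk hk' w hw hv
      simp only [hri, lt_irrefl, if_false] at hk
      rw [M.loc_eq] at hv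
      by_cases hwi : (w : ℕ) < i
      · simp only [hwi, if_true] at hv
        have h3 := X.clear_len w r hw.symm
        rw [hv] at h3
        exact h3 (M.on_vert r k)
      · simp only [hwi, if_false] at hv
        rcases Nat.eq_zero_or_pos (c w) with h3 | h3
        · have h4 := X.clear_run w
          rw [h0 w h3, ← h3] at h4
          exact h4 r hw.symm (hv ▸ M.on_vert r k)
        · exact hc w h3 r hw.symm k hk.le hk' hv.symm

theorem exists_solution (X : M.Crossing) (h : M.Pool c ms s) (hc : M.Clean c)
    (h0 : ∀ r, c r = 0 → M.run r = 0) :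
    ∃ plan, M.Expands start (M.fullPlan ms) plan ∧ M.IsSolution plan := by
  have h1 := creach_targets X h.reach hc (fun r => (h.le_run r).trans (X.run_le_len r)) h0 n le_rfl
  rw [List.take_of_length_le (by simp)] at h1
  obtain ⟨plan, h2, h3⟩ := h1.exists_plan
  refine ⟨plan, h2, X.inj, ?_⟩
  convert h3 using 1
  funext r
  simp [goal]

end MRMPGP

namespace MRMPGP

/-! ### Correctness of the planner -/

variable {a b n : ℕ} {M : MRMPGP (gridGraph a b) n} {c : Config n} {ms : List (Fin n × ℕ)}
  {s s' : State}

/-- The three numbers that stand for a move in the output. -/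
def moveOutput (m : Fin n × (Fin a × Fin b)) : List ℤ :=
  [((m.1 : ℕ) : ℤ), ((m.2.1 : ℕ) : ℤ), ((m.2.2 : ℕ) : ℤ)]

theorem flatMap_take_succ {α β : Type*} (l : List α) (f : α → List β) {i : ℕ} (hi : i < l.length) :
    (l.take (i + 1)).flatMap f = (l.take i).flatMap f ++ f l[i] := by
  rw [List.take_succ_eq_append_getElem hi, List.flatMap_append, List.flatMap_singleton]

theorem moveOutput_vert (hS : M.Straight) (r : Fin n) (k : ℕ) :
    moveOutput (r, M.vert r k) = if M.Hz r then [((r : ℕ) : ℤ), M.line r, M.cmov r (M.vert r k)]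
      else [((r : ℕ) : ℤ), M.cmov r (M.vert r k), M.line r] := by
  rw [← hS.line_vert r k]
  unfold moveOutput cfix cmov
  by_cases h : M.Hz r
  · simp only [if_pos h]
  · simp only [if_neg h]

theorem tot_emitMove (hS : M.Straight) (h : M.Pool c ms s) {i : ℕ} (hi : i < ms.length)
    (hs : s'.arr = s.arr) (h16 : s'.reg 16 = i) :
    Tot emitMove s' fun s'' T => T ≤ 8 ∧ s''.arr = s.arr ∧ s''.reg 0 = s'.reg 0 ∧
      s''.reg 24 = s'.reg 24 ∧ s''.reg 16 = s'.reg 16 ∧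
      s''.out = s'.out ++ moveOutput (ms[i].1, M.vert ms[i].1 ms[i].2) := by
  obtain ⟨h1, h2⟩ := h.buf i hi
  have hrow := h.known.row ms[i].1
  have h3 := h.tables.mov ms[i].1 ms[i].2 (h.ms_le _ (List.getElem_mem hi))
  rw [moveOutput_vert hS]
  simp only [emitMove, tot_block_cons, tot_block_nil, tot_ite, tot_assign, tot_emit, Expr.eval,
    Test.holds, rX, rJ, rM, aBuf, aMov, aRob, State.setReg_reg, State.setReg_arr, State.setReg_out,
    State.emit_reg, State.emit_arr, State.emit_out, Nat.reduceEqDiff, if_true, if_false, h16, hs,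
    h1, h2, h3, hrow.hz, hrow.line]
  by_cases hz : M.Hz ms[i].1
  · simp only [if_pos hz]
    simp
  · simp only [if_neg hz]
    simp

theorem tot_emitTarget {r : Fin n} (hs : s.arr 0 = inputArray M) (h3 : s.reg 3 = r) :
    Tot emitTarget s fun s' T => T ≤ 4 ∧ s'.arr = s.arr ∧ s'.reg = s.reg ∧
      s'.out = s.out ++ moveOutput (r, M.trg r) := by
  obtain ⟨-, -, e2, e3⟩ := inputArray_apply (M := M) r
  simp only [emitTarget, tot_block_cons, tot_block_nil, tot_emit, Expr.eval, rR, aIn,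
    State.emit_reg, State.emit_arr, State.emit_out, h3, hs, e2, e3, moveOutput]
  simp

theorem planOutput_fullPlan : planOutput (M.fullPlan ms) =
    (1 :: ms.flatMap fun m => moveOutput (m.1, M.vert m.1 m.2)) ++
      (List.finRange n).flatMap fun r => moveOutput (r, M.trg r) := by
  simp [planOutput, fullPlan, moveOutput, List.flatMap_append, List.flatMap_map]

theorem tot_report (hS : M.Straight) (h : M.Pool c ms s) :
    Tot report s fun s' T => T ≤ ms.length * 11 + n * 7 + 10 ∧
      s'.out = planOutput (M.fullPlan ms) := by
  have h5 := h.fail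
  have hn := h.known.reg_n
  have h24 := h.cnt
  have hout := h.known.out
  simp only [report, tot_ite, tot_block_cons, tot_block_nil, tot_emit, Test.holds, Expr.eval, rFail]
  refine ⟨fun _ => ?_, fun h => absurd h5 h⟩
  refine (tot_forLoop ms.length 8 (fun i m s' => m = 0 ∧ s'.arr = s.arr ∧ s'.reg 0 = n ∧
    s'.reg 24 = ms.length ∧ s'.reg 16 = i ∧
    s'.out = 1 :: (ms.take i).flatMap fun m => moveOutput (m.1, M.vert m.1 m.2)) ?_ ?_ (m := 0)
    ?_).mono ?_
  · rintro i m s' ⟨rfl, h1, h2, h3, h4, h6⟩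
    exact ⟨h4, h3⟩
  · rintro i m s' hi ⟨rfl, h1, h2, h3, h4, h6⟩
    refine (tot_emitMove hS h hi h1 h4).mono ?_
    rintro s'' T ⟨g1, g2, g3, g4, g5, g6⟩
    refine ⟨0, ⟨rfl, g2, by simp [g3, h2], by simp [g4, h3], by simp [g5, h4], ?_⟩, by omega⟩
    rw [flatMap_take_succ _ _ hi, State.setReg_out, g6, h6, List.cons_append]
  · simp [hn, h24, hout]
  rintro s1 T1 ⟨m, ⟨rfl, h1, h2, h3, h4, h6⟩, h7⟩
  rw [List.take_length] at h6
  have hin : s1.arr 0 = inputArray M := by rw [h1]; exact h.known.input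
  refine (tot_forLoop n 4 (fun i m s' => m = 0 ∧ s'.arr = s1.arr ∧ s'.reg 0 = n ∧
    s'.reg 3 = i ∧
    s'.out = s1.out ++ ((List.finRange n).take i).flatMap fun r => moveOutput (r, M.trg r)) ?_ ?_
    (m := 0) ?_).mono ?_
  · rintro i m s' ⟨rfl, h1, h2, h3, h4⟩
    exact ⟨h3, h2⟩
  · rintro i m s' hi ⟨rfl, h1, h2, h3, h4⟩
    refine (tot_emitTarget (M := M) (r := ⟨i, hi⟩) (by rw [h1, hin]) h3).mono ?_
    rintro s'' T ⟨g1, g2, g3, g4⟩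
    refine ⟨0, ⟨rfl, g2.trans h1, by simp [g3, h2], by simp [g3, h3], ?_⟩, by omega⟩
    rw [flatMap_take_succ _ _ (by simpa using hi), State.setReg_out, g4, h4, List.append_assoc]
    simp
  · simp [h2]
  rintro s2 T2 ⟨m, ⟨rfl, g1, g2, g3, g4⟩, g5⟩
  rw [List.take_of_length_le (by simp), h6] at g4
  exact ⟨by omega, by rw [g4, planOutput_fullPlan]⟩

theorem tot_planner (hS : M.Straight) (hN : M.NonBlockingTargets) (hm : M.vertexMultiplicity ≤ 2) :
    Tot planner (inputState M) fun s T => T ≤ 1000 * (n ^ 2 + 1) ∧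
      ((∃ ms plan, M.Expands start ms plan ∧ M.IsSolution plan ∧ s.out = planOutput ms) ∨
        ((¬ ∃ plan, M.IsSolution plan) ∧ s.out = noSolutionOutput)) := by
  simp only [planner, tot_block_cons, tot_block_nil, tot_ite, tot_skip, Test.holds, Expr.eval,
    rFail]
  refine tot_readInput.mono ?_
  rintro s1 T1 ⟨g1, g2⟩
  refine (tot_comparePairs hS hN g2).mono ?_
  rintro s2 T2 ⟨g3, g4⟩
  have harith : ∀ T : ℕ, T ≤ 600 * (n * n) + 600 * n + 600 → T ≤ 1000 * (n ^ 2 + 1) := by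
    intro T hT
    have : n ≤ n * n := Nat.le_mul_self n
    rw [pow_two]
    nlinarith
  have hn1 : n * (n * 13 + 3 + 3) = 13 * (n * n) + 6 * n := by ring
  have hn2 : n * (11 * n + 12 + 3) = 11 * (n * n) + 15 * n := by ring
  have hn3 : 2 * n * (n + 2) = 2 * (n * n) + 4 * n := by ring
  refine ⟨fun h5 => ?_, fun h5 => ?_⟩
  · have hg : ∀ r u, M.Good r u := by
      rcases g4.fail with h | h
      · exact fun r u => h.2 r u trivial
      · omega
    have X := crossing_of_good hS hN hm hg
    refine (tot_walkRuns hS X g4 hg h5).mono ?_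
    rintro s3 T3 ⟨g5, g6⟩
    refine (tot_serveRobots X g6).mono ?_
    rintro s4 T4 ⟨g7, g8⟩
    rcases g8 with ⟨g8, g9, g10⟩ | ⟨c, ms, g8, g9, g10, g11⟩
    · simp only [report, tot_ite, tot_emit, Test.holds, Expr.eval, rFail]
      refine ⟨fun h => by omega, fun _ => ⟨harith _ (by omega), .inr ⟨g10, ?_⟩⟩⟩
      simp [g9, noSolutionOutput]
    · refine (tot_report hS g8).mono ?_
      rintro s5 T5 ⟨f1, f2⟩
      obtain ⟨plan, f3, f4⟩ := exists_solution X g8 g9 g10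
      exact ⟨harith _ (by omega), .inl ⟨_, plan, f3, f4, f2⟩⟩
  · simp only [report, tot_ite, tot_emit, Test.holds, Expr.eval, rFail]
    have h6 : s2.reg 5 = 1 ∧ ¬ ∃ plan, M.IsSolution plan := g4.fail.resolve_left fun h => h5 h.1
    refine ⟨fun h => absurd h h5, fun _ => ⟨harith _ (by omega), .inr ⟨h6.2, ?_⟩⟩⟩
    simp [g4.known.out, noSolutionOutput]

end MRMPGP

end MRMP

theorem mainTheorem3 :
    ∃ (P : MRMP.Program) (C : ℕ),
      ∀ (a b n : ℕ) (M : MRMP.MRMPGP (MRMP.gridGraph a b) n),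
        M.NonBlockingTargets → M.vertexMultiplicity ≤ 2 → M.Straight →
        ∃ (s : MRMP.State) (T : ℕ),
          MRMP.Run P (MRMP.inputState M) s T ∧
          T ≤ C * (n ^ 2 + 1) ∧
          ((∃ (ms : List (Fin n × (Fin a × Fin b))) (plan : List (Fin n)),
              M.Expands MRMP.MRMPGP.start ms plan ∧ M.IsSolution plan ∧
              s.out = MRMP.planOutput ms) ∨
            ((¬ ∃ plan : List (Fin n), M.IsSolution plan) ∧
              s.out = MRMP.noSolutionOutput)) := by
  refine ⟨MRMP.planner, 1000, fun a b n M hN hm hS => ?_⟩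
  obtain ⟨s, T, h1, h2⟩ := MRMP.MRMPGP.tot_planner hS hN hm
  exact ⟨s, T, h1, h2⟩
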